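/- Let $n\ge 1$, let $U\subset\mathbb{R}^n$ be a bounded domain (nonempty, open, connected) with $C^\infty$ boundary, let $0<s<1$, and let $d$ be a distance on $\mathbb{R}^n$ equivalent to the Euclidean one, i.e. $c|x-y|\le d(x,y)\le C|x-y|$ for some constants $c,C>0$. Write $U^c=\mathbb{R}^n\setminus U$ and $\operatorname{diam}_d(U)=\max_{x,y\in\overline U}d(x,y)$. For $1<p<\infty$ and measurable $u:\mathbb{R}^n\to\mathbb{R}$ put $$\mathcal H_{s,p}(u)=\iint_{\mathbb{R}^{2n}\setminus(U^c)^2}\frac{|u(x)-u(y)|^p}{d(x,y)^{n+ps}}\,dx\,dy,\qquad \mathcal H_{s,\infty}(u)=\sup_{(x,y)\in\mathbb{R}^{2n}\setminus(U^c)^2,\ x\ne y}\frac{|u(x)-u(y)|}{d(x,y)^s},$$ $$[\![u]\!]_{s,\infty}=\sup_{x,y\in U,\ x\neq y}\frac{|u(x)-u(y)|}{d(x,y)^s},$$ and let $\mathcal W^{s,p}(U)$ be the set of measurable $u:\mathbb{R}^n\to\mathbb{R}$ (modulo equality a.e.) with $\|u\|_{L^p(U)}^p+\mathcal H_{s,p}(u)<\infty$,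 $\mathcal W^{s,\infty}(U)$ the set of measurable $u:\mathbb{R}^n\to\mathbb{R}$ with $\|u\|_{L^\infty(U)}+\mathcal H_{s,\infty}(u)<\infty$, and $W^{s,\infty}(U)$ the set of measurable $u:U\to\mathbb{R}$ with $\|u\|_{L^\infty(U)}+[\![u]\!]_{s,\infty}<\infty$. Consider the eigenvalue problem $(-\Delta)_p^s u=\lambda|u|^{p-2}u$ in $U$, $\mathcal N_{s,p}u=0$ in $\mathbb{R}^n\setminus\overline U$, where $(-\Delta)^s_pu(x)=\mathrm{P.V.}\int_{\mathbb{R}^n}\frac{|u(x)-u(y)|^{p-2}(u(x)-u(y))}{d(x,y)^{n+sp}}dy$ and $\mathcal N_{s,p}u(x)$ is given by the same integral over $U$. It is understood weakly: $\lambda\in\mathbb{R}$ is an eigenvalue if there is $u\in\mathcal W^{s,p}(U)$, $u\ne0$, such that for all $v\in\mathcal W^{s,p}(U)$ $$\frac12\iint_{\mathbb{R}^{2n}\setminus(U^c)^2}\frac{|u(x)-u(y)|^{p-2}(u(x)-u(y))(v(x)-v(y))}{d(x,y)^{n+ps}}\,dx\,dy=\lambda\int_U|u|^{p-2}u\,v\,dx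 .$$ Quotients below whose denominator vanishes are read as $+\infty$. Then the following hold. (1) For every $1<p<\infty$, the smallest nonzero eigenvalue exists and is the finite number $$\lambda_{s,p}=\inf\left\{\frac{\mathcal H_{s,p}(v)}{2\|v\|_{L^p(U)}^p}:\ v\in\mathcal W^{s,p}(U)\setminus\{0\},\ \int_U|v|^{p-2}v\,dx=0\right\}.$$ (2) $$\lim_{p\to\infty}(\lambda_{s,p})^{1/p}=\frac{2}{(\operatorname{diam}_d(U))^s}=\Lambda_{s,\infty}:=\inf_{u\in\mathcal A}\frac{\mathcal H_{s,\infty}(u)}{\|u\|_{L^\infty(U)}},\qquad \mathcal A=\Big\{u\in\mathcal W^{s,\infty}(U)\setminus\{0\}:\ \sup_Uu+\inf_Uu=0\Big\},$$ and this number also equals $$\Lambda^N_{s,\infty}:=\inf\Big\{\frac{[\![u]\!]_{s,\infty}}{\|u\|_{L^\infty(U)}}:\ u\in W^{s,\infty}(U)\setminus\{0\},\ \sup_Uu+\inf_Uu=0\Big\}.$$ (3) Let $p_k\to\infty$ with $p_k>1$, and for each $k$ let $u_k$ be a minimizer of $\lambda_{s,p_k}$ with $\|u_k\|_{L^{p_k}(U)}=1$.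 Then there are a subsequence $(u_{k_j})$, each member of which agrees a.e. in $U$ with a continuous function on $\overline U$, and a function $u_\infty:\mathbb{R}^n\to\mathbb{R}$, continuous on $\overline U$, such that these continuous representatives converge to $u_\infty$ uniformly on $\overline U$, and $u_\infty|_U\in W^{s,\infty}(U)$ is a minimizer of $\Lambda^N_{s,\infty}$, while $u_\infty$ (with a suitable choice of its values outside $\overline U$) belongs to $\mathcal A$ and is a minimizer of $\Lambda_{s,\infty}$. -/

import Mathlib

open MeasureTheory Filter Topology
open scoped ENNReal ContDiff

noncomputable section

namespace FracNeumann

/-- Smooth bounded domain in `ℝⁿ`: nonempty, open, connected, bounded, and near each boundary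
point it is the negativity set of a smooth function with nonvanishing differential there. -/
structure IsSmoothBoundedDomain {n : ℕ} (U : Set (EuclideanSpace ℝ (Fin n))) : Prop where
  isOpen : IsOpen U
  isConnected : IsConnected U
  isBounded : Bornology.IsBounded U
  smooth_boundary : ∀ x ∈ frontier U, ∃ V ∈ 𝓝 x, ∃ ρ : EuclideanSpace ℝ (Fin n) → ℝ,
    ContDiff ℝ ∞ ρ ∧ fderiv ℝ ρ x ≠ 0 ∧ U ∩ V = {y | ρ y < 0} ∩ V

/-- `d` is a distance on `ℝⁿ` equivalent to the Euclidean one. -/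
structure IsEquivDistance {n : ℕ}
    (d : EuclideanSpace ℝ (Fin n) → EuclideanSpace ℝ (Fin n) → ℝ) : Prop where
  eq_zero_iff : ∀ x y, d x y = 0 ↔ x = y
  symm : ∀ x y, d x y = d y x
  triangle : ∀ x y z, d x z ≤ d x y + d y z
  equiv : ∃ c C : ℝ, 0 < c ∧ 0 < C ∧ ∀ x y, c * dist x y ≤ d x y ∧ d x y ≤ C * dist x y

variable {n : ℕ} (U : Set (EuclideanSpace ℝ (Fin n)))
  (d : EuclideanSpace ℝ (Fin n) → EuclideanSpace ℝ (Fin n) → ℝ) (s p : ℝ)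

/-- The diameter of the closure of `U` with respect to `d`. -/
def diamD : ℝ := sSup (Set.image2 d (closure U) (closure U))

/-- The set `ℝ²ⁿ \ (Uᶜ)²`. -/
def crossSet : Set (EuclideanSpace ℝ (Fin n) × EuclideanSpace ℝ (Fin n)) :=
  (Uᶜ ×ˢ Uᶜ)ᶜ

/-- The energy `𝓗_{s,p}(u)`, with values in `[0, ∞]`. -/
def energy (u : EuclideanSpace ℝ (Fin n) → ℝ) : ℝ≥0∞ :=
  ∫⁻ z in crossSet U, ENNReal.ofReal (|u z.1 - u z.2| ^ p / d z.1 z.2 ^ ((n : ℝ) + p * s))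

/-- `‖u‖_{L^p(U)}`, with values in `[0, ∞]`. -/
def normLp (u : EuclideanSpace ℝ (Fin n) → ℝ) : ℝ≥0∞ :=
  eLpNorm u (ENNReal.ofReal p) (volume.restrict U)

/-- `‖u‖_{L^∞(U)}`, with values in `[0, ∞]`. -/
def normLinf (u : EuclideanSpace ℝ (Fin n) → ℝ) : ℝ≥0∞ :=
  eLpNorm u ⊤ (volume.restrict U)

/-- The space `𝓦^{s,p}(U)` (as a set of functions on `ℝⁿ`). -/
def spaceW : Set (EuclideanSpace ℝ (Fin n) → ℝ) :=
  {u | AEMeasurable u volume ∧ normLp U p u ^ p + energy U d s p u < ⊤}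

/-- The form `𝓗_{s,p}(u, v)`. -/
def form (u v : EuclideanSpace ℝ (Fin n) → ℝ) : ℝ :=
  ∫ z in crossSet U, |u z.1 - u z.2| ^ (p - 2) * (u z.1 - u z.2) * (v z.1 - v z.2) /
    d z.1 z.2 ^ ((n : ℝ) + p * s)

/-- `u` is a weak solution of `(-Δ)_p^s u = μ |u|^{p-2} u` in `U`, `𝓝_{s,p} u = 0` outside the
closure of `U`. -/
def IsWeakSolution (μ : ℝ) (u : EuclideanSpace ℝ (Fin n) → ℝ) : Prop :=
  u ∈ spaceW U d s p ∧ ∀ v ∈ spaceW U d s p,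
    1 / 2 * form U d s p u v = μ * ∫ x in U, |u x| ^ (p - 2) * u x * v x

/-- `μ` is a fractional Neumann `p`-eigenvalue: there is a weak solution that is nontrivial, i.e.
does not vanish almost everywhere. -/
def IsEigenvalue (μ : ℝ) : Prop :=
  ∃ u, IsWeakSolution U d s p μ u ∧ ¬ u =ᵐ[volume] 0

/-- The competitors: nonzero `v ∈ 𝓦^{s,p}(U)` with `∫_U |v|^{p-2} v = 0`. -/
def admissible : Set (EuclideanSpace ℝ (Fin n) → ℝ) :=
  {v | v ∈ spaceW U d s p ∧ ¬ v =ᵐ[volume] 0 ∧ ∫ x in U, |v x| ^ (p - 2) * v x = 0}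

/-- The quotient `𝓗_{s,p}(v) / (2 ‖v‖_{L^p(U)}^p)`; it is `∞` for a competitor that vanishes
almost everywhere in `U`. -/
def quotient (v : EuclideanSpace ℝ (Fin n) → ℝ) : ℝ≥0∞ :=
  energy U d s p v / (2 * normLp U p v ^ p)

/-- The infimum `λ_{s,p}` of the quotient. -/
def lam : ℝ≥0∞ := ⨅ v ∈ admissible U d s p, quotient U d s p v

/-- `v` is a minimizer of `λ_{s,p}`. -/
def IsMinimizer (v : EuclideanSpace ℝ (Fin n) → ℝ) : Prop :=
  v ∈ admissible U d s p ∧ quotient U d s p v = lam U d s p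

/-- The supremum of `|u(x) - u(y)| / d(x,y)^s` over pairs `(x, y)` in `S`, with values in `[0, ∞]`
(diagonal pairs contribute `0`). -/
def holderSup (S : Set (EuclideanSpace ℝ (Fin n) × EuclideanSpace ℝ (Fin n)))
    (u : EuclideanSpace ℝ (Fin n) → ℝ) : ℝ≥0∞ :=
  ⨆ z ∈ S, ENNReal.ofReal (|u z.1 - u z.2| / d z.1 z.2 ^ s)

/-- `𝓗_{s,∞}(u)`: the supremum is over `ℝ²ⁿ \ (Uᶜ)²`. -/
def energyInf (u : EuclideanSpace ℝ (Fin n) → ℝ) : ℝ≥0∞ :=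
  holderSup d s (crossSet U) u

/-- The intrinsic seminorm of `W^{s,∞}(U)`: the supremum is over `U × U`. -/
def seminormInf (u : EuclideanSpace ℝ (Fin n) → ℝ) : ℝ≥0∞ :=
  holderSup d s (U ×ˢ U) u

/-- The condition `sup_U u + inf_U u = 0` (both being finite). -/
def SupAddInfZero (u : EuclideanSpace ℝ (Fin n) → ℝ) : Prop :=
  ∃ M m : ℝ, IsLUB (u '' U) M ∧ IsGLB (u '' U) m ∧ M + m = 0

/-- The class `𝓐`: nonzero `u ∈ 𝓦^{s,∞}(U)` with `sup_U u + inf_U u = 0`. -/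
def classA : Set (EuclideanSpace ℝ (Fin n) → ℝ) :=
  {u | AEMeasurable u volume ∧ normLinf U u + energyInf U d s u < ⊤ ∧ u ≠ 0 ∧
    SupAddInfZero U u}

/-- `Λ_{s,∞}`; the quotient is `∞` for members of `𝓐` that vanish on `U`. -/
def LambdaInf : ℝ≥0∞ := ⨅ u ∈ classA U d s, energyInf U d s u / normLinf U u

/-- The nonzero `u ∈ W^{s,∞}(U)` with `sup_U u + inf_U u = 0`; only values on `U` matter. -/
def classAN : Set (EuclideanSpace ℝ (Fin n) → ℝ) :=
  {u | AEMeasurable u (volume.restrict U) ∧ normLinf U u + seminormInf U d s u < ⊤ ∧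
    (∃ x ∈ U, u x ≠ 0) ∧ SupAddInfZero U u}

/-- `Λ^N_{s,∞}` in variational form. -/
def LambdaNInf : ℝ≥0∞ := ⨅ u ∈ classAN U d s, seminormInf U d s u / normLinf U u

end FracNeumann

end

/-!
Let `κ` be the measure `d(x, y) ^ (-(n + p s)) dx dy` on `ℝ²ⁿ \ (Uᶜ)²` (`pairMeasure`). The energy
of `u` is `∫ |Du| ^ p dκ` with `Du (x, y) = u x - u y` (`pairDiff`), so that everything about
`λ_{s,p}` becomes a statement about the two functionals `∫ |u| ^ p` over `U` and `∫ |Du| ^ p` over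
`κ`.

**Regularity from averages.** A smooth domain fills a fixed proportion of each small ball centred
in it (`IsSmoothBoundedDomain.exists_density`). By Jensen's inequality the oscillation of the
averages of `u` over `U ∩ B(x, r)` is controlled by the energy. At a fixed scale this gives
compactness of energy-bounded sets in `L ^ p(U)` (`exists_subseq_tendsto_eLpNorm`); telescoping
over the scales gives a Hölder estimate of exponent `s / 2`, with a constant that serves all large
`p` (`exists_holder_representative`).

**The eigenvalue.** The constraint `∫_U |v| ^ (p - 2) v = 0` says by convexity that
`‖v‖ ≤ ‖v - c‖` in `L ^ p(U)` for every constant `c` (`integral_eq_zero_iff_forall_le`), hence it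
is closed in `L ^ p(U)`. A minimizing sequence converges in `L ^ p(U)`, and its differences
converge in `L ^ p(κ)` by a qualitative form of uniform convexity (`exists_tendsto_of_midpoints`).
Since almost every `x ∈ U` is paired with almost every `y ∈ ℝⁿ`, fixing one good `x` yields an
almost everywhere limit on all of `ℝⁿ`, which is a minimizer (`exists_minimizer`). For the
Euler–Lagrange equation, the competitor `u + t v` is shifted by its best constant; the resulting
inequality between two functions of `t` that agree at `t = 0` forces their derivatives to agree
(`form_eq_of_minimizer`). Conversely, testing an eigenfunction of a nonzero eigenvalue with `1`
and with itself shows that it is admissible with quotient equal to the eigenvalue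
(`lam_le_of_isEigenvalue`).

**The limit `p → ∞`.** Put `D = diam_d(U)`. The truncated cone `2 min(d(x, x₀), D) / D - 1`, with
`x₀` an end point of a diameter, has Hölder constant `2 / D ^ s`; its energy is at most a constant
times the `p`-th power of that number (`exists_energy_le`), whence
`limsup λ ^ (1 / p) ≤ 2 / D ^ s`. For the lower bound, normalized minimizers converge uniformly
along a subsequence by the uniform Hölder estimate. Comparing averages over small balls, the limit
has Hölder constant `L = lim λ ^ (1 / p)` with respect to `d` (`abs_sub_le_of_tendsto`); the
constraint becomes `sup + inf = 0` (`le_of_constraint`) and the normalization gives `sup ≥ 1`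
(`exists_lt_abs_of_normalized`). As the function oscillates by at least `2` over a set of diameter
`D`, `2 ≤ L D ^ s`. Hence `L = 2 / D ^ s`, the limit is extremal for both `Λ` problems, and
McShane's extension with respect to `d ^ s` gives its values outside the closure of `U`.
-/

namespace FracNeumann

/-! ### The functional `∫ |f| ^ p` on a general measure space -/

section Lp

variable {α : Type*} {m : MeasurableSpace α} {μ : Measure α} {p : ℝ} {f g : α → ℝ}

lemma ofReal_ne_zero_of_one_lt (hp : 1 < p) : ENNReal.ofReal p ≠ 0 := by
  simp; linarith

lemma toReal_ofReal_of_one_lt (hp : 1 < p) : (ENNReal.ofReal p).toReal = p :=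
  ENNReal.toReal_ofReal (by linarith)

lemma enorm_rpow_eq_ofReal (hp : 1 < p) (x : ℝ) : ‖x‖ₑ ^ p = ENNReal.ofReal (|x| ^ p) := by
  rw [Real.enorm_eq_ofReal_abs, ENNReal.ofReal_rpow_of_nonneg (abs_nonneg x) (by linarith)]

lemma eLpNorm_rpow_eq_lintegral (hp : 1 < p) (f : α → ℝ) :
    eLpNorm f (ENNReal.ofReal p) μ ^ p = ∫⁻ x, ENNReal.ofReal (|f x| ^ p) ∂μ := by
  rw [eLpNorm_eq_lintegral_rpow_enorm_toReal (ofReal_ne_zero_of_one_lt hp) ENNReal.ofReal_ne_top,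
    toReal_ofReal_of_one_lt hp, ← ENNReal.rpow_mul, one_div_mul_cancel (by linarith),
    ENNReal.rpow_one]
  simp_rw [enorm_rpow_eq_ofReal hp]

lemma integrable_abs_rpow (hp : 1 < p) (hf : MemLp f (ENNReal.ofReal p) μ) :
    Integrable (fun x => |f x| ^ p) μ := by
  have := hf.integrable_norm_rpow (ofReal_ne_zero_of_one_lt hp) ENNReal.ofReal_ne_top
  simpa [toReal_ofReal_of_one_lt hp] using! this

lemma eLpNorm_rpow_eq_integral (hp : 1 < p) (hf : MemLp f (ENNReal.ofReal p) μ) :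
    eLpNorm f (ENNReal.ofReal p) μ ^ p = ENNReal.ofReal (∫ x, |f x| ^ p ∂μ) := by
  rw [eLpNorm_rpow_eq_lintegral hp, ofReal_integral_eq_lintegral_ofReal (integrable_abs_rpow hp hf)
    (Eventually.of_forall fun x => by positivity)]

lemma integral_abs_rpow_eq (hp : 1 < p) (hf : MemLp f (ENNReal.ofReal p) μ) :
    ∫ x, |f x| ^ p ∂μ = (eLpNorm f (ENNReal.ofReal p) μ).toReal ^ p := by
  rw [ENNReal.toReal_rpow, eLpNorm_rpow_eq_integral hp hf, ENNReal.toReal_ofReal]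
  exact integral_nonneg fun x => by positivity

lemma integral_abs_rpow_nonneg (f : α → ℝ) : 0 ≤ ∫ x, |f x| ^ p ∂μ :=
  integral_nonneg fun x => by positivity

lemma aestronglyMeasurable_abs_rpow_mul (hf : AEStronglyMeasurable f μ) (q : ℝ) :
    AEStronglyMeasurable (fun x => |f x| ^ q * f x) μ :=
  ((hf.aemeasurable.norm.pow_const q).mul hf.aemeasurable).aestronglyMeasurable

lemma abs_abs_rpow_mul_self (hp : 1 < p) (a : ℝ) : |(|a| ^ (p - 2) * a)| = |a| ^ (p - 1) := by
  rw [abs_mul, abs_of_nonneg (by positivity)]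
  -- at `a = 0` the factor `a` annihilates the value of `|a| ^ (p - 2)`, even if `p ≤ 2`
  rcases eq_or_ne a 0 with rfl | ha
  · simp [Real.zero_rpow (by linarith : p - 1 ≠ 0)]
  · have : 0 < |a| := abs_pos.2 ha
    nth_rw 2 [← Real.rpow_one |a|]
    rw [← Real.rpow_add this]; congr 1; ring

lemma abs_rpow_mul_self_mul_self (hp : 1 < p) (a : ℝ) : |a| ^ (p - 2) * a * a = |a| ^ p := by
  rcases eq_or_ne a 0 with rfl | ha
  · simp [Real.zero_rpow (by linarith : p ≠ 0)]
  · have : 0 < |a| := abs_pos.2 ha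
    rw [mul_assoc, ← abs_mul_abs_self a, ← pow_two, ← Real.rpow_natCast, ← Real.rpow_add this]
    congr 1; push_cast; ring

/-- The derivative of `t ↦ |a + t b| ^ p` for `|t| ≤ 1` is dominated independently of `t`. -/
lemma abs_deriv_le (hp : 1 < p) (a b t : ℝ) (ht : |t| ≤ 1) :
    |p * |a + t * b| ^ (p - 2) * (a + t * b) * b| ≤ p * (|a| + |b|) ^ p := by
  have h1 : p * |a + t * b| ^ (p - 2) * (a + t * b) * b
    = p * ((|a + t * b| ^ (p - 2) * (a + t * b)) * b) := by ring
  rw [h1, abs_mul, abs_of_pos (by linarith : 0 < p), abs_mul, abs_abs_rpow_mul_self hp]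
  have h2 : |a + t * b| ≤ |a| + |b| := by
    refine (abs_add_le _ _).trans ?_
    rw [abs_mul]
    nlinarith [abs_nonneg b]
  have h3 : |a + t * b| ^ (p - 1) ≤ (|a| + |b|) ^ (p - 1) :=
    Real.rpow_le_rpow (abs_nonneg _) h2 (by linarith)
  have h0 : 0 ≤ |a| + |b| := by positivity
  have h4 : (|a| + |b|) ^ p = (|a| + |b|) ^ (p - 1) * (|a| + |b|) := by
    nth_rw 3 [← Real.rpow_one (|a| + |b|)]
    rw [← Real.rpow_add_of_nonneg h0 (by linarith) (by norm_num)]; congr 1; ring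
  rw [h4]
  have : 0 ≤ p := by linarith
  gcongr
  linarith [abs_nonneg a]

lemma integrable_abs_add_abs_rpow (hp : 1 < p) (hf : MemLp f (ENNReal.ofReal p) μ)
    (hg : MemLp g (ENNReal.ofReal p) μ) : Integrable (fun x => (|f x| + |g x|) ^ p) μ := by
  have := integrable_abs_rpow hp (hf.norm.add hg.norm)
  refine this.congr (Eventually.of_forall fun x => ?_)
  simp only [Pi.add_apply, Real.norm_eq_abs]
  rw [abs_of_nonneg (by positivity)]

/-- `t ↦ ∫ |f + t g| ^ p` is differentiable at `0` along `L ^ p` functions. -/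
lemma hasDerivAt_integral_abs_rpow (hp : 1 < p) (hf : MemLp f (ENNReal.ofReal p) μ)
    (hg : MemLp g (ENNReal.ofReal p) μ) :
    Integrable (fun x => |f x| ^ (p - 2) * f x * g x) μ ∧
    HasDerivAt (fun t : ℝ => ∫ x, |f x + t * g x| ^ p ∂μ)
      (p * ∫ x, |f x| ^ (p - 2) * f x * g x ∂μ) 0 := by
  have hfm := hf.1
  have hgm := hg.1
  have key := hasDerivAt_integral_of_dominated_loc_of_deriv_le (μ := μ) (𝕜 := ℝ) (x₀ := (0 : ℝ))
    (s := Metric.ball 0 1) (F := fun t x => |f x + t * g x| ^ p)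
    (F' := fun t x => p * |f x + t * g x| ^ (p - 2) * (f x + t * g x) * g x)
    (bound := fun x => p * (|f x| + |g x|) ^ p) (Metric.ball_mem_nhds _ one_pos)
    (Eventually.of_forall fun t =>
      ((hfm.add (hgm.const_mul t)).aemeasurable.norm.pow_const p).aestronglyMeasurable)
    (by simpa using integrable_abs_rpow hp hf)
    (by
      simp only [zero_mul, add_zero]
      have := ((aestronglyMeasurable_abs_rpow_mul hfm (p - 2)).const_mul p).mul hgm
      refine this.congr (Eventually.of_forall fun x => ?_)
      simp only [Pi.mul_apply]; ring)
    (Eventually.of_forall fun x t ht => by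
      simp only [Real.norm_eq_abs]
      exact abs_deriv_le hp _ _ _ (by simpa using (le_of_lt (Metric.mem_ball.1 ht))))
    ((integrable_abs_add_abs_rpow hp hf hg).const_mul p)
    (Eventually.of_forall fun x t ht => by
      have h1 := hasDerivAt_abs_rpow (f x + t * g x) hp
      have h2 : HasDerivAt (fun t : ℝ => f x + t * g x) (g x) t := by
        simpa using ((hasDerivAt_id t).mul_const (g x)).const_add (f x)
      exact h1.comp t h2)
  have h0 : (fun x => p * |f x + 0 * g x| ^ (p - 2) * (f x + 0 * g x) * g x)
      = fun x => p * (|f x| ^ (p - 2) * f x * g x) := by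
    ext x; simp; ring
  obtain ⟨h1, h2⟩ := key
  rw [h0] at h1 h2
  refine ⟨?_, ?_⟩
  · have := h1.const_mul p⁻¹
    refine this.congr (Eventually.of_forall fun x => ?_)
    have : p ≠ 0 := by linarith
    simp only
    field_simp
  · rwa [integral_const_mul] at h2

/-- The tangent-line inequality for the convex function `|·| ^ p`. -/
lemma abs_rpow_add_ge (hp : 1 < p) (a h : ℝ) :
    |a| ^ p + p * (|a| ^ (p - 2) * a * h) ≤ |a + h| ^ p := by
  have hconv : ConvexOn ℝ Set.univ (fun x : ℝ => |x| ^ p) := by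
    refine ConvexOn.comp (g := fun x : ℝ => x ^ p) (f := fun x : ℝ => |x|)
      (((convexOn_rpow hp.le)).subset ?_ ?_) (convexOn_norm convex_univ) ?_
    · rintro _ ⟨x, -, rfl⟩; exact abs_nonneg x
    · rw [Set.image_univ]
      have : Set.range (fun x : ℝ => |x|) = Set.Ici 0 := by
        ext y; constructor
        · rintro ⟨x, rfl⟩; exact abs_nonneg x
        · intro hy; exact ⟨y, abs_of_nonneg hy⟩
      rw [this]; exact convex_Ici 0
    · rintro _ ⟨x, -, rfl⟩ _ ⟨y, -, rfl⟩ hxy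
      exact Real.rpow_le_rpow (abs_nonneg _) hxy (by linarith)
  have hd := hasDerivAt_abs_rpow a hp
  rcases lt_trichotomy h 0 with hh | rfl | hh
  · have := hconv.slope_le_of_hasDerivAt (x := a + h) (y := a) trivial trivial (by linarith) hd
    rw [slope_def_field, div_le_iff₀ (by linarith)] at this
    nlinarith
  · simp
  · have := hconv.le_slope_of_hasDerivAt (x := a) (y := a + h) trivial trivial (by linarith) hd
    rw [slope_def_field, le_div_iff₀ (by linarith)] at this
    nlinarith

/-- The tangent-line inequality, integrated. -/
lemma integral_abs_rpow_add_ge (hp : 1 < p) (hf : MemLp f (ENNReal.ofReal p) μ)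
    (hg : MemLp g (ENNReal.ofReal p) μ) :
    ∫ x, |f x| ^ p ∂μ + p * ∫ x, |f x| ^ (p - 2) * f x * g x ∂μ ≤ ∫ x, |f x + g x| ^ p ∂μ := by
  have h1 := (hasDerivAt_integral_abs_rpow hp hf hg).1
  have h2 := integrable_abs_rpow hp hf
  have h3 := integrable_abs_rpow hp (hf.add hg)
  rw [← integral_const_mul, ← integral_add h2 (h1.const_mul p)]
  exact integral_mono (h2.add (h1.const_mul p)) h3 fun x => abs_rpow_add_ge hp _ _

variable [IsFiniteMeasure μ]

/-- The orthogonality condition says that `0` is a best constant approximation in `L ^ p`. -/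
lemma integral_eq_zero_iff_forall_le (hp : 1 < p) (hf : MemLp f (ENNReal.ofReal p) μ) :
    ∫ x, |f x| ^ (p - 2) * f x ∂μ = 0 ↔ ∀ c : ℝ, ∫ x, |f x| ^ p ∂μ ≤ ∫ x, |f x - c| ^ p ∂μ := by
  constructor
  · intro h c
    have := integral_abs_rpow_add_ge hp hf (memLp_const (-c))
    rw [integral_mul_const, h] at this
    simpa [sub_eq_add_neg] using this
  · intro h
    have hd := (hasDerivAt_integral_abs_rpow hp hf (memLp_const (1 : ℝ))).2
    have hmin : IsLocalMin (fun t : ℝ => ∫ x, |f x + t * 1| ^ p ∂μ) 0 :=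
      Eventually.of_forall fun t => by
        have := h (-t)
        simpa using this
    have := hmin.hasDerivAt_eq_zero hd
    have hp0 : p ≠ 0 := by linarith
    simpa [hp0] using this

/-- Every `L ^ p` function has a best constant approximation. -/
lemma exists_best_constant (hp : 1 < p) (hf : MemLp f (ENNReal.ofReal p) μ) :
    ∃ c : ℝ, ∫ x, |f x - c| ^ (p - 2) * (f x - c) ∂μ = 0 := by
  rcases eq_or_ne μ 0 with rfl | hμ
  · exact ⟨0, by simp⟩
  have : NeZero μ := ⟨hμ⟩
  have hmem : ∀ c : ℝ, MemLp (fun x => f x - c) (ENNReal.ofReal p) μ := fun c =>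
    hf.sub (memLp_const c)
  -- the `p`-th power of the distance to the constant `c` is continuous and coercive in `c`
  set N : ℝ → ℝ := fun c => ∫ x, |f x - c| ^ p ∂μ with hN
  have hcont : Continuous N := by
    rw [continuous_iff_continuousAt]
    intro c
    have := (hasDerivAt_integral_abs_rpow hp (hmem c) (memLp_const (-1 : ℝ))).2.continuousAt
    have h2 : ContinuousAt (fun c' : ℝ => c' - c) c := by fun_prop
    have h3 := ContinuousAt.comp (x := c) (f := fun c' : ℝ => c' - c)
      (g := fun t : ℝ => ∫ x, |f x - c + t * (-1)| ^ p ∂μ) (by simpa using this) h2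
    refine h3.congr (Eventually.of_forall fun c' => ?_)
    simp only [hN, Function.comp]
    congr 1; ext x; congr 2; ring
  have hV : 0 < μ.real Set.univ := by
    simp [measureReal_def, ENNReal.toReal_pos_iff, hμ, Measure.measure_univ_pos, measure_lt_top]
  -- coercivity: `|c| ^ p ≤ 2 ^ p (|f - c| ^ p + |f| ^ p)`
  have hlow : ∀ c : ℝ, (2 ^ p)⁻¹ * |c| ^ p * μ.real Set.univ - ∫ x, |f x| ^ p ∂μ ≤ N c := by
    intro c
    have hpt : ∀ x, (2 ^ p)⁻¹ * |c| ^ p - |f x| ^ p ≤ |f x - c| ^ p := by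
      intro x
      have h1 : |c| ≤ 2 * max |f x| |f x - c| := by
        have : |c| ≤ |f x| + |f x - c| := by
          have := abs_sub_abs_le_abs_sub c (f x)
          rw [abs_sub_comm] at this
          linarith
        linarith [le_max_left |f x| |f x - c|, le_max_right |f x| |f x - c|]
      have h2 : |c| ^ p ≤ 2 ^ p * (max |f x| |f x - c|) ^ p := by
        rw [← Real.mul_rpow (by norm_num) (by positivity)]
        exact Real.rpow_le_rpow (abs_nonneg _) h1 (by linarith)
      have h3 : (max |f x| |f x - c|) ^ p ≤ |f x| ^ p + |f x - c| ^ p := by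
        have ha : 0 ≤ |f x| ^ p := by positivity
        have hb : 0 ≤ |f x - c| ^ p := by positivity
        rcases max_cases |f x| |f x - c| with ⟨h, -⟩ | ⟨h, -⟩ <;> rw [h] <;> linarith
      have h4 : (2 ^ p)⁻¹ * |c| ^ p ≤ (max |f x| |f x - c|) ^ p := by
        rw [inv_mul_le_iff₀ (by positivity)]; exact h2
      linarith
    have := integral_mono ((integrable_const ((2 ^ p)⁻¹ * |c| ^ p)).sub
      (integrable_abs_rpow hp hf)) (integrable_abs_rpow hp (hmem c)) hpt
    simp only [Pi.sub_apply] at this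
    rw [integral_sub (integrable_const _) (integrable_abs_rpow hp hf)] at this
    simp only [integral_const, smul_eq_mul] at this
    linarith
  have htend : Tendsto N (cocompact ℝ) atTop := by
    refine tendsto_atTop_mono hlow ?_
    refine tendsto_atTop_add_const_right _ _ ?_
    refine Tendsto.atTop_mul_const hV ?_
    refine Tendsto.const_mul_atTop (by positivity) ?_
    exact (tendsto_rpow_atTop (by linarith)).comp tendsto_norm_cocompact_atTop
  obtain ⟨c, hc⟩ := hcont.exists_forall_le htend
  refine ⟨c, (integral_eq_zero_iff_forall_le hp (hmem c)).2 fun c' => ?_⟩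
  have := hc (c + c')
  simpa [hN, sub_sub] using this

end Lp

/-! ### A qualitative form of the uniform convexity of `L ^ p` -/

section UniformConvexity

variable {α : Type*} {m : MeasurableSpace α} {μ : Measure α} {p : ℝ}

lemma abs_midpoint_rpow_lt (hp : 1 < p) {a b : ℝ} (hab : a ≠ b) :
    |(a + b) / 2| ^ p < (|a| ^ p + |b| ^ p) / 2 := by
  rcases eq_or_ne |a| |b| with h | h
  · -- here `b = -a ≠ 0`
    have hb : b = -a := by
      rcases abs_eq_abs.1 h with h | h
      · exact absurd h hab
      · rw [h]; ring
    subst hb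
    have ha : a ≠ 0 := by rintro rfl; simp at hab
    have : 0 < |a| ^ p := Real.rpow_pos_of_pos (abs_pos.2 ha) p
    simp [Real.zero_rpow (by linarith : p ≠ 0)]
    linarith
  · have h1 := (strictConvexOn_rpow hp).2 (abs_nonneg a) (abs_nonneg b) h
      (by norm_num : (0 : ℝ) < 1 / 2) (by norm_num : (0 : ℝ) < 1 / 2) (by norm_num)
    have h2 : |(a + b) / 2| ≤ (1 / 2 : ℝ) • |a| + (1 / 2 : ℝ) • |b| := by
      rw [abs_div, abs_two, smul_eq_mul, smul_eq_mul]
      linarith [abs_add_le a b]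
    have h3 := Real.rpow_le_rpow (abs_nonneg _) h2 (by linarith : 0 ≤ p)
    simp only [smul_eq_mul] at h1 h3
    linarith

/-- By homogeneity and compactness of a sphere in `ℝ²`, the convexity defect of `|·| ^ p` controls
`|a - b| ^ p` up to an arbitrarily small multiple of `|a| ^ p + |b| ^ p`. -/
lemma exists_convexity_defect_bound (hp : 1 < p) {ε : ℝ} (hε : 0 < ε) :
    ∃ C : ℝ, 0 ≤ C ∧ ∀ a b : ℝ, |a - b| ^ p ≤ ε * (|a| ^ p + |b| ^ p) +
      C * ((|a| ^ p + |b| ^ p) / 2 - |(a + b) / 2| ^ p) := by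
  have hp0 : 0 ≤ p := by linarith
  set φ : ℝ × ℝ → ℝ := fun z => (|z.1| ^ p + |z.2| ^ p) / 2 - |(z.1 + z.2) / 2| ^ p with hφ
  have cpow : ∀ {f : ℝ × ℝ → ℝ}, Continuous f → Continuous fun z => |f z| ^ p := fun hf =>
    hf.abs.rpow_const fun _ => Or.inr hp0
  have hφc : Continuous φ := by
    have h1 := cpow (f := fun z => z.1) continuous_fst
    have h2 := cpow (f := fun z => z.2) continuous_snd
    have h3 := cpow (f := fun z => (z.1 + z.2) / 2) (by fun_prop)
    exact ((h1.add h2).div_const 2).sub h3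
  have hφ0 : ∀ z, 0 ≤ φ z := by
    rintro ⟨a, b⟩
    rcases eq_or_ne a b with rfl | h
    · simp [hφ]
    · have := abs_midpoint_rpow_lt hp h
      simp only [hφ]; linarith
  -- the part of the unit sphere where `|a - b| ^ p` is not small
  set K : Set (ℝ × ℝ) := Metric.sphere 0 1 ∩ {z | ε ≤ |z.1 - z.2| ^ p} with hK
  have hKc : IsCompact K := (isCompact_sphere _ _).inter_right
    (isClosed_le continuous_const (cpow (f := fun z => z.1 - z.2) (by fun_prop)))
  have hφpos : ∀ z ∈ K, 0 < φ z := by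
    rintro ⟨a, b⟩ ⟨-, hz⟩
    have hab : a ≠ b := by
      rintro rfl
      simp [Real.zero_rpow (by linarith : p ≠ 0)] at hz
      linarith
    have := abs_midpoint_rpow_lt hp hab
    simp only [hφ]; linarith
  obtain ⟨δ, hδ, hδK⟩ : ∃ δ > 0, ∀ z ∈ K, δ ≤ φ z := by
    rcases K.eq_empty_or_nonempty with h | h
    · exact ⟨1, one_pos, by simp [h]⟩
    · obtain ⟨z, hz, hmin⟩ := hKc.exists_isMinOn h hφc.continuousOn
      exact ⟨φ z, hφpos z hz, fun w hw => hmin hw⟩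
  -- on the unit sphere `|a - b| ^ p ≤ 2 ^ p`, and on `K` the defect is at least `δ`
  refine ⟨2 ^ p / δ, by positivity, fun a b => ?_⟩
  have hunit : ∀ a b : ℝ, max |a| |b| = 1 → |a - b| ^ p ≤ ε * (|a| ^ p + |b| ^ p) +
      2 ^ p / δ * φ (a, b) := by
    intro a b hab
    have hge : 1 ≤ |a| ^ p + |b| ^ p := by
      have ha : 0 ≤ |a| ^ p := by positivity
      have hb : 0 ≤ |b| ^ p := by positivity
      rcases max_cases |a| |b| with ⟨h, -⟩ | ⟨h, -⟩ <;> rw [hab] at h <;> rw [← h] at *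
      · simp at *; linarith
      · simp at *; linarith
    by_cases hz : ε ≤ |a - b| ^ p
    · have h1 := hδK (a, b) ⟨by simpa [Prod.norm_def] using hab, hz⟩
      have h2 : |a - b| ^ p ≤ 2 ^ p := by
        refine Real.rpow_le_rpow (abs_nonneg _) ?_ hp0
        have := abs_sub a b
        linarith [le_max_left |a| |b|, le_max_right |a| |b|]
      have h3 : (2 : ℝ) ^ p ≤ 2 ^ p / δ * φ (a, b) := by
        rw [div_mul_eq_mul_div, le_div_iff₀ hδ]
        gcongr
      have : 0 ≤ ε * (|a| ^ p + |b| ^ p) := by positivity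
      linarith
    · push Not at hz
      have := hφ0 (a, b)
      have : 0 ≤ 2 ^ p / δ * φ (a, b) := by positivity
      nlinarith
  -- both sides are homogeneous of degree `p`: divide by the maximum norm of `(a, b)`
  change |a - b| ^ p ≤ ε * (|a| ^ p + |b| ^ p) + 2 ^ p / δ * φ (a, b)
  set r := max |a| |b| with hr
  rcases eq_or_lt_of_le (show 0 ≤ r from le_max_of_le_left (abs_nonneg a)) with h0 | h0
  · have ha : a = 0 := by
      have := le_max_left |a| |b|; rw [← hr, ← h0] at this; exact abs_nonpos_iff.1 this
    have hb : b = 0 := by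
      have := le_max_right |a| |b|; rw [← hr, ← h0] at this; exact abs_nonpos_iff.1 this
    simp [ha, hb, hφ, Real.zero_rpow (by linarith : p ≠ 0)]
  · have hscale : ∀ x : ℝ, |x| ^ p = r ^ p * |x / r| ^ p := by
      intro x
      rw [← Real.mul_rpow h0.le (abs_nonneg _), abs_div, abs_of_pos h0, mul_div_cancel₀ _ h0.ne']
    have h1 := hunit (a / r) (b / r) (by
      rw [abs_div, abs_div, abs_of_pos h0, max_div_div_right h0.le, ← hr, div_self h0.ne'])
    have hrp : 0 < r ^ p := by positivity
    have h2 := mul_le_mul_of_nonneg_left h1 hrp.le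
    simp only [hφ] at h2 ⊢
    rw [hscale a, hscale b, hscale (a - b), hscale ((a + b) / 2)]
    have e1 : (a - b) / r = a / r - b / r := by ring
    have e2 : (a + b) / 2 / r = (a / r + b / r) / 2 := by ring
    rw [e1, e2]
    refine h2.trans (le_of_eq ?_)
    ring

/-- A sequence in `L ^ p` whose norms converge, and whose midpoints have norms at least as large in
the limit, converges in `L ^ p`. -/
lemma exists_tendsto_of_midpoints (hp : 1 < p) {F : ℕ → α → ℝ}
    (hF : ∀ k, MemLp (F k) (ENNReal.ofReal p) μ) {h : ℝ}
    (hlim : Tendsto (fun k => ∫ x, |F k x| ^ p ∂μ) atTop (𝓝 h))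
    (hmid : ∀ ε > 0, ∃ N, ∀ k ≥ N, ∀ l ≥ N, h - ε ≤ ∫ x, |(F k x + F l x) / 2| ^ p ∂μ) :
    ∃ G, MemLp G (ENNReal.ofReal p) μ ∧
      Tendsto (fun k => eLpNorm (F k - G) (ENNReal.ofReal p) μ) atTop (𝓝 0) := by
  have : Fact (1 ≤ ENNReal.ofReal p) := ⟨by simpa using hp.le⟩
  have hint := fun k => integrable_abs_rpow hp (hF k)
  have hmidint : ∀ k l, Integrable (fun x => |(F k x + F l x) / 2| ^ p) μ := fun k l => by
    have := ((hF k).add (hF l)).const_mul (1 / 2)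
    refine (integrable_abs_rpow hp this).congr (Eventually.of_forall fun x => ?_)
    simp only [Pi.add_apply]; congr 2; ring
  have hdist : ∀ k l, dist ((hF k).toLp (F k)) ((hF l).toLp (F l)) ^ p
      = ∫ x, |F k x - F l x| ^ p ∂μ := by
    intro k l
    rw [dist_eq_norm, ← MemLp.toLp_sub, Lp.norm_toLp, ← integral_abs_rpow_eq hp ((hF k).sub (hF l))]
    rfl
  have hcau : CauchySeq fun k => (hF k).toLp (F k) := by
    rw [Metric.cauchySeq_iff]
    intro η hη
    have hηp : 0 < η ^ p := by positivity
    -- `ε` absorbs the first term of the defect bound (the integrals are at most `h + 1`), and then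
    -- `δ` makes the defect at most `2 δ`
    obtain ⟨ε, hε, hε2⟩ : ∃ ε > 0, ε * (2 * (h + 1)) < η ^ p / 2 := by
      have hh : 0 ≤ h := ge_of_tendsto' hlim fun k => integral_abs_rpow_nonneg _
      refine ⟨η ^ p / (8 * (h + 1)), by positivity, ?_⟩
      rw [div_mul_eq_mul_div, div_lt_div_iff₀ (by positivity) (by positivity)]
      nlinarith
    obtain ⟨C, hC, hCb⟩ := exists_convexity_defect_bound hp hε
    obtain ⟨δ, hδ, hδ1, hδ2⟩ : ∃ δ > 0, δ ≤ 1 ∧ C * (2 * δ) < η ^ p / 2 := by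
      refine ⟨min 1 (η ^ p / (8 * (C + 1))), by positivity, min_le_left _ _, ?_⟩
      have h1 : min 1 (η ^ p / (8 * (C + 1))) ≤ η ^ p / (8 * (C + 1)) := min_le_right _ _
      have h2 : C * (η ^ p / (8 * (C + 1))) ≤ η ^ p / 8 := by
        rw [mul_div_assoc', div_le_div_iff₀ (by positivity) (by positivity)]
        nlinarith
      nlinarith
    obtain ⟨N1, hN1⟩ := hmid δ hδ
    obtain ⟨N2, hN2⟩ := Metric.tendsto_atTop.1 hlim δ hδ
    refine ⟨max N1 N2, fun k hk l hl => ?_⟩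
    have hk1 := hN2 k (le_of_max_le_right hk)
    have hl1 := hN2 l (le_of_max_le_right hl)
    have hm1 := hN1 k (le_of_max_le_left hk) l (le_of_max_le_left hl)
    rw [Real.dist_eq, abs_lt] at hk1 hl1
    have hle : ∫ x, |F k x - F l x| ^ p ∂μ ≤
        ε * (∫ x, |F k x| ^ p ∂μ + ∫ x, |F l x| ^ p ∂μ) +
        C * ((∫ x, |F k x| ^ p ∂μ + ∫ x, |F l x| ^ p ∂μ) / 2 -
          ∫ x, |(F k x + F l x) / 2| ^ p ∂μ) := by
      have i1 := (((hint k).add (hint l)).const_mul ε)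
      have i2 := ((((hint k).add (hint l)).div_const 2).sub (hmidint k l)).const_mul C
      have := integral_mono (integrable_abs_rpow hp ((hF k).sub (hF l))) (i1.add i2)
        (fun x => hCb (F k x) (F l x))
      simp only [Pi.add_apply, Pi.sub_apply] at this
      rw [integral_add (by simpa using i1) (by simpa using i2), integral_const_mul,
        integral_const_mul, integral_sub (by simpa using ((hint k).add (hint l)).div_const 2)
        (hmidint k l), integral_div, integral_add (hint k) (hint l)] at this
      simpa using this
    have hlt : dist ((hF k).toLp (F k)) ((hF l).toLp (F l)) ^ p < η ^ p := by
      rw [hdist]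
      refine hle.trans_lt ?_
      have a1 : ε * (∫ x, |F k x| ^ p ∂μ + ∫ x, |F l x| ^ p ∂μ) ≤ ε * (2 * (h + 1)) := by
        gcongr; linarith
      have a2 : C * ((∫ x, |F k x| ^ p ∂μ + ∫ x, |F l x| ^ p ∂μ) / 2 -
          ∫ x, |(F k x + F l x) / 2| ^ p ∂μ) ≤ C * (2 * δ) := by
        gcongr; linarith
      linarith
    exact lt_of_not_ge fun hge => (Real.rpow_le_rpow hη.le hge (by linarith)).not_gt hlt
  obtain ⟨G, hG⟩ := cauchySeq_tendsto_of_complete hcau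
  refine ⟨G, Lp.memLp G, ?_⟩
  rw [Lp.tendsto_Lp_iff_tendsto_eLpNorm'] at hG
  refine hG.congr fun k => eLpNorm_congr_ae ?_
  filter_upwards [(hF k).coeFn_toLp] with x hx
  simp [hx]

end UniformConvexity

/-! ### The measure on pairs behind the energy -/

section Pairs

variable {n : ℕ} {U : Set (EuclideanSpace ℝ (Fin n))}
  {d : EuclideanSpace ℝ (Fin n) → EuclideanSpace ℝ (Fin n) → ℝ} {s p : ℝ}
  {u v : EuclideanSpace ℝ (Fin n) → ℝ}

namespace IsEquivDistance

lemma nonneg (hd : IsEquivDistance d) (x y) : 0 ≤ d x y := by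
  obtain ⟨c, C, hc, hC, h⟩ := hd.equiv
  exact le_trans (by positivity) (h x y).1

lemma self_eq_zero (hd : IsEquivDistance d) (x) : d x x = 0 := (hd.eq_zero_iff x x).2 rfl

lemma pos (hd : IsEquivDistance d) {x y} (h : x ≠ y) : 0 < d x y :=
  lt_of_le_of_ne (hd.nonneg x y) fun h0 => h ((hd.eq_zero_iff x y).1 h0.symm)

lemma abs_sub_le (hd : IsEquivDistance d) (x y z) : |d x z - d y z| ≤ d x y := by
  rw [abs_le]
  have h1 := hd.triangle x y z
  have h2 := hd.triangle y x z
  rw [hd.symm y x] at h2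
  constructor <;> linarith

lemma continuous (hd : IsEquivDistance d) :
    Continuous fun z : EuclideanSpace ℝ (Fin n) × EuclideanSpace ℝ (Fin n) => d z.1 z.2 := by
  obtain ⟨c, C, hc, hC, h⟩ := hd.equiv
  rw [continuous_iff_continuousAt]
  rintro ⟨x, y⟩
  rw [ContinuousAt, tendsto_iff_dist_tendsto_zero]
  have hlim : Tendsto (fun z : EuclideanSpace ℝ (Fin n) × EuclideanSpace ℝ (Fin n) =>
      C * dist z.1 x + C * dist z.2 y) (𝓝 (x, y)) (𝓝 0) := by
    have : Continuous fun z : EuclideanSpace ℝ (Fin n) × EuclideanSpace ℝ (Fin n) =>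
      C * dist z.1 x + C * dist z.2 y := by fun_prop
    simpa using this.tendsto (x, y)
  refine squeeze_zero (fun _ => dist_nonneg) (fun z => ?_) hlim
  have h1 := hd.abs_sub_le z.1 x z.2
  have h2 := hd.abs_sub_le z.2 y x
  rw [hd.symm z.2 x, hd.symm y x] at h2
  have h3 := (h z.1 x).2
  have h4 := (h z.2 y).2
  rw [Real.dist_eq]
  rw [abs_le] at h1 h2 ⊢
  constructor <;> linarith

lemma measurable (hd : IsEquivDistance d) :
    Measurable fun z : EuclideanSpace ℝ (Fin n) × EuclideanSpace ℝ (Fin n) => d z.1 z.2 :=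
  hd.continuous.measurable

lemma measurable_rpow (hd : IsEquivDistance d) (q : ℝ) :
    Measurable fun z : EuclideanSpace ℝ (Fin n) × EuclideanSpace ℝ (Fin n) => d z.1 z.2 ^ q :=
  hd.measurable.pow_const q

end IsEquivDistance

/-- The difference `u(x) - u(y)`, as a function on pairs. -/
def pairDiff (u : EuclideanSpace ℝ (Fin n) → ℝ) :
    EuclideanSpace ℝ (Fin n) × EuclideanSpace ℝ (Fin n) → ℝ := fun z => u z.1 - u z.2

variable (U d s p) in
/-- The measure `d(x,y)^{-(n+ps)} dx dy` on `ℝ²ⁿ \ (Uᶜ)²`, for which the energy of `u` is the `p`-th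
power of the `L ^ p` norm of `pairDiff u`. -/
noncomputable def pairMeasure :
    Measure (EuclideanSpace ℝ (Fin n) × EuclideanSpace ℝ (Fin n)) :=
  (volume.restrict (crossSet U)).withDensity
    fun z => ENNReal.ofReal ((d z.1 z.2 ^ ((n : ℝ) + p * s))⁻¹)

lemma measurable_pairDensity (hd : IsEquivDistance d) (q : ℝ) :
    Measurable fun z : EuclideanSpace ℝ (Fin n) × EuclideanSpace ℝ (Fin n) =>
      ENNReal.ofReal ((d z.1 z.2 ^ q)⁻¹) :=
  (hd.measurable_rpow q).inv.ennreal_ofReal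

lemma energy_eq_lintegral (hd : IsEquivDistance d) (u : EuclideanSpace ℝ (Fin n) → ℝ) :
    energy U d s p u = ∫⁻ z, ENNReal.ofReal (|pairDiff u z| ^ p) ∂pairMeasure U d s p := by
  rw [pairMeasure, lintegral_withDensity_eq_lintegral_mul_non_measurable _
    (measurable_pairDensity hd _) (Eventually.of_forall fun _ => ENNReal.ofReal_lt_top)]
  refine lintegral_congr fun z => ?_
  rw [Pi.mul_apply, ← ENNReal.ofReal_mul (by have := hd.nonneg z.1 z.2; positivity), pairDiff]
  congr 1
  rw [div_eq_inv_mul]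

lemma form_eq_integral (hd : IsEquivDistance d) (u v : EuclideanSpace ℝ (Fin n) → ℝ) :
    form U d s p u v = ∫ z, |pairDiff u z| ^ (p - 2) * pairDiff u z * pairDiff v z
      ∂pairMeasure U d s p := by
  rw [pairMeasure, integral_withDensity_eq_integral_toReal_smul (measurable_pairDensity hd _)
    (Eventually.of_forall fun _ => ENNReal.ofReal_lt_top), form]
  refine integral_congr_ae (Eventually.of_forall fun z => ?_)
  have h0 := hd.nonneg z.1 z.2
  simp only [smul_eq_mul, pairDiff]
  rw [ENNReal.toReal_ofReal (by positivity), div_eq_inv_mul]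

lemma pairMeasure_absolutelyContinuous :
    pairMeasure U d s p ≪ (volume : Measure (EuclideanSpace ℝ (Fin n))).prod volume :=
  (withDensity_absolutelyContinuous _ _).trans Measure.restrict_le_self.absolutelyContinuous

lemma aestronglyMeasurable_pairDiff (hu : AEMeasurable u volume) :
    AEStronglyMeasurable (pairDiff u) (pairMeasure U d s p) := by
  have h1 : AEMeasurable (fun z : EuclideanSpace ℝ (Fin n) × EuclideanSpace ℝ (Fin n) => u z.1)
    ((volume : Measure (EuclideanSpace ℝ (Fin n))).prod volume) :=
    hu.comp_quasiMeasurePreserving Measure.quasiMeasurePreserving_fst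
  have h2 : AEMeasurable (fun z : EuclideanSpace ℝ (Fin n) × EuclideanSpace ℝ (Fin n) => u z.2)
    ((volume : Measure (EuclideanSpace ℝ (Fin n))).prod volume) :=
    hu.comp_quasiMeasurePreserving Measure.quasiMeasurePreserving_snd
  exact ((h1.sub h2).mono_ac pairMeasure_absolutelyContinuous).aestronglyMeasurable

lemma energy_eq_eLpNorm (hd : IsEquivDistance d) (hp : 1 < p)
    (u : EuclideanSpace ℝ (Fin n) → ℝ) :
    energy U d s p u = eLpNorm (pairDiff u) (ENNReal.ofReal p) (pairMeasure U d s p) ^ p := by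
  rw [energy_eq_lintegral hd, eLpNorm_rpow_eq_lintegral hp]

lemma mem_spaceW_iff (hd : IsEquivDistance d) (hp : 1 < p) :
    u ∈ spaceW U d s p ↔ AEMeasurable u volume ∧
      MemLp u (ENNReal.ofReal p) (volume.restrict U) ∧
      MemLp (pairDiff u) (ENNReal.ofReal p) (pairMeasure U d s p) := by
  have hp0 : 0 < p := by linarith
  simp only [spaceW, Set.mem_ofPred_eq, ENNReal.add_lt_top, energy_eq_eLpNorm hd hp, normLp,
    ENNReal.rpow_lt_top_iff_of_pos hp0]
  constructor
  · rintro ⟨h1, h2, h3⟩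
    exact ⟨h1, ⟨h1.restrict.aestronglyMeasurable, h2⟩, ⟨aestronglyMeasurable_pairDiff h1, h3⟩⟩
  · rintro ⟨h1, h2, h3⟩
    exact ⟨h1, h2.2, h3.2⟩

lemma energy_eq_ofReal (hd : IsEquivDistance d) (hp : 1 < p) (hu : u ∈ spaceW U d s p) :
    energy U d s p u = ENNReal.ofReal (∫ z, |pairDiff u z| ^ p ∂pairMeasure U d s p) := by
  rw [energy_eq_eLpNorm hd hp, eLpNorm_rpow_eq_integral hp ((mem_spaceW_iff hd hp).1 hu).2.2]

lemma energy_ne_top (hu : u ∈ spaceW U d s p) : energy U d s p u ≠ ⊤ :=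
  (ENNReal.add_lt_top.1 hu.2).2.ne

lemma normLp_rpow_eq_ofReal (hd : IsEquivDistance d) (hp : 1 < p) (hu : u ∈ spaceW U d s p) :
    normLp U p u ^ p = ENNReal.ofReal (∫ x in U, |u x| ^ p) := by
  rw [normLp, eLpNorm_rpow_eq_integral hp ((mem_spaceW_iff hd hp).1 hu).2.1]

lemma add_smul_mem_spaceW (hd : IsEquivDistance d) (hp : 1 < p) (hu : u ∈ spaceW U d s p)
    (hv : v ∈ spaceW U d s p) (t : ℝ) : (fun x => u x + t * v x) ∈ spaceW U d s p := by
  rw [mem_spaceW_iff hd hp] at *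
  refine ⟨hu.1.add (hv.1.const_mul t), hu.2.1.add (hv.2.1.const_mul t), ?_⟩
  refine (memLp_congr_ae (Eventually.of_forall fun z => ?_)).1 (hu.2.2.add (hv.2.2.const_mul t))
  simp only [pairDiff, Pi.add_apply]; ring

lemma const_mul_mem_spaceW (hd : IsEquivDistance d) (hp : 1 < p) (hu : u ∈ spaceW U d s p)
    (t : ℝ) : (fun x => t * u x) ∈ spaceW U d s p := by
  rw [mem_spaceW_iff hd hp] at *
  refine ⟨hu.1.const_mul t, hu.2.1.const_mul t, ?_⟩
  refine (memLp_congr_ae (Eventually.of_forall fun z => ?_)).1 (hu.2.2.const_mul t)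
  simp only [pairDiff]; ring

lemma const_mem_spaceW (hd : IsEquivDistance d) (hp : 1 < p) (hU : volume U ≠ ⊤) (c : ℝ) :
    (fun _ => c) ∈ spaceW U d s p := by
  have : IsFiniteMeasure (volume.restrict U) := isFiniteMeasure_restrict.2 hU
  rw [mem_spaceW_iff hd hp]
  refine ⟨aemeasurable_const, memLp_const c, ?_⟩
  have : pairDiff (fun _ : EuclideanSpace ℝ (Fin n) => c) = fun _ => 0 := by
    ext z; simp [pairDiff]
  rw [this]
  exact MemLp.zero'

lemma sub_const_mem_spaceW (hd : IsEquivDistance d) (hp : 1 < p) (hU : volume U ≠ ⊤)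
    (hu : u ∈ spaceW U d s p) (c : ℝ) : (fun x => u x - c) ∈ spaceW U d s p := by
  have := add_smul_mem_spaceW hd hp hu (const_mem_spaceW (s := s) hd hp hU (-c)) 1
  simpa [sub_eq_add_neg] using this

lemma energy_sub_const (u : EuclideanSpace ℝ (Fin n) → ℝ) (c : ℝ) :
    energy U d s p (fun x => u x - c) = energy U d s p u := by
  simp [energy]

lemma measurableSet_crossSet (hU : MeasurableSet U) : MeasurableSet (crossSet U) :=
  (hU.compl.prod hU.compl).compl

/-- A property of almost all pairs for `pairMeasure` holds for almost all `y`, for almost every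
`x ∈ U`. -/
lemma ae_ae_of_ae_pairMeasure (hn : 1 ≤ n) (hd : IsEquivDistance d) (hU : MeasurableSet U)
    {P : EuclideanSpace ℝ (Fin n) × EuclideanSpace ℝ (Fin n) → Prop}
    (h : ∀ᵐ z ∂pairMeasure U d s p, P z) :
    ∀ᵐ x ∂volume.restrict U, ∀ᵐ y, P (x, y) := by
  have : Nonempty (Fin n) := ⟨⟨0, hn⟩⟩
  rw [pairMeasure, ae_withDensity_iff (measurable_pairDensity hd _),
    ae_restrict_iff' (measurableSet_crossSet hU)] at h
  rw [ae_restrict_iff' hU]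
  filter_upwards [Measure.ae_ae_of_ae_prod h] with x hx hxU
  have hne : ∀ᵐ y : EuclideanSpace ℝ (Fin n), y ≠ x := by
    simp [ae_iff]
  filter_upwards [hx, hne] with y hy hyx
  refine hy (by simp [crossSet, hxU]) ?_
  have := hd.pos (Ne.symm hyx)
  simp only [ne_eq, ENNReal.ofReal_eq_zero, not_le]
  positivity

lemma ae_pairMeasure_of_ae {P : EuclideanSpace ℝ (Fin n) → Prop} (h : ∀ᵐ x, P x) :
    ∀ᵐ z ∂pairMeasure U d s p, P z.1 ∧ P z.2 := by
  refine pairMeasure_absolutelyContinuous.ae_le ?_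
  exact (Measure.quasiMeasurePreserving_fst.ae h).and (Measure.quasiMeasurePreserving_snd.ae h)

/-- A function whose differences vanish is constant. -/
lemma ae_eq_const_of_pairDiff (hn : 1 ≤ n) (hd : IsEquivDistance d) (hU : MeasurableSet U)
    (hU0 : volume U ≠ 0) (h : pairDiff u =ᵐ[pairMeasure U d s p] 0) :
    ∃ c, u =ᵐ[volume] fun _ => c := by
  have h1 := ae_ae_of_ae_pairMeasure hn hd hU h
  have : (ae (volume.restrict U)).NeBot := by
    rw [ae_neBot, ne_eq, Measure.restrict_eq_zero]; exact hU0
  obtain ⟨x, hx⟩ := h1.exists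
  refine ⟨u x, hx.mono fun y hy => ?_⟩
  simp only [pairDiff, Pi.zero_apply] at hy
  linarith

lemma ae_eq_const_of_energy_eq_zero (hn : 1 ≤ n) (hd : IsEquivDistance d) (hU : MeasurableSet U)
    (hU0 : volume U ≠ 0) (hp : 1 < p) (hu : u ∈ spaceW U d s p) (h : energy U d s p u = 0) :
    ∃ c, u =ᵐ[volume] fun _ => c := by
  refine ae_eq_const_of_pairDiff hn hd hU hU0 (s := s) (p := p) ?_
  rw [energy_eq_eLpNorm hd hp, ENNReal.rpow_eq_zero_iff_of_pos (by linarith),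
    eLpNorm_eq_zero_iff ((mem_spaceW_iff hd hp).1 hu).2.2.1 (ofReal_ne_zero_of_one_lt hp)] at h
  exact h

/-- Tonelli: iterated integrals over rectangles with a side in `U` are below the energy. -/
lemma lintegral_lintegral_le_energy (hd : IsEquivDistance d) (hu : AEMeasurable u volume)
    {A B : Set (EuclideanSpace ℝ (Fin n))} (hAU : A ⊆ U) :
    ∫⁻ x in A, ∫⁻ y in B, ENNReal.ofReal (|u x - u y| ^ p / d x y ^ ((n : ℝ) + p * s))
      ≤ energy U d s p u := by
  have h1 : AEMeasurable (fun z : EuclideanSpace ℝ (Fin n) × EuclideanSpace ℝ (Fin n) => u z.1)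
    ((volume : Measure (EuclideanSpace ℝ (Fin n))).prod volume) :=
    hu.comp_quasiMeasurePreserving Measure.quasiMeasurePreserving_fst
  have h2 : AEMeasurable (fun z : EuclideanSpace ℝ (Fin n) × EuclideanSpace ℝ (Fin n) => u z.2)
    ((volume : Measure (EuclideanSpace ℝ (Fin n))).prod volume) :=
    hu.comp_quasiMeasurePreserving Measure.quasiMeasurePreserving_snd
  have hm : AEMeasurable (fun z : EuclideanSpace ℝ (Fin n) × EuclideanSpace ℝ (Fin n) =>
      ENNReal.ofReal (|u z.1 - u z.2| ^ p / d z.1 z.2 ^ ((n : ℝ) + p * s)))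
      ((volume : Measure (EuclideanSpace ℝ (Fin n))).prod volume) :=
    ((((h1.sub h2).norm.pow_const p).div (hd.measurable_rpow _).aemeasurable)).ennreal_ofReal
  rw [← lintegral_prod (fun z : EuclideanSpace ℝ (Fin n) × EuclideanSpace ℝ (Fin n) =>
      ENNReal.ofReal (|u z.1 - u z.2| ^ p / d z.1 z.2 ^ ((n : ℝ) + p * s)))
      (by rw [Measure.prod_restrict]; exact hm.restrict),
    Measure.prod_restrict, energy]
  refine lintegral_mono' (Measure.restrict_mono ?_ le_rfl) le_rfl
  rintro ⟨x, y⟩ ⟨hx, -⟩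
  simp [crossSet, hAU hx]

/-- Jensen's inequality for the distance of a constant to a mean value. -/
lemma abs_sub_average_rpow_le {α : Type*} [MeasurableSpace α] {μ : Measure α} [IsFiniteMeasure μ]
    (hμ : μ ≠ 0) (hp : 1 < p) {f : α → ℝ} (hf : MemLp f (ENNReal.ofReal p) μ) (c : ℝ) :
    ENNReal.ofReal (|c - ⨍ y, f y ∂μ| ^ p) ≤
      (μ Set.univ)⁻¹ * ∫⁻ y, ENNReal.ofReal (|c - f y| ^ p) ∂μ := by
  have : NeZero μ := ⟨hμ⟩
  have hp0 : (0 : ℝ) ≤ p := by linarith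
  have hint : Integrable f μ := hf.integrable (by simpa using hp.le)
  have hcf : MemLp (fun y => c - f y) (ENNReal.ofReal p) μ := (memLp_const c).sub hf
  have hci : Integrable (fun y => c - f y) μ := (integrable_const c).sub hint
  have hpi := integrable_abs_rpow hp hcf
  have h1 : c - ⨍ y, f y ∂μ = ⨍ y, (c - f y) ∂μ := by
    have := average_const μ c
    rw [average_eq] at this
    rw [average_eq, average_eq, integral_sub (integrable_const c) hint, smul_sub, this]
  have h2 : |⨍ y, (c - f y) ∂μ| ≤ ⨍ y, |c - f y| ∂μ := by
    rw [average_eq, average_eq, smul_eq_mul, smul_eq_mul, abs_mul, abs_of_nonneg (by positivity)]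
    gcongr
    exact norm_integral_le_integral_norm (fun y => c - f y)
  have h3 := (convexOn_rpow hp.le).map_average_le (μ := μ) (f := fun y => |c - f y|)
    (continuousOn_id.rpow_const fun _ _ => Or.inr hp0) isClosed_Ici
    (Eventually.of_forall fun y => Set.mem_Ici.2 (abs_nonneg _)) hci.abs hpi
  have h4 : |c - ⨍ y, f y ∂μ| ^ p ≤ ⨍ y, |c - f y| ^ p ∂μ := by
    rw [h1]
    exact (Real.rpow_le_rpow (abs_nonneg _) h2 hp0).trans h3
  refine (ENNReal.ofReal_le_ofReal h4).trans (le_of_eq ?_)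
  rw [average_eq, smul_eq_mul, ENNReal.ofReal_mul (by positivity),
    ofReal_integral_eq_lintegral_ofReal hpi (Eventually.of_forall fun y => by positivity),
    measureReal_def, ENNReal.ofReal_inv_of_pos (by
      rw [ENNReal.toReal_pos_iff]
      exact ⟨Measure.measure_univ_pos.2 hμ, measure_lt_top _ _⟩), ENNReal.ofReal_toReal
      (measure_ne_top _ _)]

/-- Distance of the value at `x` to the mean value over a set `B` of points at distance at most `R`
from `x`. -/
lemma abs_sub_setAverage_rpow_le (hd : IsEquivDistance d) (hp : 1 < p) (hs : 0 < s)
    (hu : MemLp u (ENNReal.ofReal p) (volume.restrict U)) {B : Set (EuclideanSpace ℝ (Fin n))}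
    (hBU : B ⊆ U) (hB : MeasurableSet B) (hBt : volume B ≠ ⊤) {m R : ℝ} (hm : 0 < m)
    (hmB : ENNReal.ofReal m ≤ volume B) {x : EuclideanSpace ℝ (Fin n)} (hR : ∀ y ∈ B, d x y ≤ R) :
    ENNReal.ofReal (|u x - ⨍ y in B, u y| ^ p) ≤ ENNReal.ofReal (m⁻¹ * R ^ ((n : ℝ) + p * s)) *
      ∫⁻ y in B, ENNReal.ofReal (|u x - u y| ^ p / d x y ^ ((n : ℝ) + p * s)) := by
  have : IsFiniteMeasure (volume.restrict B) := isFiniteMeasure_restrict.2 hBt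
  have hB0 : volume B ≠ 0 := by
    intro h; rw [h] at hmB; simp at hmB; linarith
  have hq : 0 < (n : ℝ) + p * s := by positivity
  refine (abs_sub_average_rpow_le (by rwa [ne_eq, Measure.restrict_eq_zero]) hp
    (hu.mono_measure (Measure.restrict_mono hBU le_rfl)) (u x)).trans ?_
  rw [Measure.restrict_apply_univ, ENNReal.ofReal_mul (by positivity), mul_assoc,
    ENNReal.ofReal_inv_of_pos hm, ← lintegral_const_mul' _ _ ENNReal.ofReal_ne_top]
  refine mul_le_mul' (ENNReal.inv_le_inv.2 hmB) ?_
  refine setLIntegral_mono' hB fun y hy => ?_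
  have hR0 : 0 ≤ R := (hd.nonneg x y).trans (hR y hy)
  rw [← ENNReal.ofReal_mul (by positivity)]
  refine ENNReal.ofReal_le_ofReal ?_
  rcases eq_or_ne x y with rfl | hxy
  · simp [Real.zero_rpow (by linarith : p ≠ 0)]
  · have h0 := hd.pos hxy
    rw [mul_div_assoc', le_div_iff₀ (by positivity), mul_comm]
    gcongr
    exact hR y hy

/-- Comparison of the mean values over two subsets of `U`. -/
lemma abs_setAverage_sub_setAverage_le (hd : IsEquivDistance d) (hp : 1 < p) (hs : 0 < s)
    (hu : u ∈ spaceW U d s p) {A B : Set (EuclideanSpace ℝ (Fin n))} (hAU : A ⊆ U) (hBU : B ⊆ U)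
    (hA : MeasurableSet A) (hB : MeasurableSet B) (hAt : volume A ≠ ⊤) (hBt : volume B ≠ ⊤)
    {m R : ℝ} (hm : 0 < m) (hmA : ENNReal.ofReal m ≤ volume A) (hmB : ENNReal.ofReal m ≤ volume B)
    (hR0 : 0 ≤ R) (hR : ∀ x ∈ A, ∀ y ∈ B, d x y ≤ R) :
    |(⨍ y in A, u y) - ⨍ y in B, u y| ^ p ≤
      m⁻¹ * (m⁻¹ * R ^ ((n : ℝ) + p * s)) * (energy U d s p u).toReal := by
  have : IsFiniteMeasure (volume.restrict A) := isFiniteMeasure_restrict.2 hAt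
  have hA0 : volume A ≠ 0 := by
    intro h; rw [h] at hmA; simp at hmA; linarith
  have hW := (mem_spaceW_iff hd hp).1 hu
  have h1 := abs_sub_average_rpow_le (by rwa [ne_eq, Measure.restrict_eq_zero]) hp
    (hW.2.1.mono_measure (Measure.restrict_mono hAU le_rfl)) (⨍ y in B, u y)
  rw [Measure.restrict_apply_univ] at h1
  have h2 : ∫⁻ x in A, ENNReal.ofReal (|(⨍ y in B, u y) - u x| ^ p) ≤
      ENNReal.ofReal (m⁻¹ * R ^ ((n : ℝ) + p * s)) * energy U d s p u := by
    refine le_trans ?_ (mul_le_mul_right (lintegral_lintegral_le_energy hd hW.1 hAU (B := B)) _)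
    rw [← lintegral_const_mul' _ _ ENNReal.ofReal_ne_top]
    refine setLIntegral_mono' hA fun x hx => ?_
    rw [abs_sub_comm]
    exact abs_sub_setAverage_rpow_le hd hp hs hW.2.1 hBU hB hBt hm hmB (hR x hx)
  have h3 := h1.trans (mul_le_mul' (ENNReal.inv_le_inv.2 hmA) h2)
  rw [← ENNReal.ofReal_inv_of_pos hm, ← mul_assoc, ← ENNReal.ofReal_mul (by positivity),
    ← ENNReal.ofReal_toReal (energy_ne_top hu), ← ENNReal.ofReal_mul (by positivity),
    ENNReal.ofReal_le_ofReal_iff (by positivity), abs_sub_comm] at h3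
  exact h3

end Pairs

/-! ### Extension of functions dominated by a distance -/

/-- McShane's extension, for a function whose increments are dominated by a pseudodistance `ρ`. -/
lemma exists_extension_of_abs_sub_le {X : Type*} {ρ : X → X → ℝ} (h0 : ∀ x, ρ x x = 0)
    (hsymm : ∀ x y, ρ x y = ρ y x) (htri : ∀ x y z, ρ x z ≤ ρ x y + ρ y z) {S : Set X}
    (hS : S.Nonempty) {u : X → ℝ} (hu : ∀ x ∈ S, ∀ y ∈ S, |u x - u y| ≤ ρ x y) :
    ∃ g : X → ℝ, (∀ x ∈ S, g x = u x) ∧ ∀ x y, |g x - g y| ≤ ρ x y := by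
  obtain ⟨y₀, hy₀⟩ := hS
  have : Nonempty S := ⟨⟨y₀, hy₀⟩⟩
  set g : X → ℝ := fun x => ⨅ y : S, (u y + ρ x y) with hg
  have hbdd : ∀ x, BddBelow (Set.range fun y : S => u y + ρ x y) := by
    intro x
    refine ⟨u y₀ - ρ y₀ x, ?_⟩
    rintro _ ⟨y, rfl⟩
    have h1 := (abs_le.1 (hu y₀ hy₀ y y.2)).2
    have h2 := htri y₀ x y
    simp only
    linarith
  have hle : ∀ x y, g x ≤ g y + ρ x y := by
    intro x y
    rw [← sub_le_iff_le_add]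
    refine le_ciInf fun z => ?_
    have h1 : g x ≤ u z + ρ x z := ciInf_le (hbdd x) z
    have h2 := htri x y z
    linarith
  refine ⟨g, fun x hx => le_antisymm ?_ ?_, fun x y => abs_le.2 ⟨?_, ?_⟩⟩
  · have : g x ≤ u x + ρ x x := ciInf_le (hbdd x) ⟨x, hx⟩
    rwa [h0, add_zero] at this
  · refine le_ciInf fun z => ?_
    have := (abs_le.1 (hu x hx z z.2)).2
    linarith
  · have := hle y x
    rw [hsymm] at this
    linarith
  · have := hle x y
    linarith

lemma rpow_le_add_rpow {a b c s : ℝ} (ha : 0 ≤ a) (hb : 0 ≤ b) (hc : 0 ≤ c) (h : a ≤ b + c)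
    (hs0 : 0 ≤ s) (hs1 : s ≤ 1) : a ^ s ≤ b ^ s + c ^ s :=
  (Real.rpow_le_rpow ha h hs0).trans (Real.rpow_add_le_add_rpow hb hc hs0 hs1)

/-- Extension of a function that is Hölder continuous with respect to a distance. -/
lemma exists_holder_extension {X : Type*} {d : X → X → ℝ} (h0 : ∀ x, d x x = 0)
    (hnn : ∀ x y, 0 ≤ d x y) (hsymm : ∀ x y, d x y = d y x)
    (htri : ∀ x y z, d x z ≤ d x y + d y z) {s K : ℝ} (hs0 : 0 < s) (hs1 : s ≤ 1) (hK : 0 ≤ K)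
    {S : Set X} (hS : S.Nonempty) {u : X → ℝ} (hu : ∀ x ∈ S, ∀ y ∈ S, |u x - u y| ≤ K * d x y ^ s) :
    ∃ g : X → ℝ, (∀ x ∈ S, g x = u x) ∧ ∀ x y, |g x - g y| ≤ K * d x y ^ s := by
  refine exists_extension_of_abs_sub_le (ρ := fun x y => K * d x y ^ s) (fun x => ?_)
    (fun x y => ?_) (fun x y z => ?_) hS hu
  · simp [h0, Real.zero_rpow hs0.ne']
  · simp only [hsymm]
  · rw [← mul_add]
    exact mul_le_mul_of_nonneg_left
      (rpow_le_add_rpow (hnn _ _) (hnn _ _) (hnn _ _) (htri x y z) hs0.le hs1) hK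

lemma continuous_of_holder {X : Type*} [PseudoMetricSpace X] {g : X → ℝ} {K s : ℝ} (hs : 0 < s)
    (h : ∀ x y, |g x - g y| ≤ K * dist x y ^ s) : Continuous g := by
  rw [continuous_iff_continuousAt]
  intro x
  rw [ContinuousAt, tendsto_iff_dist_tendsto_zero]
  refine squeeze_zero (fun _ => dist_nonneg) (fun y => h y x) ?_
  have h1 : Continuous fun y => K * dist y x ^ s :=
    continuous_const.mul ((continuous_id.dist continuous_const).rpow_const fun _ => Or.inr hs.le)
  simpa [Real.zero_rpow hs.ne'] using h1.tendsto x

/-! ### Measure density of smooth domains -/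

section Density

variable {n : ℕ} {U : Set (EuclideanSpace ℝ (Fin n))}

/-- At a boundary point the domain contains, near each of its points, a truncated cone with a fixed
opening around the inner normal. -/
lemma IsSmoothBoundedDomain.exists_ball_subset_local (hU : IsSmoothBoundedDomain U)
    {x₀ : EuclideanSpace ℝ (Fin n)} (hx₀ : x₀ ∈ closure U) :
    ∃ η > 0, ∃ δ > 0, ∀ x ∈ U ∩ Metric.ball x₀ η, ∀ r, 0 < r → r ≤ η →
      ∃ z, Metric.ball z (δ * r) ⊆ U ∩ Metric.ball x r := by
  by_cases hxU : x₀ ∈ U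
  · obtain ⟨η, hη, hηU⟩ := Metric.isOpen_iff.1 hU.isOpen x₀ hxU
    refine ⟨η / 2, by positivity, 1, one_pos, fun x hx r hr hrη => ⟨x, fun y hy => ⟨hηU ?_, ?_⟩⟩⟩
    · have h1 := Metric.mem_ball.1 hx.2
      have h2 := Metric.mem_ball.1 hy
      have := dist_triangle y x x₀
      rw [Metric.mem_ball]; linarith
    · simpa using hy
  · have hfr : x₀ ∈ frontier U := by
      rw [frontier, hU.isOpen.interior_eq]; exact ⟨hx₀, hxU⟩
    obtain ⟨V, hV, ρ, hρ, hL, hUV⟩ := hU.smooth_boundary x₀ hfr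
    set L := fderiv ℝ ρ x₀ with hLdef
    -- a unit vector pointing into the domain
    obtain ⟨e, he1, heL⟩ : ∃ e : EuclideanSpace ℝ (Fin n), ‖e‖ = 1 ∧ L e < 0 := by
      obtain ⟨w, hw⟩ : ∃ w, L w ≠ 0 := by
        by_contra! h
        exact hL (ContinuousLinearMap.ext h)
      obtain ⟨w, hw⟩ : ∃ w, L w < 0 := by
        rcases lt_or_gt_of_ne hw with h | h
        · exact ⟨w, h⟩
        · exact ⟨-w, by simpa using h⟩
      have hw0 : w ≠ 0 := by rintro rfl; simp at hw
      have hn : 0 < ‖w‖ := norm_pos_iff.2 hw0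
      refine ⟨‖w‖⁻¹ • w, by rw [norm_smul, norm_inv, norm_norm, inv_mul_cancel₀ hn.ne'], ?_⟩
      rw [map_smul, smul_eq_mul]
      exact mul_neg_of_pos_of_neg (by positivity) hw
    set a := -L e with ha
    have ha0 : 0 < a := by simp [ha, heL]
    -- strict differentiability at `x₀` controls `ρ y - ρ x` for all pairs near `x₀`, so that one
    -- cone serves every nearby `x`
    have hstrict : HasStrictFDerivAt ρ L x₀ :=
      hρ.contDiffAt.hasStrictFDerivAt (by simp)
    have hev := hstrict.isLittleO.bound (show 0 < a / 8 by positivity)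
    obtain ⟨η, hη, hball⟩ := Metric.mem_nhds_iff.1
      (Filter.inter_mem hev (prod_mem_nhds hV hV))
    -- `δ` is the opening of the cone
    obtain ⟨δ, hδ, hδ1, hδL⟩ : ∃ δ > 0, δ ≤ 1 ∧ ‖L‖ * δ ≤ a / 4 := by
      refine ⟨min 1 (a / 4 / (‖L‖ + 1)), by positivity, min_le_left _ _, ?_⟩
      have h1 : min 1 (a / 4 / (‖L‖ + 1)) ≤ a / 4 / (‖L‖ + 1) := min_le_right _ _
      calc ‖L‖ * min 1 (a / 4 / (‖L‖ + 1)) ≤ (‖L‖ + 1) * (a / 4 / (‖L‖ + 1)) := by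
            gcongr; linarith
        _ = a / 4 := by field_simp
    refine ⟨η / 2, by positivity, δ / 2, by positivity, fun x hx r hr hrη => ?_⟩
    refine ⟨x + (r / 2) • e, fun y hy => ?_⟩
    have hy' : ‖y - (x + (r / 2) • e)‖ < δ / 2 * r := by rwa [← dist_eq_norm]
    set h := y - (x + (r / 2) • e) with hh
    have hyx : y - x = (r / 2) • e + h := by rw [hh]; abel
    have hnorm : ‖y - x‖ < r := by
      rw [hyx]
      refine (norm_add_le _ _).trans_lt ?_
      rw [norm_smul, he1, Real.norm_of_nonneg (by positivity)]
      nlinarith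
    have hyr : y ∈ Metric.ball x r := by rw [Metric.mem_ball, dist_eq_norm]; exact hnorm
    have hx2 := Metric.mem_ball.1 hx.2
    have hy2 : dist y x₀ < η := by
      have := dist_triangle y x x₀
      have := Metric.mem_ball.1 hyr
      linarith
    have hmem : (y, x) ∈ Metric.ball (x₀, x₀) η := by
      rw [Metric.mem_ball, Prod.dist_eq]
      exact max_lt hy2 (by simp only; linarith)
    obtain ⟨hb, hyV, hxV⟩ := hball hmem
    simp only [Set.mem_ofPred_eq] at hb
    have hρx : ρ x < 0 := by
      have : x ∈ U ∩ V := ⟨hx.1, hxV⟩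
      rw [hUV] at this
      exact this.1
    -- along `e` the value of `ρ` drops by `a r / 2`; the transversal part of `y - x` and the
    -- remainder give back at most `a r / 4`
    have hρy : ρ y < 0 := by
      have h1 := (abs_le.1 (by simpa using hb)).2
      have h2 : L (y - x) ≤ -(a * (r / 2)) + a / 4 * (r / 2) := by
        rw [hyx, map_add, map_smul, smul_eq_mul]
        have h3 : L h ≤ ‖L‖ * ‖h‖ := (le_abs_self _).trans (L.le_opNorm h)
        have h4 : ‖L‖ * ‖h‖ ≤ ‖L‖ * (δ / 2 * r) := by gcongr
        have h5 : ‖L‖ * (δ / 2 * r) ≤ a / 4 * (r / 2) := by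
          have := mul_le_mul_of_nonneg_right hδL (show 0 ≤ r / 2 by positivity)
          linarith
        have h6 : L e = -a := by simp [ha]
        rw [h6]; linarith
      rw [map_sub] at h2
      nlinarith
    refine ⟨?_, hyr⟩
    have : y ∈ {y | ρ y < 0} ∩ V := ⟨hρy, hyV⟩
    rw [← hUV] at this
    exact this.1

lemma IsSmoothBoundedDomain.isCompact_closure (hU : IsSmoothBoundedDomain U) :
    IsCompact (closure U) := hU.isBounded.isCompact_closure

/-- The inner cone condition with uniform parameters, by compactness of the closure. -/
lemma IsSmoothBoundedDomain.exists_ball_subset (hU : IsSmoothBoundedDomain U) :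
    ∃ η > 0, ∃ δ > 0, ∀ x ∈ U, ∀ r, 0 < r → r ≤ η →
      ∃ z, Metric.ball z (δ * r) ⊆ U ∩ Metric.ball x r := by
  have key : ∃ η > 0, ∃ δ > 0, ∀ x ∈ U ∩ closure U, ∀ r, 0 < r → r ≤ η →
      ∃ z, Metric.ball z (δ * r) ⊆ U ∩ Metric.ball x r := by
    refine hU.isCompact_closure.induction_on (p := fun S => ∃ η > 0, ∃ δ > 0, ∀ x ∈ U ∩ S,
      ∀ r, 0 < r → r ≤ η → ∃ z, Metric.ball z (δ * r) ⊆ U ∩ Metric.ball x r) ?_ ?_ ?_ ?_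
    · exact ⟨1, one_pos, 1, one_pos, by simp⟩
    · rintro S T hST ⟨η, hη, δ, hδ, h⟩
      exact ⟨η, hη, δ, hδ, fun x hx => h x ⟨hx.1, hST hx.2⟩⟩
    · rintro S T ⟨η, hη, δ, hδ, h⟩ ⟨η', hη', δ', hδ', h'⟩
      refine ⟨min η η', by positivity, min δ δ', by positivity, fun x hx r hr hrη => ?_⟩
      rcases hx.2 with hxS | hxT
      · obtain ⟨z, hz⟩ := h x ⟨hx.1, hxS⟩ r hr (hrη.trans (min_le_left _ _))
        exact ⟨z, (Metric.ball_subset_ball (by gcongr; exact min_le_left _ _)).trans hz⟩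
      · obtain ⟨z, hz⟩ := h' x ⟨hx.1, hxT⟩ r hr (hrη.trans (min_le_right _ _))
        exact ⟨z, (Metric.ball_subset_ball (by gcongr; exact min_le_right _ _)).trans hz⟩
    · intro x₀ hx₀
      obtain ⟨η, hη, δ, hδ, h⟩ := hU.exists_ball_subset_local hx₀
      exact ⟨Metric.ball x₀ η, mem_nhdsWithin_of_mem_nhds (Metric.ball_mem_nhds _ hη),
        η, hη, δ, hδ, h⟩
  obtain ⟨η, hη, δ, hδ, h⟩ := key
  exact ⟨η, hη, δ, hδ, fun x hx => h x ⟨hx, subset_closure hx⟩⟩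

/-- Balls centred in a smooth bounded domain meet it in a fixed proportion of their volume. -/
lemma IsSmoothBoundedDomain.exists_density (hU : IsSmoothBoundedDomain U) :
    ∃ c > 0, ∃ η > 0, η ≤ 1 ∧ ∀ x ∈ U, ∀ r, 0 < r → r ≤ η →
      ENNReal.ofReal (c * r ^ n) ≤ volume (U ∩ Metric.ball x r) := by
  obtain ⟨η, hη, δ, hδ, h⟩ := hU.exists_ball_subset
  set b := volume (Metric.ball (0 : EuclideanSpace ℝ (Fin n)) 1) with hb
  have hb0 : b ≠ 0 := (Metric.measure_ball_pos _ _ one_pos).ne'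
  have hbt : b ≠ ⊤ := measure_ball_lt_top.ne
  refine ⟨δ ^ n * b.toReal, mul_pos (by positivity) (ENNReal.toReal_pos hb0 hbt), min η 1,
    by positivity, min_le_right _ _, fun x hx r hr hrη => ?_⟩
  obtain ⟨z, hz⟩ := h x hx r hr (hrη.trans (min_le_left _ _))
  refine le_trans (le_of_eq ?_) (measure_mono hz)
  rw [Measure.addHaar_ball_of_pos _ _ (by positivity), ← hb, finrank_euclideanSpace_fin,
    ← ENNReal.ofReal_toReal hbt, ← ENNReal.ofReal_mul (by positivity), ENNReal.ofReal_toReal hbt,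
    mul_pow]
  congr 1; ring

lemma IsSmoothBoundedDomain.volume_ne_top (hU : IsSmoothBoundedDomain U) : volume U ≠ ⊤ :=
  hU.isBounded.measure_lt_top.ne

lemma IsSmoothBoundedDomain.volume_ne_zero (hU : IsSmoothBoundedDomain U) : volume U ≠ 0 :=
  (hU.isOpen.measure_pos _ hU.isConnected.nonempty).ne'

end Density

/-! ### A Morrey estimate, uniform in the exponent -/

section Morrey

variable {n : ℕ} {U : Set (EuclideanSpace ℝ (Fin n))}
  {d : EuclideanSpace ℝ (Fin n) → EuclideanSpace ℝ (Fin n) → ℝ} {s p : ℝ}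
  {u : EuclideanSpace ℝ (Fin n) → ℝ}

/-- The mean-value comparison at scale `r`, with a constant that does not depend on `p`. -/
lemma abs_setAverage_sub_le_scale (hd : IsEquivDistance d) (hp : 1 < p) (hs : 0 < s)
    (hps : 2 * (n : ℝ) ≤ p * s) (hUt : volume U ≠ ⊤) (hu : u ∈ spaceW U d s p)
    {A B : Set (EuclideanSpace ℝ (Fin n))} (hAU : A ⊆ U) (hBU : B ⊆ U)
    (hA : MeasurableSet A) (hB : MeasurableSet B) {c Λ r : ℝ} (hc : 0 < c) (hΛ : 0 < Λ)
    (hr : 0 < r) (hr1 : r ≤ 1) (hmA : ENNReal.ofReal (c * r ^ n) ≤ volume A)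
    (hmB : ENNReal.ofReal (c * r ^ n) ≤ volume B) (hR : ∀ x ∈ A, ∀ y ∈ B, d x y ≤ Λ * r) :
    |(⨍ y in A, u y) - ⨍ y in B, u y| ≤
      max 1 (c⁻¹ * c⁻¹ * Λ ^ n) * Λ ^ s * r ^ (s / 2) *
        (energy U d s p u).toReal ^ (1 / p) := by
  have hp0 : 0 < p := by linarith
  have h := abs_setAverage_sub_setAverage_le hd hp hs hu hAU hBU hA hB
    (measure_ne_top_of_subset hAU hUt) (measure_ne_top_of_subset hBU hUt)
    (m := c * r ^ n) (R := Λ * r) (by positivity) hmA hmB (by positivity) hR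
  set H := (energy U d s p u).toReal with hH
  have hH0 : 0 ≤ H := ENNReal.toReal_nonneg
  set b := max 1 (c⁻¹ * c⁻¹ * Λ ^ n) with hb
  have hb1 : 1 ≤ b := le_max_left _ _
  rw [← Real.rpow_le_rpow_iff (abs_nonneg _) (by positivity) hp0]
  refine h.trans ?_
  rw [Real.mul_rpow (y := H ^ (1 / p)) (by positivity) (by positivity),
    Real.mul_rpow (y := r ^ (s / 2)) (by positivity) (by positivity),
    Real.mul_rpow (y := Λ ^ s) (by positivity) (by positivity), ← Real.rpow_mul hH0,
    one_div_mul_cancel hp0.ne', Real.rpow_one, ← Real.rpow_mul hΛ.le, ← Real.rpow_mul hr.le]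
  refine mul_le_mul_of_nonneg_right ?_ hH0
  -- the net power of `r` is `p s - n ≥ p s / 2`, because `2 n ≤ p s`; this leaves the exponent
  -- `s / 2` after the `p`-th root
  have e1 : (c * r ^ n)⁻¹ * ((c * r ^ n)⁻¹ * (Λ * r) ^ ((n : ℝ) + p * s)) =
      (c⁻¹ * c⁻¹ * Λ ^ n) * Λ ^ (s * p) * r ^ (p * s - n) := by
    rw [Real.mul_rpow hΛ.le hr.le, Real.rpow_add hΛ, Real.rpow_add hr, Real.rpow_sub hr,
      Real.rpow_natCast, Real.rpow_natCast, mul_comm s p]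
    field_simp
  rw [e1]
  have e2 : c⁻¹ * c⁻¹ * Λ ^ n ≤ b ^ p :=
    (le_max_right _ _).trans (by
      conv_lhs => rw [← Real.rpow_one (max 1 (c⁻¹ * c⁻¹ * Λ ^ n))]
      exact Real.rpow_le_rpow_of_exponent_le hb1 hp.le)
  have e3 : r ^ (p * s - n) ≤ r ^ (s / 2 * p) :=
    Real.rpow_le_rpow_of_exponent_ge hr hr1 (by linarith)
  gcongr

/-- For almost every `x ∈ U` the weighted integral of `|u(x) - u(y)|^p` is finite. -/
lemma ae_lintegral_lt_top (hd : IsEquivDistance d) (hu : u ∈ spaceW U d s p) :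
    ∀ᵐ x ∂volume.restrict U,
      ∫⁻ y in U, ENNReal.ofReal (|u x - u y| ^ p / d x y ^ ((n : ℝ) + p * s)) < ⊤ := by
  have h := (lintegral_lintegral_le_energy (p := p) (s := s) hd hu.1 (B := U)
    (subset_refl U)).trans_lt (energy_ne_top hu).lt_top
  have h1 : AEMeasurable (fun z : EuclideanSpace ℝ (Fin n) × EuclideanSpace ℝ (Fin n) => u z.1)
    ((volume.restrict U : Measure (EuclideanSpace ℝ (Fin n))).prod (volume.restrict U)) :=
    hu.1.restrict.comp_quasiMeasurePreserving Measure.quasiMeasurePreserving_fst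
  have h2 : AEMeasurable (fun z : EuclideanSpace ℝ (Fin n) × EuclideanSpace ℝ (Fin n) => u z.2)
    ((volume.restrict U : Measure (EuclideanSpace ℝ (Fin n))).prod (volume.restrict U)) :=
    hu.1.restrict.comp_quasiMeasurePreserving Measure.quasiMeasurePreserving_snd
  have hm : AEMeasurable (fun z : EuclideanSpace ℝ (Fin n) × EuclideanSpace ℝ (Fin n) =>
      ENNReal.ofReal (|u z.1 - u z.2| ^ p / d z.1 z.2 ^ ((n : ℝ) + p * s)))
      ((volume.restrict U : Measure (EuclideanSpace ℝ (Fin n))).prod (volume.restrict U)) :=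
    ((((h1.sub h2).norm.pow_const p).div (hd.measurable_rpow _).aemeasurable)).ennreal_ofReal
  exact ae_lt_top' hm.lintegral_prod_right' h.ne

/-- Mean values over shrinking sets `U ∩ B(x, r)` converge almost everywhere. -/
lemma ae_tendsto_setAverage (hd : IsEquivDistance d) (hU : MeasurableSet U) (hUt : volume U ≠ ⊤)
    (hp : 1 < p) (hs : 0 < s) {c η : ℝ} (hc : 0 < c)
    (hdens : ∀ x ∈ U, ∀ r, 0 < r → r ≤ η →
      ENNReal.ofReal (c * r ^ n) ≤ volume (U ∩ Metric.ball x r)) (hu : u ∈ spaceW U d s p) :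
    ∀ᵐ x ∂volume.restrict U, ∀ r : ℕ → ℝ, (∀ j, 0 < r j) → (∀ j, r j ≤ η) →
      Tendsto r atTop (𝓝 0) →
      Tendsto (fun j => ⨍ y in U ∩ Metric.ball x (r j), u y) atTop (𝓝 (u x)) := by
  obtain ⟨_, C, _, hC, hequiv⟩ := hd.equiv
  filter_upwards [ae_lintegral_lt_top hd hu, ae_restrict_mem hU] with x hx hxU r hr0 hrη hr
  have hp0 : 0 < p := by linarith
  set I := ∫⁻ y in U, ENNReal.ofReal (|u x - u y| ^ p / d x y ^ ((n : ℝ) + p * s)) with hI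
  have hbound : ∀ j, |u x - ⨍ y in U ∩ Metric.ball x (r j), u y| ^ p ≤
      (c⁻¹ * C ^ ((n : ℝ) + p * s)) * I.toReal * r j ^ (p * s) := by
    intro j
    have h1 := abs_sub_setAverage_rpow_le hd hp hs ((mem_spaceW_iff hd hp).1 hu).2.1
      (B := U ∩ Metric.ball x (r j)) Set.inter_subset_left (hU.inter measurableSet_ball)
      (measure_ne_top_of_subset Set.inter_subset_left hUt)
      (m := c * r j ^ n) (by have := hr0 j; positivity) (hdens x hxU (r j) (hr0 j) (hrη j))
      (x := x) (R := C * r j) (fun y hy => (hequiv x y).2.trans (by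
        have := Metric.mem_ball'.1 hy.2
        gcongr))
    have h2 := h1.trans (mul_le_mul_right (lintegral_mono' (Measure.restrict_mono
      Set.inter_subset_left le_rfl) le_rfl) _)
    rw [← hI, ← ENNReal.ofReal_toReal hx.ne, ← ENNReal.ofReal_mul (by
      have := hr0 j; positivity), ENNReal.ofReal_le_ofReal_iff (by have := hr0 j; positivity)] at h2
    refine h2.trans (le_of_eq ?_)
    have := hr0 j
    rw [Real.mul_rpow hC.le this.le, Real.rpow_add this, Real.rpow_natCast]
    field_simp
  have hlim : Tendsto (fun j => |u x - ⨍ y in U ∩ Metric.ball x (r j), u y| ^ p) atTop (𝓝 0) := by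
    refine squeeze_zero (fun j => by positivity) hbound ?_
    have h3 : Tendsto (fun j => r j ^ (p * s)) atTop (𝓝 0) := by
      have := hr.rpow_const (p := p * s) (Or.inr (by positivity))
      rwa [Real.zero_rpow (by positivity)] at this
    simpa using h3.const_mul ((c⁻¹ * C ^ ((n : ℝ) + p * s)) * I.toReal)
  have h4 := hlim.rpow_const (p := 1 / p) (Or.inr (by positivity))
  rw [Real.zero_rpow (by positivity)] at h4
  rw [tendsto_iff_dist_tendsto_zero]
  refine h4.congr fun j => ?_
  rw [← Real.rpow_mul (abs_nonneg _), mul_one_div_cancel hp0.ne', Real.rpow_one, Real.dist_eq,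
    abs_sub_comm]

/-- Functions of finite energy are Hölder continuous off a null set when `p` is large, with constant
`K 𝓗(u)^{1/p}` where `K` does not depend on `p`: telescope the mean values over `U ∩ B(x, 2⁻ʲr)`. -/
lemma exists_morrey_const (hU : IsSmoothBoundedDomain U) (hd : IsEquivDistance d) (hs : 0 < s) :
    ∃ K : ℝ, 0 ≤ K ∧ ∀ p : ℝ, 1 < p → 2 * (n : ℝ) ≤ p * s → ∀ u ∈ spaceW U d s p,
      ∃ S ⊆ U, (∀ᵐ x ∂volume.restrict U, x ∈ S) ∧ ∀ x ∈ S, ∀ y ∈ S,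
        |u x - u y| ≤ K * (energy U d s p u).toReal ^ (1 / p) * dist x y ^ (s / 2) := by
  obtain ⟨_, C, _, hC, hequiv⟩ := hd.equiv
  obtain ⟨c, hc, η, hη, hη1, hdens⟩ := hU.exists_density
  have hUm := hU.isOpen.measurableSet
  obtain ⟨D, hD⟩ := Metric.isBounded_iff.1 hU.isBounded
  -- `c / 2 ^ n` accounts for balls of radius `r / 2`, and `Λ` for points of `U` far apart
  set c' := c / 2 ^ n with hc'
  have hc'0 : 0 < c' := by positivity
  set Λ := max (3 * C) (C * D / η) with hΛ
  have hΛ0 : 0 < Λ := lt_max_of_lt_left (by positivity)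
  set K₀ := max 1 (c'⁻¹ * c'⁻¹ * Λ ^ n) * Λ ^ s with hK₀
  have hK₀0 : 0 ≤ K₀ := by positivity
  set q : ℝ := (1 / 2) ^ (s / 2) with hq
  have hq0 : 0 < q := by positivity
  have hq1 : q < 1 := Real.rpow_lt_one (by norm_num) (by norm_num) (by positivity)
  have h1q : 0 < 1 - q := by linarith
  refine ⟨K₀ * (1 + 2 / (1 - q)), by positivity, fun p hp hps u hu => ?_⟩
  set H := (energy U d s p u).toReal ^ (1 / p) with hH
  have hH0 : 0 ≤ H := by positivity
  set S : Set (EuclideanSpace ℝ (Fin n)) := {x | x ∈ U ∧ ∀ r : ℕ → ℝ, (∀ j, 0 < r j) →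
      (∀ j, r j ≤ η) → Tendsto r atTop (𝓝 0) →
      Tendsto (fun j => ⨍ y in U ∩ Metric.ball x (r j), u y) atTop (𝓝 (u x))} with hS
  refine ⟨S, fun x hx => hx.1, ?_, ?_⟩
  · filter_upwards [ae_restrict_mem hUm,
      ae_tendsto_setAverage hd hUm hU.volume_ne_top hp hs hc hdens hu] with x h1 h2
    exact ⟨h1, h2⟩
  have hdens' : ∀ x ∈ U, ∀ r, 0 < r → r ≤ η → ∀ r', r / 2 ≤ r' → r' ≤ r →
      ENNReal.ofReal (c' * r ^ n) ≤ volume (U ∩ Metric.ball x r') := by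
    intro x hx r hr hrη r' h1 h2
    refine le_trans (ENNReal.ofReal_le_ofReal ?_) (hdens x hx r' (by linarith) (by linarith))
    have : (r / 2) ^ n ≤ r' ^ n := pow_le_pow_left₀ (by positivity) h1 n
    calc c' * r ^ n = c * (r / 2) ^ n := by rw [hc', div_pow]; ring
      _ ≤ _ := by gcongr
  -- mean values over two comparable sets at scale `r` differ by at most a multiple of `r ^ (s / 2)`
  have hscale : ∀ x ∈ U, ∀ y ∈ U, ∀ r, 0 < r → r ≤ η → ∀ r₁, r / 2 ≤ r₁ → r₁ ≤ r →
      (∀ x' ∈ U ∩ Metric.ball x r, ∀ y' ∈ U ∩ Metric.ball y r₁, d x' y' ≤ Λ * r) →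
      |(⨍ z in U ∩ Metric.ball x r, u z) - ⨍ z in U ∩ Metric.ball y r₁, u z|
        ≤ K₀ * r ^ (s / 2) * H := by
    intro x hx y hy r hr hrη r₁ h1 h2 hdist
    exact abs_setAverage_sub_le_scale hd hp hs hps hU.volume_ne_top hu Set.inter_subset_left
      Set.inter_subset_left (hUm.inter measurableSet_ball) (hUm.inter measurableSet_ball) hc'0 hΛ0
      hr (hrη.trans hη1) (hdens' x hx r hr hrη r (by linarith) le_rfl)
      (hdens' y hy r hr hrη r₁ h1 h2) hdist
  have hnear : ∀ x y r r₁, dist x y ≤ r → r₁ ≤ r → ∀ x' ∈ U ∩ Metric.ball x r,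
      ∀ y' ∈ U ∩ Metric.ball y r₁, d x' y' ≤ Λ * r := by
    intro x y r r₁ hxy hr₁ x' hx' y' hy'
    have h1 := Metric.mem_ball.1 hx'.2
    have h2 := Metric.mem_ball'.1 hy'.2
    have h3 := dist_triangle4 x' x y y'
    have hr : 0 ≤ r := dist_nonneg.trans hxy
    calc d x' y' ≤ C * dist x' y' := (hequiv _ _).2
      _ ≤ C * (3 * r) := by gcongr; linarith
      _ = 3 * C * r := by ring
      _ ≤ Λ * r := by gcongr; exact le_max_left _ _
  -- telescope over the radii `r / 2 ^ j`: a geometric series of ratio `q = 2 ^ (-s / 2)`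
  have htel : ∀ x ∈ S, ∀ r, 0 < r → r ≤ η →
      |(⨍ z in U ∩ Metric.ball x r, u z) - u x| ≤ K₀ * r ^ (s / 2) * H / (1 - q) := by
    intro x hx r hr hrη
    set f : ℕ → ℝ := fun j => ⨍ z in U ∩ Metric.ball x (r * (1 / 2) ^ j), u z with hf
    have hle : ∀ j : ℕ, r * (1 / 2) ^ j ≤ η := fun j =>
      (mul_le_of_le_one_right hr.le (pow_le_one₀ (by norm_num) (by norm_num))).trans hrη
    have hlim : Tendsto f atTop (𝓝 (u x)) := by
      refine hx.2 (fun j => r * (1 / 2) ^ j) (fun j => by positivity) hle ?_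
      have := tendsto_pow_atTop_nhds_zero_of_lt_one (r := (1 / 2 : ℝ)) (by norm_num) (by norm_num)
      simpa using this.const_mul r
    have hstep : ∀ j, dist (f j) (f (j + 1)) ≤ K₀ * r ^ (s / 2) * H * q ^ j := by
      intro j
      have h1 := hscale x hx.1 x hx.1 (r * (1 / 2) ^ j) (by positivity) (hle j)
        (r * (1 / 2) ^ (j + 1)) (by rw [pow_succ]; linarith)
        (by
          rw [pow_succ]
          have : 0 < r * (1 / 2) ^ j := by positivity
          linarith)
        (hnear x x _ _ (by rw [dist_self]; positivity) (by
          rw [pow_succ]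
          have : 0 < r * (1 / 2) ^ j := by positivity
          linarith))
      rw [Real.dist_eq]
      refine h1.trans (le_of_eq ?_)
      rw [Real.mul_rpow hr.le (by positivity), ← Real.rpow_natCast, ← Real.rpow_natCast,
        ← Real.rpow_mul (by norm_num), hq, ← Real.rpow_mul (by norm_num), mul_comm (j : ℝ)]
      ring
    have := dist_le_of_le_geometric_of_tendsto₀ q _ hq1 hstep hlim
    simpa [hf, Real.dist_eq] using this
  intro x hx y hy
  rcases eq_or_ne x y with rfl | hxy
  · simp; positivity
  have hxy0 : 0 < dist x y := dist_pos.2 hxy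
  -- distant points are compared at the largest admissible scale `η`
  set r := min (dist x y) η with hr
  have hr0 : 0 < r := lt_min hxy0 hη
  have hrη : r ≤ η := min_le_right _ _
  have hmid := hscale x hx.1 y hy.1 r hr0 hrη r (by linarith) le_rfl (by
    rcases le_total (dist x y) η with h | h
    · exact hnear x y r r (by rw [hr, min_eq_left h]) le_rfl
    · intro x' hx' y' hy'
      have hrη' : r = η := by rw [hr, min_eq_right h]
      calc d x' y' ≤ C * dist x' y' := (hequiv _ _).2
        _ ≤ C * D := by gcongr; exact hD hx'.1 hy'.1
        _ = C * D / η * r := by rw [hrη']; field_simp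
        _ ≤ Λ * r := by gcongr; exact le_max_right _ _)
  have h1 := htel x hx r hr0 hrη
  have h2 := htel y hy r hr0 hrη
  have htri : |u x - u y| ≤ K₀ * r ^ (s / 2) * H / (1 - q) + K₀ * r ^ (s / 2) * H +
      K₀ * r ^ (s / 2) * H / (1 - q) := by
    rw [abs_le] at h1 h2 hmid ⊢
    constructor <;> linarith
  refine htri.trans ?_
  have hrr : r ^ (s / 2) ≤ dist x y ^ (s / 2) :=
    Real.rpow_le_rpow hr0.le (min_le_left _ _) (by positivity)
  calc _ = K₀ * (1 + 2 / (1 - q)) * H * r ^ (s / 2) := by field_simp; ring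
    _ ≤ _ := by gcongr

/-- For large `p`, functions of finite energy have a globally Hölder continuous representative. -/
lemma exists_holder_representative (hU : IsSmoothBoundedDomain U) (hd : IsEquivDistance d)
    (hs : 0 < s) (hs1 : s < 1) :
    ∃ K : ℝ, 0 ≤ K ∧ ∀ p : ℝ, 1 < p → 2 * (n : ℝ) ≤ p * s → ∀ u ∈ spaceW U d s p,
      ∃ g : EuclideanSpace ℝ (Fin n) → ℝ, g =ᵐ[volume.restrict U] u ∧ ∀ x y,
        |g x - g y| ≤ K * (energy U d s p u).toReal ^ (1 / p) * dist x y ^ (s / 2) := by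
  obtain ⟨K, hK, h⟩ := exists_morrey_const hU hd hs
  refine ⟨K, hK, fun p hp hps u hu => ?_⟩
  obtain ⟨S, hSU, hS, hSu⟩ := h p hp hps u hu
  have : (ae (volume.restrict U)).NeBot := by
    rw [ae_neBot, ne_eq, Measure.restrict_eq_zero]; exact hU.volume_ne_zero
  obtain ⟨g, hg, hg2⟩ := exists_holder_extension (d := fun x y => dist x y) dist_self
    (fun _ _ => dist_nonneg) dist_comm dist_triangle (s := s / 2) (by positivity) (by linarith)
    (by positivity) hS.exists hSu
  exact ⟨g, hS.mono fun x hx => hg x hx, hg2⟩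

end Morrey

/-! ### Compactness in `L ^ p(U)` -/

/-- A set within every distance of a totally bounded set is totally bounded. -/
lemma totallyBounded_of_approx {X : Type*} [PseudoMetricSpace X] {T : Set X}
    (h : ∀ ε > 0, ∃ K : Set X, TotallyBounded K ∧ ∀ t ∈ T, ∃ k ∈ K, dist t k ≤ ε) :
    TotallyBounded T := by
  rw [Metric.totallyBounded_iff]
  intro ε hε
  obtain ⟨K, hK, hTK⟩ := h (ε / 2) (by positivity)
  obtain ⟨t, ht, hKt⟩ := Metric.totallyBounded_iff.1 hK (ε / 2) (by positivity)
  refine ⟨t, ht, fun x hx => ?_⟩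
  obtain ⟨k, hk, hxk⟩ := hTK x hx
  obtain ⟨y, hy, hky⟩ := Set.mem_iUnion₂.1 (hKt hk)
  refine Set.mem_iUnion₂.2 ⟨y, hy, ?_⟩
  have := dist_triangle x k y
  rw [Metric.mem_ball] at hky ⊢
  linarith

/-- A measurable choice of a point of a finite `r`-net. -/
lemma exists_measurable_net_index {X : Type*} [PseudoMetricSpace X] [MeasurableSpace X]
    [OpensMeasurableSpace X] {U : Set X} (hU : TotallyBounded U) (hne : U.Nonempty) {r : ℝ}
    (hr : 0 < r) : ∃ (N : ℕ) (x : Fin N → X) (ind : X → Fin N), Measurable ind ∧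
      (∀ i, x i ∈ U) ∧ ∀ y ∈ U, dist y (x (ind y)) < r := by
  obtain ⟨t, htU, htf, hcov⟩ := Metric.finite_approx_of_totallyBounded hU r hr
  have htne : t.Nonempty := by
    obtain ⟨y, hy⟩ := hne
    obtain ⟨z, hz, -⟩ := Set.mem_iUnion₂.1 (hcov hy)
    exact ⟨z, hz⟩
  obtain ⟨f, hf⟩ := htf.countable.exists_eq_range htne
  -- finitely many terms of the enumeration already exhaust the net
  obtain ⟨N, hN⟩ : ∃ N, ∀ z ∈ t, ∃ k ≤ N, f k = z := by
    have : ∀ z ∈ t, ∃ k, f k = z := fun z hz => by rw [hf] at hz; exact hz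
    choose! k hk using this
    refine ⟨htf.toFinset.sup k, fun z hz => ⟨k z, ?_, hk z hz⟩⟩
    exact Finset.le_sup (f := k) (htf.mem_toFinset.2 hz)
  refine ⟨N + 1, fun i => f i,
    fun y => ⟨SimpleFunc.nearestPtInd f N y,
      Nat.lt_succ_of_le (SimpleFunc.nearestPtInd_le f N y)⟩, ?_, fun i => htU ?_, fun y hy => ?_⟩
  · refine measurable_to_countable' fun i => ?_
    convert (SimpleFunc.nearestPtInd f N).measurableSet_fiber i using 1
    ext y
    simp [Fin.ext_iff]
  · rw [hf]; exact ⟨_, rfl⟩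
  · obtain ⟨z, hz, hyz⟩ := Set.mem_iUnion₂.1 (hcov hy)
    obtain ⟨k, hkN, rfl⟩ := hN z hz
    have h1 := SimpleFunc.edist_nearestPt_le f y hkN
    rw [SimpleFunc.nearestPt, SimpleFunc.map_apply, edist_dist, edist_dist,
      ENNReal.ofReal_le_ofReal_iff dist_nonneg] at h1
    rw [Metric.mem_ball] at hyz
    rw [dist_comm]
    refine h1.trans_lt ?_
    rwa [dist_comm]

section Compactness

variable {n : ℕ} {U : Set (EuclideanSpace ℝ (Fin n))}
  {d : EuclideanSpace ℝ (Fin n) → EuclideanSpace ℝ (Fin n) → ℝ} {s p : ℝ}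
  {u : EuclideanSpace ℝ (Fin n) → ℝ}

/-- Mean values are bounded by the `L ^ p` norm. -/
lemma abs_setAverage_rpow_le (hp : 1 < p) (hu : MemLp u (ENNReal.ofReal p) (volume.restrict U))
    {A : Set (EuclideanSpace ℝ (Fin n))} (hAU : A ⊆ U) (hAt : volume A ≠ ⊤) {m M : ℝ} (hm : 0 < m)
    (hmA : ENNReal.ofReal m ≤ volume A) (hM : ∫ x in U, |u x| ^ p ≤ M) :
    |⨍ y in A, u y| ^ p ≤ m⁻¹ * M := by
  have : IsFiniteMeasure (volume.restrict A) := isFiniteMeasure_restrict.2 hAt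
  have hA0 : volume A ≠ 0 := by
    intro h; rw [h] at hmA; simp at hmA; linarith
  have hM0 : 0 ≤ M := (integral_abs_rpow_nonneg u).trans hM
  have h1 := abs_sub_average_rpow_le (by rwa [ne_eq, Measure.restrict_eq_zero]) hp
    (hu.mono_measure (Measure.restrict_mono hAU le_rfl)) 0
  rw [Measure.restrict_apply_univ] at h1
  simp only [zero_sub, abs_neg] at h1
  have h2 : ∫⁻ x in A, ENNReal.ofReal (|u x| ^ p) ≤ ENNReal.ofReal M := by
    refine (lintegral_mono' (Measure.restrict_mono hAU le_rfl) le_rfl).trans ?_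
    rw [← ofReal_integral_eq_lintegral_ofReal (integrable_abs_rpow hp hu)
      (Eventually.of_forall fun x => by positivity)]
    exact ENNReal.ofReal_le_ofReal hM
  have h3 := h1.trans (mul_le_mul' (ENNReal.inv_le_inv.2 hmA) h2)
  rwa [← ENNReal.ofReal_inv_of_pos hm, ← ENNReal.ofReal_mul (by positivity),
    ENNReal.ofReal_le_ofReal_iff (by positivity)] at h3

/-- Replacing `u` by its mean values around the points of an `r`-net makes an error of order `r ^ s`
in `L ^ p(U)`. -/
lemma lintegral_sub_net_average_le (hd : IsEquivDistance d) (hU : MeasurableSet U)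
    (hUt : volume U ≠ ⊤) (hp : 1 < p) (hs : 0 < s) {c C r : ℝ} (hc : 0 < c) (hC : 0 < C)
    (hequiv : ∀ x y, d x y ≤ C * dist x y) (hr : 0 < r)
    (hdens : ∀ x ∈ U, ENNReal.ofReal (c * r ^ n) ≤ volume (U ∩ Metric.ball x r))
    {N : ℕ} {x : Fin N → EuclideanSpace ℝ (Fin n)} {ind : EuclideanSpace ℝ (Fin n) → Fin N}
    (hx : ∀ i, x i ∈ U) (hind : ∀ y ∈ U, dist y (x (ind y)) < r) (hu : u ∈ spaceW U d s p) :
    ∫⁻ y in U, ENNReal.ofReal (|u y - ⨍ z in U ∩ Metric.ball (x (ind y)) r, u z| ^ p) ≤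
      ENNReal.ofReal (c⁻¹ * (2 * C) ^ ((n : ℝ) + p * s) * r ^ (p * s)) * energy U d s p u := by
  have hW := (mem_spaceW_iff hd hp).1 hu
  refine le_trans ?_ (mul_le_mul_right
    (lintegral_lintegral_le_energy hd hW.1 (subset_refl U) (B := U)) _)
  rw [← lintegral_const_mul' _ _ ENNReal.ofReal_ne_top]
  refine setLIntegral_mono' hU fun y hy => ?_
  have h1 := abs_sub_setAverage_rpow_le hd hp hs hW.2.1
    (B := U ∩ Metric.ball (x (ind y)) r) Set.inter_subset_left (hU.inter measurableSet_ball)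
    (measure_ne_top_of_subset Set.inter_subset_left hUt)
    (m := c * r ^ n) (by positivity) (hdens _ (hx _)) (x := y) (R := 2 * C * r) (fun z hz => by
      have h1 := Metric.mem_ball'.1 hz.2
      have h2 := hind y hy
      have h3 := dist_triangle y (x (ind y)) z
      calc d y z ≤ C * dist y z := hequiv _ _
        _ ≤ C * (2 * r) := by gcongr; linarith
        _ = 2 * C * r := by ring)
  refine h1.trans (mul_le_mul' (le_of_eq ?_)
    (lintegral_mono' (Measure.restrict_mono Set.inter_subset_left le_rfl) le_rfl))
  congr 1
  rw [Real.mul_rpow (by positivity) hr.le, Real.rpow_add hr, Real.rpow_natCast]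
  field_simp

/-- Sequences bounded in `L ^ p(U)` and in energy are relatively compact in `L ^ p(U)`: they are
approximated uniformly by step functions on finitely many pieces. -/
lemma exists_subseq_tendsto_eLpNorm (hU : IsSmoothBoundedDomain U) (hd : IsEquivDistance d)
    (hp : 1 < p) (hs : 0 < s) {v : ℕ → EuclideanSpace ℝ (Fin n) → ℝ}
    (hv : ∀ k, v k ∈ spaceW U d s p) {M : ℝ} (hM : ∀ k, ∫ x in U, |v k x| ^ p ≤ M)
    (hH : ∀ k, energy U d s p (v k) ≤ ENNReal.ofReal M) :
    ∃ φ : ℕ → ℕ, StrictMono φ ∧ ∃ w, MemLp w (ENNReal.ofReal p) (volume.restrict U) ∧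
      Tendsto (fun k => eLpNorm (v (φ k) - w) (ENNReal.ofReal p) (volume.restrict U))
        atTop (𝓝 0) := by
  have : Fact (1 ≤ ENNReal.ofReal p) := ⟨by simpa using hp.le⟩
  have : IsFiniteMeasure (volume.restrict U) := isFiniteMeasure_restrict.2 hU.volume_ne_top
  have hp0 : 0 < p := by linarith
  obtain ⟨_, C, _, hC, hequiv⟩ := hd.equiv
  obtain ⟨c, hc, η, hη, hη1, hdens⟩ := hU.exists_density
  have hUm := hU.isOpen.measurableSet
  have hM0 : 0 ≤ M := (integral_abs_rpow_nonneg (v 0)).trans (hM 0)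
  have hmem : ∀ k, MemLp (v k) (ENNReal.ofReal p) (volume.restrict U) := fun k =>
    ((mem_spaceW_iff hd hp).1 (hv k)).2.1
  set T : Set (Lp ℝ (ENNReal.ofReal p) (volume.restrict U)) :=
    Set.range fun k => (hmem k).toLp (v k) with hT
  have hTB : TotallyBounded T := by
    refine totallyBounded_of_approx fun ε hε => ?_
    -- the mesh `r` makes the error of the net averages at most `ε`
    obtain ⟨r, hr, hrη, hrε⟩ : ∃ r > 0, r ≤ η ∧
        c⁻¹ * (2 * C) ^ ((n : ℝ) + p * s) * r ^ (p * s) * M ≤ ε ^ p := by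
      have hlim : Tendsto (fun r : ℝ => c⁻¹ * (2 * C) ^ ((n : ℝ) + p * s) * r ^ (p * s) * M)
          (𝓝[>] 0) (𝓝 0) := by
        have h1 : Continuous fun r : ℝ =>
            c⁻¹ * (2 * C) ^ ((n : ℝ) + p * s) * r ^ (p * s) * M :=
          (continuous_const.mul (continuous_id.rpow_const fun _ =>
            Or.inr (by positivity))).mul continuous_const
        have := h1.tendsto 0
        rw [Real.zero_rpow (by positivity), mul_zero, zero_mul] at this
        exact this.mono_left nhdsWithin_le_nhds
      have hev := (hlim.eventually (gt_mem_nhds (show 0 < ε ^ p by positivity))).and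
        (Ioc_mem_nhdsGT hη)
      obtain ⟨r, h1, h2⟩ := hev.exists
      exact ⟨r, h2.1, h2.2, h1.le⟩
    obtain ⟨N, x, ind, hind, hxU, hnet⟩ := exists_measurable_net_index
      (hU.isCompact_closure.totallyBounded.subset subset_closure) hU.isConnected.nonempty hr
    -- step functions with values in a fixed ball of `ℝᴺ` form a compact set in `L ^ p(U)`
    have hstep : ∀ a : Fin N → ℝ, MemLp (fun y => a (ind y)) (ENNReal.ofReal p)
        (volume.restrict U) := fun a => by
      refine MemLp.of_bound ((measurable_of_finite a).comp hind).aestronglyMeasurable ‖a‖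
        (Eventually.of_forall fun y => norm_le_pi_norm a _)
    have hcont : Continuous fun a : Fin N → ℝ => (hstep a).toLp _ := by
      have hlip : LipschitzWith (Real.toNNReal (((volume.restrict U) Set.univ).toReal ^
          ((ENNReal.ofReal p).toReal⁻¹))) (fun a : Fin N → ℝ => (hstep a).toLp _) := by
        refine LipschitzWith.of_dist_le_mul fun a b => ?_
        rw [dist_eq_norm, dist_eq_norm, Real.coe_toNNReal _ (by positivity), ← MemLp.toLp_sub]
        refine Lp.norm_le_of_ae_bound (norm_nonneg _) ?_
        filter_upwards [MemLp.coeFn_toLp ((hstep a).sub (hstep b))] with y hy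
        rw [hy]
        exact norm_le_pi_norm (a - b) (ind y)
      exact hlip.continuous
    refine ⟨(fun a : Fin N → ℝ => (hstep a).toLp _) ''
      Metric.closedBall 0 (((c * r ^ n)⁻¹ * M) ^ (1 / p)),
      ((isCompact_closedBall _ _).image hcont).totallyBounded, ?_⟩
    rintro _ ⟨k, rfl⟩
    have hdens' : ∀ x ∈ U, ENNReal.ofReal (c * r ^ n) ≤ volume (U ∩ Metric.ball x r) :=
      fun x hx => hdens x hx r hr hrη
    refine ⟨_, ⟨fun i => ⨍ z in U ∩ Metric.ball (x i) r, v k z, ?_, rfl⟩, ?_⟩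
    · rw [mem_closedBall_zero_iff, pi_norm_le_iff_of_nonneg (by positivity)]
      intro i
      have h1 := abs_setAverage_rpow_le hp (hmem k) (A := U ∩ Metric.ball (x i) r)
        Set.inter_subset_left (measure_ne_top_of_subset Set.inter_subset_left hU.volume_ne_top)
        (by positivity) (hdens' _ (hxU i)) (hM k)
      rw [Real.norm_eq_abs, ← Real.rpow_le_rpow_iff (abs_nonneg _) (by positivity) hp0,
        ← Real.rpow_mul (by positivity), one_div_mul_cancel hp0.ne', Real.rpow_one]
      exact h1
    · have h1 := (lintegral_sub_net_average_le hd hUm hU.volume_ne_top hp hs hc hC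
        (fun x y => (hequiv x y).2) hr hdens' hxU hnet (hv k)).trans (mul_le_mul_right (hH k) _)
      rw [← ENNReal.ofReal_mul (by positivity)] at h1
      have h2 := h1.trans (ENNReal.ofReal_le_ofReal hrε)
      rw [← eLpNorm_rpow_eq_lintegral hp, ← ENNReal.ofReal_rpow_of_pos hε,
        ENNReal.rpow_le_rpow_iff hp0] at h2
      rw [dist_eq_norm, ← MemLp.toLp_sub, Lp.norm_toLp]
      exact ENNReal.toReal_le_of_le_ofReal hε.le h2
  have hcomp : IsCompact (closure T) := isCompact_iff_totallyBounded_isComplete.2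
    ⟨hTB.closure, isClosed_closure.isComplete⟩
  obtain ⟨w, -, φ, hφ, hlim⟩ := hcomp.tendsto_subseq
    (x := fun k => (hmem k).toLp (v k)) fun k => subset_closure ⟨k, rfl⟩
  refine ⟨φ, hφ, w, Lp.memLp w, ?_⟩
  rw [Lp.tendsto_Lp_iff_tendsto_eLpNorm'] at hlim
  refine hlim.congr fun k => eLpNorm_congr_ae ?_
  filter_upwards [(hmem (φ k)).coeFn_toLp] with x hx
  simp [hx]

end Compactness

/-! ### Energy of truncated Lipschitz functions -/

section Truncated

variable {n : ℕ} {U : Set (EuclideanSpace ℝ (Fin n))}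
  {d : EuclideanSpace ℝ (Fin n) → EuclideanSpace ℝ (Fin n) → ℝ} {s p : ℝ}
  {u : EuclideanSpace ℝ (Fin n) → ℝ}

/-- Pointwise majorant of the energy density with the radial variable `t`: the `p`-th power of
`K D^{1-s}`, times a function of `t` with exponent `η ≤ min (s, 1 - s)` that does not depend on `p`.
The gain `t ^ η` near `0` and the decay `t ^ (-η)` at infinity make `‖y‖ ^ (-n)` integrable. -/
lemma rpow_min_div_rpow_le {D t K η q : ℝ} (hD : 0 < D) (ht : 0 < t) (hK : 0 ≤ K)
    (hη1 : η ≤ 1 - s) (hηs : η ≤ s) (hs0 : 0 < s) (hs1 : s < 1) (hp : 1 ≤ p) :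
    (K * min t D) ^ p / t ^ (q + p * s) ≤
      (K * D ^ (1 - s)) ^ p * (t ^ (-q) * (if t ≤ D then (t / D) ^ η else (D / t) ^ η)) := by
  have hp0 : 0 < p := by linarith
  have hm : 0 < min t D := lt_min ht hD
  have key : (min t D) ^ p / t ^ (p * s) ≤
      (D ^ (1 - s)) ^ p * (if t ≤ D then (t / D) ^ η else (D / t) ^ η) := by
    rw [← Real.rpow_mul hD.le]
    split_ifs with h
    · rw [min_eq_left h, ← Real.rpow_sub ht]
      have e1 : p - p * s = (1 - s) * p := by ring
      have e2 : t ^ ((1 - s) * p) = D ^ ((1 - s) * p) * (t / D) ^ ((1 - s) * p) := by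
        rw [← Real.mul_rpow hD.le (by positivity), mul_div_cancel₀ _ hD.ne']
      rw [e1, e2]
      refine mul_le_mul_of_nonneg_left ?_ (by positivity)
      refine Real.rpow_le_rpow_of_exponent_ge (by positivity) ((div_le_one hD).2 h) ?_
      nlinarith
    · push Not at h
      rw [min_eq_right h.le]
      have e1 : (1 - s) * p = p - p * s := by ring
      have e2 : D ^ p / t ^ (p * s) = D ^ ((1 - s) * p) * (D / t) ^ (p * s) := by
        rw [e1, Real.rpow_sub hD, Real.div_rpow hD.le ht.le]
        have := Real.rpow_pos_of_pos hD (p * s)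
        field_simp
      rw [e2]
      refine mul_le_mul_of_nonneg_left ?_ (by positivity)
      refine Real.rpow_le_rpow_of_exponent_ge (by positivity) ((div_le_one ht).2 h.le) ?_
      nlinarith
  rw [Real.mul_rpow hK hm.le, Real.mul_rpow hK (by positivity), Real.rpow_add ht,
    Real.rpow_neg ht.le]
  have h0 : 0 ≤ K ^ p * (t ^ q)⁻¹ := by positivity
  calc _ = K ^ p * (t ^ q)⁻¹ * ((min t D) ^ p / t ^ (p * s)) := by
        field_simp
    _ ≤ K ^ p * (t ^ q)⁻¹ * _ := mul_le_mul_of_nonneg_left key h0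
    _ = _ := by ring

/-- The radial majorant is integrable at the origin and at infinity. -/
lemma integrable_radial (hn : 1 ≤ n) {η : ℝ} (hη : 0 < η) :
    Integrable fun y : EuclideanSpace ℝ (Fin n) =>
      ‖y‖ ^ (-(n : ℝ)) * (if ‖y‖ ≤ 1 then ‖y‖ ^ η else ‖y‖ ^ (-η)) := by
  have : Nonempty (Fin n) := ⟨⟨0, hn⟩⟩
  rw [integrable_fun_norm_addHaar (volume : Measure (EuclideanSpace ℝ (Fin n)))
    (f := fun r : ℝ => r ^ (-(n : ℝ)) * (if r ≤ 1 then r ^ η else r ^ (-η))),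
    finrank_euclideanSpace_fin]
  have hpow : ∀ r : ℝ, 0 < r → r ^ (n - 1) * r ^ (-(n : ℝ)) = r ^ (-1 : ℝ) := by
    intro r hr
    rw [← Real.rpow_natCast, ← Real.rpow_add hr, Nat.cast_sub hn]
    congr 1; push_cast; ring
  rw [← Set.Ioc_union_Ioi_eq_Ioi (zero_le_one' ℝ)]
  refine IntegrableOn.union ?_ ?_
  · have h1 : IntegrableOn (fun r : ℝ => r ^ (η - 1)) (Set.Ioc 0 1) := by
      rw [← intervalIntegrable_iff_integrableOn_Ioc_of_le zero_le_one]
      exact intervalIntegral.intervalIntegrable_rpow' (by linarith)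
    refine h1.congr_fun (fun r hr => ?_) measurableSet_Ioc
    simp only [smul_eq_mul]
    rw [if_pos hr.2, ← mul_assoc, hpow r hr.1, ← Real.rpow_add hr.1]
    congr 1; ring
  · have h1 : IntegrableOn (fun r : ℝ => r ^ (-η - 1)) (Set.Ioi 1) :=
      integrableOn_Ioi_rpow_of_lt (by linarith) one_pos
    refine h1.congr_fun (fun r hr => ?_) measurableSet_Ioi
    have hr1 : (1 : ℝ) < r := hr
    have hr0 : 0 < r := by linarith
    simp only [smul_eq_mul]
    rw [if_neg (not_le.2 hr1), ← mul_assoc, hpow r hr0, ← Real.rpow_add hr0]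
    congr 1; ring

/-- Energy bound for functions with increments at most `K min(d, D)`. The bound is `K D^{1-s}` to
the power `p`, up to a factor that does not depend on `p`. -/
lemma exists_energy_le (hn : 1 ≤ n) (hU : IsSmoothBoundedDomain U) (hd : IsEquivDistance d)
    (hs0 : 0 < s) (hs1 : s < 1) {D : ℝ} (hD : 0 < D) :
    ∃ C₀ : ℝ, 0 < C₀ ∧ ∀ p : ℝ, 1 < p → ∀ K : ℝ, 0 ≤ K → ∀ w : EuclideanSpace ℝ (Fin n) → ℝ,
      (∀ x y, |w x - w y| ≤ K * min (d x y) D) →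
      energy U d s p w ≤ ENNReal.ofReal (C₀ * (K * D ^ (1 - s)) ^ p) := by
  have : Nonempty (Fin n) := ⟨⟨0, hn⟩⟩
  obtain ⟨c, C, hc, hC, hequiv⟩ := hd.equiv
  set η := min s (1 - s) with hη
  have hη0 : 0 < η := lt_min hs0 (by linarith)
  set Φ : EuclideanSpace ℝ (Fin n) → ℝ := fun y =>
    ‖y‖ ^ (-(n : ℝ)) * (if ‖y‖ ≤ 1 then ‖y‖ ^ η else ‖y‖ ^ (-η)) with hΦ
  have hΦ0 : ∀ y, 0 ≤ Φ y := fun y => by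
    simp only [hΦ]; split_ifs <;> positivity
  have hΦi : Integrable Φ := integrable_radial hn hη0
  set A : ℝ := c ^ (-(n : ℝ)) * max ((C / D) ^ η) ((D / c) ^ η) with hA
  have hA0 : 0 < A := by positivity
  -- comparison of `d` with the Euclidean distance in the majorant
  have hG : ∀ x y, x ≠ y → (d x y) ^ (-(n : ℝ)) *
      (if d x y ≤ D then (d x y / D) ^ η else (D / d x y) ^ η) ≤ A * Φ (x - y) := by
    intro x y hxy
    have hρ : 0 < ‖x - y‖ := norm_pos_iff.2 (sub_ne_zero.2 hxy)
    obtain ⟨h1, h2⟩ := hequiv x y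
    rw [dist_eq_norm] at h1 h2
    have ht : 0 < d x y := hd.pos hxy
    set ρ := ‖x - y‖
    set t := d x y
    have e1 : t ^ (-(n : ℝ)) ≤ c ^ (-(n : ℝ)) * ρ ^ (-(n : ℝ)) := by
      rw [← Real.mul_rpow hc.le hρ.le]
      exact Real.rpow_le_rpow_of_nonpos (by positivity) h1 (by simp)
    have a1 : (t / D) ^ η ≤ (C / D) ^ η * ρ ^ η := by
      rw [← Real.mul_rpow (by positivity) hρ.le]
      refine Real.rpow_le_rpow (by positivity) ?_ hη0.le
      rw [div_mul_eq_mul_div]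
      gcongr
    have a2 : (D / t) ^ η ≤ (D / c) ^ η * ρ ^ (-η) := by
      rw [Real.rpow_neg hρ.le, ← Real.inv_rpow hρ.le, ← Real.mul_rpow (by positivity)
        (by positivity)]
      refine Real.rpow_le_rpow (by positivity) ?_ hη0.le
      rw [← div_eq_mul_inv, div_div]
      gcongr
    have a3 : (if t ≤ D then (t / D) ^ η else (D / t) ^ η) ≤ (t / D) ^ η ∧
        (if t ≤ D then (t / D) ^ η else (D / t) ^ η) ≤ (D / t) ^ η := by
      split_ifs with h
      · refine ⟨le_rfl, Real.rpow_le_rpow (by positivity) ?_ hη0.le⟩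
        exact ((div_le_one hD).2 h).trans ((one_le_div ht).2 h)
      · push Not at h
        refine ⟨Real.rpow_le_rpow (by positivity) ?_ hη0.le, le_rfl⟩
        exact ((div_le_one ht).2 h.le).trans ((one_le_div hD).2 h.le)
    have e2 : (if t ≤ D then (t / D) ^ η else (D / t) ^ η) ≤
        max ((C / D) ^ η) ((D / c) ^ η) * (if ρ ≤ 1 then ρ ^ η else ρ ^ (-η)) := by
      by_cases h : ρ ≤ 1
      · rw [if_pos h]
        refine a3.1.trans (a1.trans ?_)
        gcongr
        exact le_max_left _ _
      · rw [if_neg h]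
        refine a3.2.trans (a2.trans ?_)
        gcongr
        exact le_max_right _ _
    have e3 : 0 ≤ (if t ≤ D then (t / D) ^ η else (D / t) ^ η) := by
      split_ifs <;> positivity
    calc _ ≤ (c ^ (-(n : ℝ)) * ρ ^ (-(n : ℝ))) *
          (max ((C / D) ^ η) ((D / c) ^ η) * (if ρ ≤ 1 then ρ ^ η else ρ ^ (-η))) :=
        mul_le_mul e1 e2 e3 (by positivity)
      _ = A * Φ (x - y) := by simp only [hA, hΦ]; ring
  set J : ℝ := ∫ y, Φ y with hJ
  have hJ0 : 0 ≤ J := integral_nonneg hΦ0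
  have hJl : ∫⁻ y, ENNReal.ofReal (Φ y) = ENNReal.ofReal J :=
    (ofReal_integral_eq_lintegral_ofReal hΦi (Eventually.of_forall hΦ0)).symm
  set V := (volume U).toReal with hV
  refine ⟨2 * A * J * V + 1, by positivity, fun p hp K hK w hw => ?_⟩
  set Q := (K * D ^ (1 - s)) ^ p with hQ
  have hQ0 : 0 ≤ Q := by positivity
  set F : EuclideanSpace ℝ (Fin n) × EuclideanSpace ℝ (Fin n) → ℝ≥0∞ := fun z =>
    ENNReal.ofReal (Q * A) * ENNReal.ofReal (Φ (z.1 - z.2)) with hF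
  have hFm : Measurable F := by
    have hΦm : Measurable Φ := by
      refine (measurable_norm.pow_const _).mul (Measurable.ite ?_ (measurable_norm.pow_const _)
        (measurable_norm.pow_const _))
      exact measurableSet_le measurable_norm measurable_const
    exact ((hΦm.comp (measurable_fst.sub measurable_snd)).ennreal_ofReal).const_mul _
  have hpt : ∀ z : EuclideanSpace ℝ (Fin n) × EuclideanSpace ℝ (Fin n),
      ENNReal.ofReal (|w z.1 - w z.2| ^ p / d z.1 z.2 ^ ((n : ℝ) + p * s)) ≤ F z := by
    rintro ⟨x, y⟩
    simp only [hF]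
    rw [← ENNReal.ofReal_mul (by positivity)]
    refine ENNReal.ofReal_le_ofReal ?_
    rcases eq_or_ne x y with rfl | hxy
    · simp [Real.zero_rpow (by linarith : p ≠ 0)]
      exact mul_nonneg (by positivity) (hΦ0 0)
    · have ht := hd.pos hxy
      calc |w x - w y| ^ p / d x y ^ ((n : ℝ) + p * s)
          ≤ (K * min (d x y) D) ^ p / d x y ^ ((n : ℝ) + p * s) := by
            gcongr
            exact hw x y
        _ ≤ _ := rpow_min_div_rpow_le hD ht hK (min_le_right _ _) (min_le_left _ _) hs0 hs1 hp.le
        _ ≤ Q * (A * Φ (x - y)) := mul_le_mul_of_nonneg_left (hG x y hxy) hQ0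
        _ = _ := by ring
  have hUt := hU.volume_ne_top
  -- in each of the two strips that cover the cross set, one variable runs over `U` and the other is
  -- integrated by translation invariance
  have hcross : crossSet U ⊆ (U ×ˢ Set.univ) ∪ (Set.univ ×ˢ U) := by
    rintro ⟨x, y⟩ h
    by_contra h2
    simp only [Set.mem_union, Set.mem_prod, Set.mem_univ, and_true, true_and, not_or] at h2
    exact h ⟨h2.1, h2.2⟩
  have hI1 : ∫⁻ z in U ×ˢ Set.univ, F z ≤ ENNReal.ofReal (Q * A * J * V) := by
    rw [Measure.volume_eq_prod, ← Measure.prod_restrict, lintegral_prod _ hFm.aemeasurable]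
    have : ∀ x : EuclideanSpace ℝ (Fin n), ∫⁻ y in Set.univ, F (x, y) =
        ENNReal.ofReal (Q * A) * ENNReal.ofReal J := by
      intro x
      rw [Measure.restrict_univ]
      simp only [hF]
      rw [lintegral_const_mul' _ _ ENNReal.ofReal_ne_top,
        lintegral_sub_left_eq_self (fun y => ENNReal.ofReal (Φ y)) x, hJl]
    simp_rw [this]
    rw [setLIntegral_const, ← ENNReal.ofReal_mul (by positivity), ← ENNReal.ofReal_toReal hUt,
      ← ENNReal.ofReal_mul (by positivity)]
  have hI2 : ∫⁻ z in Set.univ ×ˢ U, F z ≤ ENNReal.ofReal (Q * A * J * V) := by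
    rw [Measure.volume_eq_prod, ← Measure.prod_restrict, lintegral_prod_symm _ hFm.aemeasurable]
    have : ∀ y : EuclideanSpace ℝ (Fin n), ∫⁻ x in Set.univ, F (x, y) =
        ENNReal.ofReal (Q * A) * ENNReal.ofReal J := by
      intro y
      rw [Measure.restrict_univ]
      simp only [hF]
      rw [lintegral_const_mul' _ _ ENNReal.ofReal_ne_top,
        lintegral_sub_right_eq_self (fun x => ENNReal.ofReal (Φ x)) y, hJl]
    simp_rw [this]
    rw [setLIntegral_const, ← ENNReal.ofReal_mul (by positivity), ← ENNReal.ofReal_toReal hUt,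
      ← ENNReal.ofReal_mul (by positivity)]
  calc energy U d s p w ≤ ∫⁻ z in crossSet U, F z := lintegral_mono hpt
    _ ≤ ∫⁻ z in (U ×ˢ Set.univ) ∪ (Set.univ ×ˢ U), F z :=
        lintegral_mono' (Measure.restrict_mono hcross le_rfl) le_rfl
    _ ≤ (∫⁻ z in U ×ˢ Set.univ, F z) + ∫⁻ z in Set.univ ×ˢ U, F z := lintegral_union_le _ _ _
    _ ≤ ENNReal.ofReal (Q * A * J * V) + ENNReal.ofReal (Q * A * J * V) := add_le_add hI1 hI2
    _ ≤ ENNReal.ofReal ((2 * A * J * V + 1) * Q) := by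
        rw [← ENNReal.ofReal_add (by positivity) (by positivity)]
        exact ENNReal.ofReal_le_ofReal (by nlinarith)

end Truncated

/-! ### The diameter and the extremal cone -/

section Cone

variable {n : ℕ} {U : Set (EuclideanSpace ℝ (Fin n))}
  {d : EuclideanSpace ℝ (Fin n) → EuclideanSpace ℝ (Fin n) → ℝ} {s p : ℝ}
  {u : EuclideanSpace ℝ (Fin n) → ℝ}

lemma exists_diamD_eq (hU : IsSmoothBoundedDomain U) (hd : IsEquivDistance d) :
    ∃ x₀ ∈ closure U, ∃ y₀ ∈ closure U, d x₀ y₀ = diamD U d ∧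
      ∀ x ∈ closure U, ∀ y ∈ closure U, d x y ≤ diamD U d := by
  have hK : IsCompact (closure U ×ˢ closure U) := hU.isCompact_closure.prod hU.isCompact_closure
  have hne : (closure U ×ˢ closure U).Nonempty :=
    hU.isConnected.nonempty.closure.prod hU.isConnected.nonempty.closure
  obtain ⟨z, hz, hmax⟩ := hK.exists_isMaxOn hne hd.continuous.continuousOn
  have hgr : IsGreatest (Set.image2 d (closure U) (closure U)) (d z.1 z.2) := by
    refine ⟨⟨z.1, hz.1, z.2, hz.2, rfl⟩, ?_⟩
    rintro _ ⟨x, hx, y, hy, rfl⟩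
    exact hmax (show (x, y) ∈ closure U ×ˢ closure U from ⟨hx, hy⟩)
  have heq : diamD U d = d z.1 z.2 := hgr.csSup_eq
  refine ⟨z.1, hz.1, z.2, hz.2, heq.symm, fun x hx y hy => ?_⟩
  rw [heq]
  exact hgr.2 ⟨x, hx, y, hy, rfl⟩

lemma diamD_pos (hn : 1 ≤ n) (hU : IsSmoothBoundedDomain U) (hd : IsEquivDistance d) :
    0 < diamD U d := by
  have : Nonempty (Fin n) := ⟨⟨0, hn⟩⟩
  obtain ⟨x₀, -, y₀, -, -, hle⟩ := exists_diamD_eq hU hd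
  obtain ⟨x, hx⟩ := hU.isConnected.nonempty
  have : (𝓝[≠] x).NeBot := inferInstance
  obtain ⟨y, hyU, hyx⟩ := ((eventually_nhdsWithin_of_eventually_nhds
    (hU.isOpen.mem_nhds hx)).and self_mem_nhdsWithin).exists (f := 𝓝[≠] x)
  exact (hd.pos hyx).trans_le (hle y (subset_closure hyU) x (subset_closure hx))

/-- The cone with apex `x₀`, rescaled so that it goes from `-1` at `x₀` to `1` at distance `D`. -/
noncomputable def cone (d : EuclideanSpace ℝ (Fin n) → EuclideanSpace ℝ (Fin n) → ℝ) (D : ℝ)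
    (x₀ : EuclideanSpace ℝ (Fin n)) : EuclideanSpace ℝ (Fin n) → ℝ :=
  fun x => 2 / D * min (d x x₀) D - 1

lemma abs_cone_sub_le (hd : IsEquivDistance d) {D : ℝ} (hD : 0 < D)
    (x₀ x y : EuclideanSpace ℝ (Fin n)) :
    |cone d D x₀ x - cone d D x₀ y| ≤ 2 / D * min (d x y) D := by
  have h1 : cone d D x₀ x - cone d D x₀ y = 2 / D * (min (d x x₀) D - min (d y x₀) D) := by
    simp only [cone]; ring
  rw [h1, abs_mul, abs_of_pos (by positivity)]
  refine mul_le_mul_of_nonneg_left (le_min ?_ ?_) (by positivity)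
  · exact (abs_min_sub_min_le_max _ _ _ _).trans
      (max_le (hd.abs_sub_le x y x₀) (by simpa using hd.nonneg x y))
  · have a1 : 0 ≤ min (d x x₀) D := le_min (hd.nonneg _ _) hD.le
    have a2 : 0 ≤ min (d y x₀) D := le_min (hd.nonneg _ _) hD.le
    have a3 := min_le_right (d x x₀) D
    have a4 := min_le_right (d y x₀) D
    rw [abs_le]; constructor <;> linarith

lemma continuous_cone (hd : IsEquivDistance d) (D : ℝ) (x₀ : EuclideanSpace ℝ (Fin n)) :
    Continuous (cone d D x₀) := by
  have : Continuous fun x => d x x₀ := hd.continuous.comp (continuous_id.prodMk continuous_const)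
  unfold cone
  fun_prop

lemma abs_cone_le_one (hd : IsEquivDistance d) {D : ℝ} (hD : 0 < D)
    (x₀ x : EuclideanSpace ℝ (Fin n)) : |cone d D x₀ x| ≤ 1 := by
  have a1 : 0 ≤ min (d x x₀) D := le_min (hd.nonneg _ _) hD.le
  have a3 := min_le_right (d x x₀) D
  have a4 : 2 / D * min (d x x₀) D ≤ 2 := by
    rw [div_mul_eq_mul_div, div_le_iff₀ hD]; linarith
  have a5 : 0 ≤ 2 / D * min (d x x₀) D := by positivity
  rw [cone, abs_le]; constructor <;> linarith

lemma cone_apex (hd : IsEquivDistance d) {D : ℝ} (hD : 0 < D) (x₀ : EuclideanSpace ℝ (Fin n)) :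
    cone d D x₀ x₀ = -1 := by
  simp [cone, hd.self_eq_zero, hD.le]

lemma cone_eq_one {D : ℝ} (hD : 0 < D) {x₀ y₀ : EuclideanSpace ℝ (Fin n)} (h : d y₀ x₀ = D) :
    cone d D x₀ y₀ = 1 := by
  simp only [cone, h, min_self]
  field_simp
  norm_num

/-- The truncated linear profile of the cone lies below the `s`-Hölder profile that it meets at
`t = D`. -/
lemma rpow_min_div_le {t D : ℝ} (ht : 0 ≤ t) (hD : 0 < D) (hs0 : 0 < s) (hs1 : s < 1) :
    2 / D * min t D ≤ 2 / D ^ s * t ^ s := by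
  have h1 : min t D ≤ D ^ (1 - s) * t ^ s := by
    rcases le_total t D with h | h
    · rw [min_eq_left h]
      rcases eq_or_lt_of_le ht with rfl | ht0
      · positivity
      · calc t = t ^ (1 - s) * t ^ s := by rw [← Real.rpow_add ht0]; simp
          _ ≤ _ := by gcongr
    · rw [min_eq_right h]
      calc D = D ^ (1 - s) * D ^ s := by rw [← Real.rpow_add hD]; simp
        _ ≤ _ := by gcongr
  calc 2 / D * min t D ≤ 2 / D * (D ^ (1 - s) * t ^ s) := by gcongr
    _ = 2 / D ^ s * t ^ s := by
      rw [Real.rpow_sub hD, Real.rpow_one]; field_simp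

/-- A pointwise Hölder bound controls the Hölder quotients; diagonal pairs contribute `0`. -/
lemma holderSup_le (hd : IsEquivDistance d) {L : ℝ}
    {S : Set (EuclideanSpace ℝ (Fin n) × EuclideanSpace ℝ (Fin n))}
    (h : ∀ z ∈ S, |u z.1 - u z.2| ≤ L * d z.1 z.2 ^ s) : holderSup d s S u ≤ ENNReal.ofReal L := by
  refine iSup₂_le fun z hz => ?_
  rcases eq_or_ne z.1 z.2 with he | he
  · simp [he]
  · refine ENNReal.ofReal_le_ofReal ?_
    have := hd.pos he
    rw [div_le_iff₀ (by positivity)]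
    exact h z hz

lemma abs_sub_le_of_holderSup (hd : IsEquivDistance d)
    {S : Set (EuclideanSpace ℝ (Fin n) × EuclideanSpace ℝ (Fin n))}
    (h : holderSup d s S u ≠ ⊤) {x y : EuclideanSpace ℝ (Fin n)} (hxy : (x, y) ∈ S) :
    |u x - u y| ≤ (holderSup d s S u).toReal * d x y ^ s := by
  rcases eq_or_ne x y with rfl | he
  · simp; have := hd.nonneg x x; positivity
  · have h0 := hd.pos he
    have h1 : ENNReal.ofReal (|u x - u y| / d x y ^ s) ≤ holderSup d s S u :=
      le_iSup₂_of_le (f := fun z (_ : z ∈ S) => ENNReal.ofReal (|u z.1 - u z.2| / d z.1 z.2 ^ s))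
        (x, y) hxy le_rfl
    rw [ENNReal.ofReal_le_iff_le_toReal h, div_le_iff₀ (by positivity)] at h1
    exact h1

lemma prod_subset_crossSet : U ×ˢ U ⊆ crossSet U := by
  rintro ⟨x, y⟩ ⟨hx, -⟩
  simp [crossSet]; exact fun h => absurd hx h

lemma seminormInf_le_energyInf : seminormInf U d s u ≤ energyInf U d s u :=
  biSup_mono fun _ hz => prod_subset_crossSet hz

/-- On an open set the essential supremum of a continuous function dominates its values. -/
lemma ofReal_abs_le_normLinf (hU : IsOpen U) (hu : ContinuousOn u U)
    {x : EuclideanSpace ℝ (Fin n)} (hx : x ∈ U) : ENNReal.ofReal |u x| ≤ normLinf U u := by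
  by_contra! h
  rw [normLinf, eLpNorm_exponent_top] at h
  have hev : ∀ᶠ y in 𝓝 x, eLpNormEssSup u (volume.restrict U) < ENNReal.ofReal |u y| ∧ y ∈ U := by
    have hc : ContinuousAt (fun y => ENNReal.ofReal |u y|) x :=
      ENNReal.continuous_ofReal.continuousAt.comp (hu.continuousAt (hU.mem_nhds hx)).abs
    exact (hc.eventually (lt_mem_nhds h)).and (hU.mem_nhds hx)
  obtain ⟨V, hV, hVo, hxV⟩ := mem_nhds_iff.1 hev
  have hpos : 0 < volume V := hVo.measure_pos _ ⟨x, hxV⟩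
  have hae := ae_le_eLpNormEssSup (f := u) (μ := volume.restrict U)
  rw [ae_restrict_iff' hU.measurableSet] at hae
  have hsub : V ⊆ {y | ¬ (y ∈ U → ‖u y‖ₑ ≤ eLpNormEssSup u (volume.restrict U))} := by
    intro y hy
    have := hV hy
    simp only [Set.mem_ofPred_eq] at this ⊢
    rw [Real.enorm_eq_ofReal_abs]
    exact fun h' => (h' this.2).not_gt this.1
  exact hpos.ne' (measure_mono_null hsub hae)

lemma normLinf_le {M : ℝ} (hU : MeasurableSet U) (h : ∀ x ∈ U, |u x| ≤ M) :
    normLinf U u ≤ ENNReal.ofReal M := by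
  rw [normLinf, eLpNorm_exponent_top]
  refine eLpNormEssSup_le_of_ae_bound ?_
  filter_upwards [ae_restrict_mem hU] with x hx
  exact h x hx

/-- A balanced function oscillates by twice its maximum within one diameter. -/
lemma two_mul_sup_le (hU : IsSmoothBoundedDomain U) (hd : IsEquivDistance d) (hs : 0 < s)
    {L M m : ℝ} (hL : 0 ≤ L) (h : ∀ x ∈ U, ∀ y ∈ U, |u x - u y| ≤ L * d x y ^ s)
    (hM : IsLUB (u '' U) M) (hm : IsGLB (u '' U) m) (hMm : M + m = 0) :
    2 * M ≤ L * diamD U d ^ s := by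
  obtain ⟨x₀, -, y₀, -, -, hle⟩ := exists_diamD_eq hU hd
  refine le_of_forall_pos_lt_add fun ε hε => ?_
  obtain ⟨_, ⟨x, hx, rfl⟩, hx1, -⟩ := hM.exists_between (show M - ε / 2 < M by linarith)
  obtain ⟨_, ⟨y, hy, rfl⟩, -, hy1⟩ := hm.exists_between (show m < m + ε / 2 by linarith)
  have h1 := (abs_le.1 (h x hx y hy)).2
  have h2 : L * d x y ^ s ≤ L * diamD U d ^ s := by
    have := hd.nonneg x y
    have := hle x (subset_closure hx) y (subset_closure hy)
    gcongr
  linarith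

lemma continuousOn_of_holder (hd : IsEquivDistance d) (hs : 0 < s) {L : ℝ} (hL : 0 ≤ L)
    {S : Set (EuclideanSpace ℝ (Fin n))} (h : ∀ x ∈ S, ∀ y ∈ S, |u x - u y| ≤ L * d x y ^ s) :
    ContinuousOn u S := by
  obtain ⟨_, C, _, hC, hequiv⟩ := hd.equiv
  rw [continuousOn_iff_continuous_domRestrict]
  refine continuous_of_holder (K := L * C ^ s) hs fun x y => (h x x.2 y y.2).trans ?_
  rw [mul_assoc, ← Real.mul_rpow hC.le dist_nonneg]
  have := hd.nonneg x y
  gcongr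
  exact (hequiv x y).2

/-- The lower bound for the Hölder quotient of a balanced function that is nonzero on `U`. -/
lemma le_seminormInf_div (hn : 1 ≤ n) (hU : IsSmoothBoundedDomain U) (hd : IsEquivDistance d)
    (hs : 0 < s) (hfin : seminormInf U d s u ≠ ⊤) (hne : ∃ x ∈ U, u x ≠ 0)
    (hbal : SupAddInfZero U u) :
    ENNReal.ofReal (2 / diamD U d ^ s) ≤ seminormInf U d s u / normLinf U u := by
  obtain ⟨M, m, hM, hm, hMm⟩ := hbal
  have hD := diamD_pos hn hU hd
  have hH : ∀ x ∈ U, ∀ y ∈ U, |u x - u y| ≤ (seminormInf U d s u).toReal * d x y ^ s :=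
    fun x hx y hy => abs_sub_le_of_holderSup hd hfin (show (x, y) ∈ U ×ˢ U from ⟨hx, hy⟩)
  have h2 := two_mul_sup_le hU hd hs ENNReal.toReal_nonneg hH hM hm hMm
  have habs : ∀ x ∈ U, |u x| ≤ M := fun x hx => by
    have h3 := hM.1 ⟨x, hx, rfl⟩
    have h4 := hm.1 ⟨x, hx, rfl⟩
    rw [abs_le]; constructor <;> linarith
  have hN := normLinf_le hU.isOpen.measurableSet habs
  have hcont := continuousOn_of_holder hd hs ENNReal.toReal_nonneg hH
  have hN0 : normLinf U u ≠ 0 := by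
    obtain ⟨x, hx, hx0⟩ := hne
    have := ofReal_abs_le_normLinf hU.isOpen hcont hx
    intro h0
    rw [h0, nonpos_iff_eq_zero, ENNReal.ofReal_eq_zero] at this
    exact hx0 (abs_nonpos_iff.1 this)
  rw [ENNReal.le_div_iff_mul_le (Or.inl hN0) (Or.inl (hN.trans_lt ENNReal.ofReal_lt_top).ne)]
  refine (mul_le_mul_right hN _).trans ?_
  rw [← ENNReal.ofReal_mul (by positivity), ← ENNReal.ofReal_toReal hfin]
  refine ENNReal.ofReal_le_ofReal ?_
  rw [div_mul_eq_mul_div, div_le_iff₀ (by positivity)]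
  exact h2

lemma le_LambdaNInf (hn : 1 ≤ n) (hU : IsSmoothBoundedDomain U) (hd : IsEquivDistance d)
    (hs : 0 < s) : ENNReal.ofReal (2 / diamD U d ^ s) ≤ LambdaNInf U d s :=
  le_iInf₂ fun _ hu => le_seminormInf_div hn hU hd hs (ENNReal.add_lt_top.1 hu.2.1).2.ne hu.2.2.1
    hu.2.2.2

lemma le_LambdaInf (hn : 1 ≤ n) (hU : IsSmoothBoundedDomain U) (hd : IsEquivDistance d)
    (hs : 0 < s) : ENNReal.ofReal (2 / diamD U d ^ s) ≤ LambdaInf U d s := by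
  refine le_iInf₂ fun u hu => ?_
  obtain ⟨-, hfin, hu0, hbal⟩ := hu
  have hfin' := (ENNReal.add_lt_top.1 hfin).2
  by_cases hne : ∃ x ∈ U, u x ≠ 0
  · exact (le_seminormInf_div hn hU hd hs (seminormInf_le_energyInf.trans_lt hfin').ne hne
      hbal).trans (ENNReal.div_le_div_right seminormInf_le_energyInf _)
  · -- a nonzero function vanishing on `U` has positive energy, so that its quotient is infinite
    push Not at hne
    obtain ⟨y, hy⟩ := Function.ne_iff.1 hu0
    obtain ⟨x, hx⟩ := hU.isConnected.nonempty
    have h1 := abs_sub_le_of_holderSup hd hfin'.ne (x := x) (y := y) (by simp [crossSet, hx])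
    rw [hne x hx] at h1
    have h2 : energyInf U d s u ≠ 0 := by
      intro h0
      rw [energyInf] at h0
      rw [h0] at h1
      simp at h1
      exact hy h1
    have h3 : normLinf U u = 0 := by
      have := normLinf_le (M := 0) hU.isOpen.measurableSet (u := u) fun x hx => by simp [hne x hx]
      simpa using this
    rw [h3, ENNReal.div_zero h2]
    exact le_top

/-- Data of a balanced function with the optimal Hölder constant: it is a minimizer of both limit
problems. -/
lemma isMinimizer_of_holder (hn : 1 ≤ n) (hU : IsSmoothBoundedDomain U) (hd : IsEquivDistance d)
    (hs : 0 < s)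
    (h : ∀ x y, |u x - u y| ≤ 2 / diamD U d ^ s * d x y ^ s) (hM : IsLUB (u '' U) 1)
    (hm : IsGLB (u '' U) (-1)) :
    u ∈ classAN U d s ∧ seminormInf U d s u / normLinf U u = ENNReal.ofReal (2 / diamD U d ^ s) ∧
    u ∈ classA U d s ∧ energyInf U d s u / normLinf U u = ENNReal.ofReal (2 / diamD U d ^ s) := by
  have hD := diamD_pos hn hU hd
  have hcont : Continuous u := by
    rw [← continuousOn_univ]
    exact continuousOn_of_holder hd hs (L := 2 / diamD U d ^ s) (by positivity) fun x _ y _ => h x y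
  have hbal : SupAddInfZero U u := ⟨1, -1, hM, hm, by norm_num⟩
  have habs : ∀ x ∈ U, |u x| ≤ 1 := fun x hx => by
    rw [abs_le]
    exact ⟨hm.1 ⟨x, hx, rfl⟩, hM.1 ⟨x, hx, rfl⟩⟩
  have hN := normLinf_le hU.isOpen.measurableSet habs
  have hN1 : normLinf U u = 1 := by
    refine le_antisymm (by simpa using hN) (le_of_forall_lt fun a ha => ?_)
    have hat : a ≠ ⊤ := (ha.trans ENNReal.one_lt_top).ne
    have ha1 : a.toReal < 1 := by
      rw [← ENNReal.toReal_one]; exact (ENNReal.toReal_lt_toReal hat ENNReal.one_ne_top).2 ha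
    obtain ⟨_, ⟨x, hx, rfl⟩, hx1, -⟩ := hM.exists_between ha1
    refine lt_of_lt_of_le ?_ (ofReal_abs_le_normLinf hU.isOpen hcont.continuousOn hx)
    rw [ENNReal.lt_ofReal_iff_toReal_lt hat]
    exact hx1.trans_le (le_abs_self _)
  have hne : ∃ x ∈ U, u x ≠ 0 := by
    obtain ⟨_, ⟨x, hx, rfl⟩, hx1, -⟩ := hM.exists_between (zero_lt_one' ℝ)
    exact ⟨x, hx, hx1.ne'⟩
  have hE : energyInf U d s u ≤ ENNReal.ofReal (2 / diamD U d ^ s) :=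
    holderSup_le hd fun z _ => h z.1 z.2
  have hS : seminormInf U d s u ≤ ENNReal.ofReal (2 / diamD U d ^ s) :=
    seminormInf_le_energyInf.trans hE
  have hlow := le_seminormInf_div hn hU hd hs (hS.trans_lt ENNReal.ofReal_lt_top).ne hne hbal
  have hmid : seminormInf U d s u / normLinf U u ≤ energyInf U d s u / normLinf U u :=
    ENNReal.div_le_div_right seminormInf_le_energyInf _
  rw [hN1, div_one] at hlow
  rw [hN1, div_one, div_one]
  refine ⟨⟨hcont.aemeasurable, ?_, hne, hbal⟩, le_antisymm hS hlow,
    ⟨hcont.aemeasurable, ?_, ?_, hbal⟩,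
    le_antisymm hE (hlow.trans seminormInf_le_energyInf)⟩
  · rw [hN1]
    exact ENNReal.add_lt_top.2 ⟨ENNReal.one_lt_top, hS.trans_lt ENNReal.ofReal_lt_top⟩
  · rw [hN1]
    exact ENNReal.add_lt_top.2 ⟨ENNReal.one_lt_top, hE.trans_lt ENNReal.ofReal_lt_top⟩
  · obtain ⟨x, -, hx⟩ := hne
    exact fun h0 => hx (by rw [h0]; rfl)

/-- On a set with a continuous function, extreme values on the closure are extreme bounds. -/
lemma isLUB_image_of_closure {X : Type*} [TopologicalSpace X] {U : Set X} {w : X → ℝ}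
    (hw : Continuous w) {M : ℝ} (hle : ∀ x, w x ≤ M) {x : X} (hx : x ∈ closure U) (hxM : w x = M) :
    IsLUB (w '' U) M := by
  refine ⟨?_, fun b hb => ?_⟩
  · rintro _ ⟨y, -, rfl⟩; exact hle y
  · rw [← hxM]
    have : closure U ⊆ {y | w y ≤ b} :=
      closure_minimal (fun y hy => hb ⟨y, hy, rfl⟩) (isClosed_le hw continuous_const)
    exact this hx

lemma isLUB_cone (hd : IsEquivDistance d) (hD : 0 < diamD U d)
    {x₀ y₀ : EuclideanSpace ℝ (Fin n)} (hx₀ : x₀ ∈ closure U) (hy₀ : y₀ ∈ closure U)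
    (h : d x₀ y₀ = diamD U d) :
    IsLUB (cone d (diamD U d) x₀ '' U) 1 ∧ IsGLB (cone d (diamD U d) x₀ '' U) (-1) := by
  have hc := continuous_cone hd (diamD U d) x₀
  refine ⟨isLUB_image_of_closure hc (fun x => (abs_le.1 (abs_cone_le_one hd hD x₀ x)).2) hy₀
    (cone_eq_one hD (by rw [hd.symm, h])), ?_⟩
  have h2 := isLUB_image_of_closure hc.neg (fun x =>
    neg_le.1 (abs_le.1 (abs_cone_le_one hd hD x₀ x)).1) hx₀ (by
      rw [Pi.neg_apply, cone_apex hd hD, neg_neg])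
  constructor
  · rintro _ ⟨y, -, rfl⟩; exact (abs_le.1 (abs_cone_le_one hd hD x₀ y)).1
  · intro b hb
    have : 1 ≤ -b := h2.2 (by
      rintro _ ⟨y, hy, rfl⟩
      exact neg_le_neg (hb ⟨y, hy, rfl⟩))
    linarith

lemma Lambda_eq (hn : 1 ≤ n) (hU : IsSmoothBoundedDomain U) (hd : IsEquivDistance d)
    (hs : 0 < s) (hs1 : s < 1) :
    LambdaInf U d s = ENNReal.ofReal (2 / diamD U d ^ s) ∧
      LambdaNInf U d s = ENNReal.ofReal (2 / diamD U d ^ s) := by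
  have hD := diamD_pos hn hU hd
  obtain ⟨x₀, hx₀, y₀, hy₀, heq, -⟩ := exists_diamD_eq hU hd
  obtain ⟨hL, hG⟩ := isLUB_cone hd hD hx₀ hy₀ heq
  obtain ⟨h1, h2, h3, h4⟩ := isMinimizer_of_holder hn hU hd hs (fun x y =>
    (abs_cone_sub_le hd hD x₀ x y).trans (rpow_min_div_le (hd.nonneg x y) hD hs hs1)) hL hG
  exact ⟨le_antisymm (h4 ▸ iInf₂_le _ h3) (le_LambdaInf hn hU hd hs),
    le_antisymm (h2 ▸ iInf₂_le _ h1) (le_LambdaNInf hn hU hd hs)⟩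

end Cone

/-! ### Upper bounds for the infimum -/

section Rayleigh

variable {n : ℕ} {U : Set (EuclideanSpace ℝ (Fin n))}
  {d : EuclideanSpace ℝ (Fin n) → EuclideanSpace ℝ (Fin n) → ℝ} {s p : ℝ}
  {u v : EuclideanSpace ℝ (Fin n) → ℝ}

lemma integral_eq_zero_of_ae_eq_zero (hp : 1 < p) (h : u =ᵐ[volume] 0) :
    ∫ x in U, |u x| ^ p = 0 := by
  rw [← integral_zero (EuclideanSpace ℝ (Fin n)) ℝ (μ := volume.restrict U)]
  refine integral_congr_ae (ae_restrict_of_ae (h.mono fun x hx => ?_))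
  simp [hx, Real.zero_rpow (by linarith : p ≠ 0)]

lemma quotient_eq (hd : IsEquivDistance d) (hp : 1 < p) (hu : u ∈ spaceW U d s p)
    (hN : 0 < ∫ x in U, |u x| ^ p) : quotient U d s p u =
      ENNReal.ofReal ((∫ z, |pairDiff u z| ^ p ∂pairMeasure U d s p) /
        (2 * ∫ x in U, |u x| ^ p)) := by
  rw [quotient, energy_eq_ofReal hd hp hu, normLp_rpow_eq_ofReal hd hp hu,
    ENNReal.ofReal_div_of_pos (by positivity), ENNReal.ofReal_mul (by norm_num)]
  norm_num

/-- The cone, shifted by its best constant approximation, is an admissible competitor. -/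
lemma exists_lam_le (hn : 1 ≤ n) (hU : IsSmoothBoundedDomain U) (hd : IsEquivDistance d)
    (hs : 0 < s) (hs1 : s < 1) {ε : ℝ} (hε : 0 < ε) (hε1 : ε < 1) :
    ∃ C₁ : ℝ, 0 < C₁ ∧ ∀ p : ℝ, 1 < p →
      lam U d s p ≤ ENNReal.ofReal (C₁ * (2 / diamD U d ^ s / (1 - ε)) ^ p) := by
  have hD := diamD_pos hn hU hd
  set D := diamD U d with hDdef
  obtain ⟨x₀, hx₀, y₀, hy₀, heq, -⟩ := exists_diamD_eq hU hd
  obtain ⟨hL, hG⟩ := isLUB_cone hd hD hx₀ hy₀ heq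
  obtain ⟨C₀, hC₀, hC₀e⟩ := exists_energy_le hn hU hd hs hs1 hD
  have hUt := hU.volume_ne_top
  have : IsFiniteMeasure (volume.restrict U) := isFiniteMeasure_restrict.2 hUt
  set w := cone d D x₀ with hw
  have hwc : Continuous w := continuous_cone hd D x₀
  -- the cone is close to `-1` and to `1` on sets of positive measure
  set V₁ := U ∩ {x | w x < -1 + ε} with hV₁
  set V₂ := U ∩ {x | 1 - ε < w x} with hV₂
  have hV₁o : IsOpen V₁ := hU.isOpen.inter (isOpen_lt hwc continuous_const)
  have hV₂o : IsOpen V₂ := hU.isOpen.inter (isOpen_lt continuous_const hwc)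
  have hV₁n : V₁.Nonempty := by
    obtain ⟨_, ⟨x, hx, rfl⟩, -, hx1⟩ := hG.exists_between (show -1 < -1 + ε by linarith)
    exact ⟨x, hx, hx1⟩
  have hV₂n : V₂.Nonempty := by
    obtain ⟨_, ⟨x, hx, rfl⟩, hx1, -⟩ := hL.exists_between (show 1 - ε < 1 by linarith)
    exact ⟨x, hx, hx1⟩
  have hV₁t : volume V₁ ≠ ⊤ := measure_ne_top_of_subset Set.inter_subset_left hUt
  have hV₂t : volume V₂ ≠ ⊤ := measure_ne_top_of_subset Set.inter_subset_left hUt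
  set m := min (volume.real V₁) (volume.real V₂) with hm
  have hm0 : 0 < m := lt_min (ENNReal.toReal_pos (hV₁o.measure_pos _ hV₁n).ne' hV₁t)
    (ENNReal.toReal_pos (hV₂o.measure_pos _ hV₂n).ne' hV₂t)
  refine ⟨C₀ / (2 * m), by positivity, fun p hp => ?_⟩
  have hp0 : 0 < p := by linarith
  have hE := hC₀e p hp (2 / D) (by positivity) w (abs_cone_sub_le hd hD x₀)
  have hK : 2 / D * D ^ (1 - s) = 2 / D ^ s := by
    rw [Real.rpow_sub hD, Real.rpow_one]; field_simp
  rw [hK] at hE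
  have hwL : MemLp w (ENNReal.ofReal p) (volume.restrict U) :=
    MemLp.of_bound hwc.aestronglyMeasurable 1
      (Eventually.of_forall fun x => abs_cone_le_one hd hD x₀ x)
  have hwW : w ∈ spaceW U d s p := by
    refine ⟨hwc.aemeasurable, ENNReal.add_lt_top.2 ⟨?_, hE.trans_lt ENNReal.ofReal_lt_top⟩⟩
    exact ENNReal.rpow_lt_top_of_nonneg hp0.le hwL.2.ne
  obtain ⟨c, hc⟩ := exists_best_constant hp hwL
  have hvW := sub_const_mem_spaceW hd hp hUt hwW c
  have hvL := ((mem_spaceW_iff hd hp).1 hvW).2.1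
  -- for `c ≥ 0` the function `w - c` is large on `V₁`, and for `c ≤ 0` on `V₂`
  have hlow : (1 - ε) ^ p * m ≤ ∫ x in U, |w x - c| ^ p := by
    have hint := integrable_abs_rpow hp hvL
    have key : ∀ V, MeasurableSet V → V ⊆ U → volume V ≠ ⊤ → (∀ x ∈ V, 1 - ε ≤ |w x - c|) →
        (1 - ε) ^ p * volume.real V ≤ ∫ x in U, |w x - c| ^ p := by
      intro V hV hVU hVt hle
      calc (1 - ε) ^ p * volume.real V = ∫ _ in V, (1 - ε) ^ p := by
            rw [setIntegral_const, smul_eq_mul, mul_comm]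
        _ ≤ ∫ x in V, |w x - c| ^ p := by
            refine setIntegral_mono_on (integrableOn_const hVt)
              (IntegrableOn.mono_set hint hVU) hV fun x hx => ?_
            exact Real.rpow_le_rpow (by linarith) (hle x hx) hp0.le
        _ ≤ _ := setIntegral_mono_set hint (Eventually.of_forall fun x => by positivity)
            hVU.eventuallyLE
    have h1e : 0 ≤ (1 - ε) ^ p := Real.rpow_nonneg (by linarith) p
    rcases le_total 0 c with h | h
    · refine (mul_le_mul_of_nonneg_left (min_le_left _ _) h1e).trans
        (key V₁ hV₁o.measurableSet Set.inter_subset_left hV₁t fun x hx => ?_)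
      have : w x < -1 + ε := hx.2
      rw [abs_sub_comm]
      exact le_trans (by linarith) (le_abs_self _)
    · refine (mul_le_mul_of_nonneg_left (min_le_right _ _) h1e).trans
        (key V₂ hV₂o.measurableSet Set.inter_subset_left hV₂t fun x hx => ?_)
      have : 1 - ε < w x := hx.2
      exact le_trans (by linarith) (le_abs_self _)
  have h1e : 0 < (1 - ε) ^ p := Real.rpow_pos_of_pos (by linarith) p
  have hNpos : 0 < ∫ x in U, |w x - c| ^ p := lt_of_lt_of_le (by positivity) hlow
  have hadm : (fun x => w x - c) ∈ admissible U d s p :=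
    ⟨hvW, fun h => hNpos.ne' (integral_eq_zero_of_ae_eq_zero hp h), hc⟩
  refine (iInf₂_le _ hadm).trans ?_
  rw [quotient, energy_sub_const, normLp_rpow_eq_ofReal hd hp hvW]
  refine ENNReal.div_le_of_le_mul ?_
  refine hE.trans ?_
  have h2N : 2 * ENNReal.ofReal (∫ x in U, |w x - c| ^ p) =
      ENNReal.ofReal (2 * ∫ x in U, |w x - c| ^ p) := by
    rw [ENNReal.ofReal_mul (by norm_num)]; norm_num
  rw [h2N, ← ENNReal.ofReal_mul (by
      have : 0 < 1 - ε := by linarith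
      positivity)]
  refine ENNReal.ofReal_le_ofReal ?_
  rw [Real.div_rpow (x := 2 / D ^ s) (by positivity) (by linarith)]
  have hQ : 0 < (2 / D ^ s) ^ p := by positivity
  calc C₀ * (2 / D ^ s) ^ p
      = C₀ / (2 * m) * ((2 / D ^ s) ^ p / (1 - ε) ^ p) * (2 * ((1 - ε) ^ p * m)) := by
        field_simp
    _ ≤ _ := by gcongr

lemma lam_ne_top (hn : 1 ≤ n) (hU : IsSmoothBoundedDomain U) (hd : IsEquivDistance d)
    (hs : 0 < s) (hs1 : s < 1) (hp : 1 < p) : lam U d s p ≠ ⊤ := by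
  obtain ⟨C₁, -, h⟩ := exists_lam_le hn hU hd hs hs1 (show (0 : ℝ) < 1 / 2 by norm_num)
    (by norm_num)
  exact ((h p hp).trans_lt ENNReal.ofReal_lt_top).ne

/-! ### Existence of minimizers -/

/-- The Rayleigh inequality for functions in `𝓦^{s,p}(U)` that satisfy the constraint. -/
lemma two_mul_lam_mul_le (hn : 1 ≤ n) (hU : IsSmoothBoundedDomain U) (hd : IsEquivDistance d)
    (hs : 0 < s) (hs1 : s < 1) (hp : 1 < p) (hv : v ∈ spaceW U d s p)
    (hc : ∫ x in U, |v x| ^ (p - 2) * v x = 0) :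
    2 * (lam U d s p).toReal * ∫ x in U, |v x| ^ p ≤
      ∫ z, |pairDiff v z| ^ p ∂pairMeasure U d s p := by
  have hN0 : 0 ≤ ∫ x in U, |v x| ^ p := integral_abs_rpow_nonneg v
  have hE0 : 0 ≤ ∫ z, |pairDiff v z| ^ p ∂pairMeasure U d s p := integral_abs_rpow_nonneg _
  rcases eq_or_lt_of_le hN0 with h | h
  · rw [← h, mul_zero]; exact hE0
  · have hadm : v ∈ admissible U d s p :=
      ⟨hv, fun h0 => h.ne' (integral_eq_zero_of_ae_eq_zero hp h0), hc⟩
    have h1 : lam U d s p ≤ quotient U d s p v := iInf₂_le _ hadm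
    rw [quotient_eq hd hp hv h, ENNReal.le_ofReal_iff_toReal_le
      (lam_ne_top hn hU hd hs hs1 hp) (by positivity), le_div_iff₀ (by positivity)] at h1
    linarith

/-- Without the constraint, the inequality holds after subtraction of a constant. -/
lemma exists_const_two_mul_lam_mul_le (hn : 1 ≤ n) (hU : IsSmoothBoundedDomain U)
    (hd : IsEquivDistance d) (hs : 0 < s) (hs1 : s < 1) (hp : 1 < p) (hv : v ∈ spaceW U d s p) :
    ∃ c : ℝ, 2 * (lam U d s p).toReal * ∫ x in U, |v x - c| ^ p ≤
      ∫ z, |pairDiff v z| ^ p ∂pairMeasure U d s p := by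
  have : IsFiniteMeasure (volume.restrict U) := isFiniteMeasure_restrict.2 hU.volume_ne_top
  obtain ⟨c, hc⟩ := exists_best_constant hp ((mem_spaceW_iff hd hp).1 hv).2.1
  refine ⟨c, (two_mul_lam_mul_le hn hU hd hs hs1 hp
    (sub_const_mem_spaceW hd hp hU.volume_ne_top hv c) hc).trans (le_of_eq ?_)⟩
  simp [pairDiff]

/-- A competitor with finite quotient does not vanish almost everywhere in `U`: otherwise its energy
would vanish as well, and it would be a constant. -/
lemma integral_pos_of_admissible (hn : 1 ≤ n) (hU : IsSmoothBoundedDomain U)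
    (hd : IsEquivDistance d) (hp : 1 < p) (hv : v ∈ admissible U d s p)
    (hq : quotient U d s p v ≠ ⊤) : 0 < ∫ x in U, |v x| ^ p := by
  refine lt_of_le_of_ne (integral_abs_rpow_nonneg v) fun h0 => ?_
  obtain ⟨hvW, hv0, -⟩ := hv
  have hE : energy U d s p v = 0 := by
    by_contra hE
    rw [quotient, normLp_rpow_eq_ofReal hd hp hvW, ← h0] at hq
    simp [ENNReal.div_zero hE] at hq
  obtain ⟨c, hc⟩ := ae_eq_const_of_energy_eq_zero hn hd hU.isOpen.measurableSet hU.volume_ne_zero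
    hp hvW hE
  have h1 : ∫ x in U, |v x| ^ p = ∫ _ in U, |c| ^ p :=
    integral_congr_ae (ae_restrict_of_ae (hc.mono fun x hx => by simp [hx]))
  rw [setIntegral_const, ← h0, smul_eq_mul] at h1
  have hV : volume.real U ≠ 0 := (ENNReal.toReal_pos hU.volume_ne_zero hU.volume_ne_top).ne'
  have hc0 : |c| ^ p = 0 := by
    rcases mul_eq_zero.1 h1.symm with h | h
    · exact absurd h hV
    · exact h
  rw [Real.rpow_eq_zero (abs_nonneg c) (by linarith), abs_eq_zero] at hc0
  exact hv0 (hc.mono fun x hx => by simp [hx, hc0])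

/-- Competitors can be normalized in `L ^ p(U)`. -/
lemma exists_normalized (hn : 1 ≤ n) (hU : IsSmoothBoundedDomain U)
    (hd : IsEquivDistance d) (hp : 1 < p) (hv : v ∈ admissible U d s p)
    (hq : quotient U d s p v ≠ ⊤) : ∃ v' ∈ spaceW U d s p, ∫ x in U, |v' x| ^ p = 1 ∧
      ∫ x in U, |v' x| ^ (p - 2) * v' x = 0 ∧
      ∫ z, |pairDiff v' z| ^ p ∂pairMeasure U d s p = 2 * (quotient U d s p v).toReal := by
  have hp0 : 0 < p := by linarith
  have hN := integral_pos_of_admissible hn hU hd hp hv hq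
  set N := ∫ x in U, |v x| ^ p with hNdef
  set t := N⁻¹ ^ (1 / p) with ht
  have ht0 : 0 < t := by positivity
  have htp : t ^ p = N⁻¹ := by
    rw [ht, ← Real.rpow_mul (by positivity), one_div_mul_cancel hp0.ne', Real.rpow_one]
  refine ⟨fun x => t * v x, const_mul_mem_spaceW hd hp hv.1 t, ?_, ?_, ?_⟩
  · simp_rw [abs_mul, abs_of_pos ht0, Real.mul_rpow ht0.le (abs_nonneg _)]
    rw [integral_const_mul, htp, inv_mul_cancel₀ hN.ne']
  · simp_rw [abs_mul, abs_of_pos ht0, Real.mul_rpow ht0.le (abs_nonneg _)]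
    have : ∀ x, t ^ (p - 2) * |v x| ^ (p - 2) * (t * v x) =
        t ^ (p - 2) * t * (|v x| ^ (p - 2) * v x) := fun x => by ring
    simp_rw [this]
    rw [integral_const_mul, hv.2.2, mul_zero]
  · have : ∀ z, |pairDiff (fun x => t * v x) z| ^ p = N⁻¹ * |pairDiff v z| ^ p := by
      intro z
      rw [← htp, ← Real.mul_rpow ht0.le (abs_nonneg _)]
      congr 1
      rw [← abs_of_pos ht0, ← abs_mul, abs_of_pos ht0]
      simp only [pairDiff]; congr 1; ring
    simp_rw [this]
    have hE0 : 0 ≤ ∫ z, |pairDiff v z| ^ p ∂pairMeasure U d s p := integral_abs_rpow_nonneg _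
    rw [integral_const_mul, quotient_eq hd hp hv.1 hN, ENNReal.toReal_ofReal (by positivity),
      ← hNdef]
    field_simp

/-- Convergence in `L ^ p` implies convergence of the `p`-th powers of the norms. -/
lemma tendsto_integral_abs_rpow {α : Type*} {m : MeasurableSpace α} {μ : Measure α}
    (hp : 1 < p) {F : ℕ → α → ℝ} {G : α → ℝ}
    (hF : ∀ k, MemLp (F k) (ENNReal.ofReal p) μ) (hG : MemLp G (ENNReal.ofReal p) μ)
    (h : Tendsto (fun k => eLpNorm (F k - G) (ENNReal.ofReal p) μ) atTop (𝓝 0)) :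
    Tendsto (fun k => ∫ x, |F k x| ^ p ∂μ) atTop (𝓝 (∫ x, |G x| ^ p ∂μ)) := by
  have : Fact (1 ≤ ENNReal.ofReal p) := ⟨by simpa using hp.le⟩
  have h1 : Tendsto (fun k => (hF k).toLp (F k)) atTop (𝓝 (hG.toLp G)) :=
    (Lp.tendsto_Lp_iff_tendsto_eLpNorm'' F hF G hG).2 h
  have h2 := h1.norm.rpow_const (p := p) (Or.inr (by linarith))
  simp_rw [Lp.norm_toLp, ← integral_abs_rpow_eq hp (hF _)] at h2
  rwa [← integral_abs_rpow_eq hp hG] at h2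

/-- The midpoint of two normalized competitors that are close in `L ^ p(U)` has almost the minimal
energy at least. -/
lemma two_mul_lam_mul_rpow_le_midpoint (hn : 1 ≤ n) (hU : IsSmoothBoundedDomain U)
    (hd : IsEquivDistance d) (hs : 0 < s) (hs1 : s < 1) (hp : 1 < p) (hu : u ∈ spaceW U d s p)
    (hv : v ∈ spaceW U d s p) (hu1 : ∫ x in U, |u x| ^ p = 1)
    (hu0 : ∫ x in U, |u x| ^ (p - 2) * u x = 0) {δ : ℝ} (hδ0 : 0 ≤ δ) (hδ1 : δ ≤ 1)
    (hδ : eLpNorm (u - v) (ENNReal.ofReal p) (volume.restrict U) ≤ ENNReal.ofReal (2 * δ)) :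
    2 * (lam U d s p).toReal * (1 - δ) ^ p ≤
      ∫ z, |(pairDiff u z + pairDiff v z) / 2| ^ p ∂pairMeasure U d s p := by
  have hp0 : 0 < p := by linarith
  have : IsFiniteMeasure (volume.restrict U) := isFiniteMeasure_restrict.2 hU.volume_ne_top
  have huL := ((mem_spaceW_iff hd hp).1 hu).2.1
  have hvL := ((mem_spaceW_iff hd hp).1 hv).2.1
  have hmid : (fun x => (1 / 2) * (u x + 1 * v x)) ∈ spaceW U d s p :=
    const_mul_mem_spaceW hd hp (add_smul_mem_spaceW hd hp hu hv 1) (1 / 2)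
  obtain ⟨c, hc⟩ := exists_const_two_mul_lam_mul_le hn hU hd hs hs1 hp hmid
  set q : EuclideanSpace ℝ (Fin n) → ℝ := fun x => (1 / 2) * (u x + 1 * v x) - c with hq
  have hqL : MemLp q (ENNReal.ofReal p) (volume.restrict U) :=
    ((mem_spaceW_iff hd hp).1 hmid).2.1.sub (memLp_const c)
  -- `1 = ‖u‖ ≤ ‖u - c‖ ≤ ‖(u + v) / 2 - c‖ + ‖u - v‖ / 2`, where the first inequality is the
  -- constraint on `u`
  have hle : (1 - δ) ^ p ≤ ∫ x in U, |q x| ^ p := by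
    have h1 := (integral_eq_zero_iff_forall_le hp huL).1 hu0 c
    have hcL : MemLp (fun x => u x - c) (ENNReal.ofReal p) (volume.restrict U) :=
      huL.sub (memLp_const c)
    rw [hu1, integral_abs_rpow_eq hp hcL] at h1
    have h2 : 1 ≤ (eLpNorm (fun x => u x - c) (ENNReal.ofReal p) (volume.restrict U)).toReal := by
      by_contra! h
      have := Real.rpow_lt_one ENNReal.toReal_nonneg h hp0
      exact absurd h1 (not_le.2 this)
    have h3 : (fun x => u x - c) = q + fun x => (1 / 2 : ℝ) • (u - v) x := by
      ext x; simp only [hq, Pi.add_apply, Pi.sub_apply, smul_eq_mul]; ring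
    have h4 : eLpNorm (fun x => u x - c) (ENNReal.ofReal p) (volume.restrict U) ≤
        eLpNorm q (ENNReal.ofReal p) (volume.restrict U) + ENNReal.ofReal δ := by
      rw [h3]
      refine (eLpNorm_add_le hqL.1 ((huL.sub hvL).1.const_smul (1 / 2 : ℝ))
        (by simpa using hp.le)).trans (add_le_add le_rfl ?_)
      have h5 := eLpNorm_const_smul (1 / 2 : ℝ) (u - v) (ENNReal.ofReal p) (volume.restrict U)
      refine h5.le.trans ((mul_le_mul_right hδ _).trans (le_of_eq ?_))
      rw [Real.enorm_eq_ofReal (by norm_num), ← ENNReal.ofReal_mul (by norm_num)]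
      congr 1; ring
    have h6 := ENNReal.toReal_mono (ENNReal.add_ne_top.2 ⟨hqL.2.ne, ENNReal.ofReal_ne_top⟩) h4
    rw [ENNReal.toReal_add hqL.2.ne ENNReal.ofReal_ne_top, ENNReal.toReal_ofReal hδ0] at h6
    rw [integral_abs_rpow_eq hp hqL]
    exact Real.rpow_le_rpow (by linarith) (by linarith) hp0.le
  calc 2 * (lam U d s p).toReal * (1 - δ) ^ p
      ≤ 2 * (lam U d s p).toReal * ∫ x in U, |q x| ^ p := by gcongr
    _ ≤ _ := hc
    _ = _ := by
      refine integral_congr_ae (Eventually.of_forall fun z => ?_)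
      simp only [pairDiff]; congr 2; ring

/-- Along a sequence converging in `L ^ p(U)` whose differences converge for `pairMeasure`, the
functions themselves have a limit almost everywhere in `ℝⁿ`, outside `U` too: fix one generic
`x ∈ U`. -/
lemma exists_ae_limit (hn : 1 ≤ n) (hU : IsSmoothBoundedDomain U) (hd : IsEquivDistance d)
    (hp : 1 < p) {v : ℕ → EuclideanSpace ℝ (Fin n) → ℝ} (hv : ∀ k, v k ∈ spaceW U d s p)
    {w : EuclideanSpace ℝ (Fin n) → ℝ} (hw : MemLp w (ENNReal.ofReal p) (volume.restrict U))
    (hvw : Tendsto (fun k => eLpNorm (v k - w) (ENNReal.ofReal p) (volume.restrict U))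
      atTop (𝓝 0)) {G : EuclideanSpace ℝ (Fin n) × EuclideanSpace ℝ (Fin n) → ℝ}
    (hG : MemLp G (ENNReal.ofReal p) (pairMeasure U d s p))
    (hvG : Tendsto (fun k => eLpNorm (pairDiff (v k) - G) (ENNReal.ofReal p)
      (pairMeasure U d s p)) atTop (𝓝 0)) :
    ∃ u ∈ spaceW U d s p, u =ᵐ[volume.restrict U] w ∧
      pairDiff u =ᵐ[pairMeasure U d s p] G := by
  have hW := fun k => (mem_spaceW_iff hd hp).1 (hv k)
  obtain ⟨ψ, hψ, hψG⟩ := (tendstoInMeasure_of_tendsto_eLpNorm (ofReal_ne_zero_of_one_lt hp)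
    (fun k => (hW k).2.2.1) hG.1 hvG).exists_seq_tendsto_ae
  obtain ⟨θ, hθ, hθw⟩ := (tendstoInMeasure_of_tendsto_eLpNorm (ofReal_ne_zero_of_one_lt hp)
    (fun k => (hW (ψ k)).2.1.1) hw.1 (hvw.comp hψ.tendsto_atTop)).exists_seq_tendsto_ae
  set f : ℕ → EuclideanSpace ℝ (Fin n) → ℝ := fun j => v (ψ (θ j)) with hf
  have hfG : ∀ᵐ z ∂pairMeasure U d s p, Tendsto (fun j => pairDiff (f j) z) atTop (𝓝 (G z)) :=
    hψG.mono fun z hz => hz.comp hθ.tendsto_atTop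
  have : (ae (volume.restrict U)).NeBot := by
    rw [ae_neBot, ne_eq, Measure.restrict_eq_zero]; exact hU.volume_ne_zero
  obtain ⟨x, hx1, hx2⟩ :=
    ((ae_ae_of_ae_pairMeasure hn hd hU.isOpen.measurableSet hfG).and hθw).exists
  -- `f j y = f j x - (f j x - f j y)`, and both terms converge
  set u : EuclideanSpace ℝ (Fin n) → ℝ := fun y => w x - G (x, y) with hu
  have hfu : ∀ᵐ y, Tendsto (fun j => f j y) atTop (𝓝 (u y)) := by
    filter_upwards [hx1] with y hy
    have := hx2.sub hy
    simpa [pairDiff, hf, hu] using this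
  have hum : AEMeasurable u volume :=
    aemeasurable_of_tendsto_metrizable_ae atTop (fun j => (hv (ψ (θ j))).1) hfu
  have huw : u =ᵐ[volume.restrict U] w := by
    filter_upwards [ae_restrict_of_ae hfu, hθw] with y h1 h2
    exact tendsto_nhds_unique h1 h2
  have huG : pairDiff u =ᵐ[pairMeasure U d s p] G := by
    filter_upwards [hfG, ae_pairMeasure_of_ae hfu] with z h1 h2
    exact tendsto_nhds_unique (h2.1.sub h2.2) h1
  exact ⟨u, (mem_spaceW_iff hd hp).2 ⟨hum, (memLp_congr_ae huw).2 hw, (memLp_congr_ae huG).2 hG⟩,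
    huw, huG⟩

/-- The infimum is attained by a normalized competitor. -/
lemma exists_minimizer (hn : 1 ≤ n) (hU : IsSmoothBoundedDomain U) (hd : IsEquivDistance d)
    (hs : 0 < s) (hs1 : s < 1) (hp : 1 < p) :
    ∃ u ∈ spaceW U d s p, ∫ x in U, |u x| ^ p = 1 ∧ ∫ x in U, |u x| ^ (p - 2) * u x = 0 ∧
      ∫ z, |pairDiff u z| ^ p ∂pairMeasure U d s p = 2 * (lam U d s p).toReal := by
  have hp0 : 0 < p := by linarith
  have : IsFiniteMeasure (volume.restrict U) := isFiniteMeasure_restrict.2 hU.volume_ne_top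
  have hlt := lam_ne_top hn hU hd hs hs1 hp
  set l := (lam U d s p).toReal with hl
  have hl0 : 0 ≤ l := ENNReal.toReal_nonneg
  have hseq : ∀ k : ℕ, ∃ v ∈ spaceW U d s p, ∫ x in U, |v x| ^ p = 1 ∧
      ∫ x in U, |v x| ^ (p - 2) * v x = 0 ∧
      ∫ z, |pairDiff v z| ^ p ∂pairMeasure U d s p ≤ 2 * (l + 1 / (k + 1 : ℝ)) := by
    intro k
    have hk : (0 : ℝ) < 1 / (k + 1 : ℝ) := by positivity
    have h1 : lam U d s p < ENNReal.ofReal (l + 1 / (k + 1 : ℝ)) := by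
      rw [ENNReal.lt_ofReal_iff_toReal_lt hlt]; linarith
    simp only [lam, iInf_lt_iff] at h1
    obtain ⟨v, hv, hvq⟩ := h1
    obtain ⟨v', h1, h2, h3, h4⟩ := exists_normalized hn hU hd hp hv
      (hvq.trans ENNReal.ofReal_lt_top).ne
    refine ⟨v', h1, h2, h3, ?_⟩
    rw [h4]
    have := ENNReal.toReal_le_of_le_ofReal (by positivity) hvq.le
    linarith
  choose v hvW hv1 hv0 hvE using hseq
  obtain ⟨φ, hφ, w, hw, hvw⟩ := exists_subseq_tendsto_eLpNorm hU hd hp hs hvW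
    (M := 1 + 2 * (l + 1)) (fun k => by rw [hv1]; linarith) (fun k => by
      rw [energy_eq_ofReal hd hp (hvW k)]
      refine ENNReal.ofReal_le_ofReal ((hvE k).trans ?_)
      have : 1 / (k + 1 : ℝ) ≤ 1 := by
        rw [div_le_one (by positivity)]; linarith [(Nat.cast_nonneg k : (0 : ℝ) ≤ k)]
      linarith)
  have hWk := fun k => (mem_spaceW_iff hd hp).1 (hvW (φ k))
  have hlow : ∀ k, 2 * l ≤ ∫ z, |pairDiff (v k) z| ^ p ∂pairMeasure U d s p := fun k => by
    have := two_mul_lam_mul_le hn hU hd hs hs1 hp (hvW k) (hv0 k)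
    rwa [hv1, mul_one] at this
  have hlimE : Tendsto (fun k => ∫ z, |pairDiff (v (φ k)) z| ^ p ∂pairMeasure U d s p) atTop
      (𝓝 (2 * l)) := by
    have h1 : Tendsto (fun k : ℕ => 2 * (l + 1 / (k + 1 : ℝ))) atTop (𝓝 (2 * l)) := by
      have := (tendsto_one_div_add_atTop_nhds_zero_nat (𝕜 := ℝ)).const_add l |>.const_mul 2
      simpa using this
    exact tendsto_of_tendsto_of_tendsto_of_le_of_le tendsto_const_nhds
      (h1.comp hφ.tendsto_atTop) (fun k => hlow (φ k)) (fun k => hvE (φ k))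
  obtain ⟨G, hG, hvG⟩ := exists_tendsto_of_midpoints hp (fun k => (hWk k).2.2) hlimE (by
    intro ε hε
    obtain ⟨δ, hδ0, hδ1, hδ⟩ : ∃ δ > 0, δ ≤ 1 ∧ 2 * l - ε ≤ 2 * l * (1 - δ) ^ p := by
      have h1 : Continuous fun δ : ℝ => 2 * l * (1 - δ) ^ p :=
        continuous_const.mul ((continuous_const.sub continuous_id).rpow_const
          fun _ => Or.inr hp0.le)
      have h2 := h1.tendsto 0
      simp only [sub_zero, Real.one_rpow, mul_one] at h2
      have h3 := (h2.mono_left (nhdsWithin_le_nhds (s := Set.Ioi 0))).eventually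
        (lt_mem_nhds (show 2 * l - ε < 2 * l by linarith))
      obtain ⟨δ, ha, hb⟩ := (h3.and (Ioc_mem_nhdsGT one_pos)).exists
      exact ⟨δ, hb.1, hb.2, ha.le⟩
    have hev := hvw.eventually (gt_mem_nhds (ENNReal.ofReal_pos.2 hδ0))
    obtain ⟨N, hN⟩ := eventually_atTop.1 hev
    refine ⟨N, fun k hk j hj => hδ.trans ?_⟩
    refine two_mul_lam_mul_rpow_le_midpoint hn hU hd hs hs1 hp (hvW _) (hvW _) (hv1 _) (hv0 _)
      hδ0.le hδ1 ?_
    have h1 : v (φ k) - v (φ j) = (v (φ k) - w) - (v (φ j) - w) := by abel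
    rw [h1]
    refine (eLpNorm_sub_le ((hWk k).2.1.sub hw).1 ((hWk j).2.1.sub hw).1
      (by simpa using hp.le)).trans ((add_le_add (hN k hk).le (hN j hj).le).trans ?_)
    rw [← ENNReal.ofReal_add hδ0.le hδ0.le, two_mul])
  obtain ⟨u, huW, huw, huG⟩ := exists_ae_limit hn hU hd hp (fun k => hvW (φ k)) hw hvw hG hvG
  have hE : ∫ z, |pairDiff u z| ^ p ∂pairMeasure U d s p = 2 * l := by
    rw [integral_congr_ae (g := fun z => |G z| ^ p) (huG.mono fun z hz => by simp only [hz])]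
    exact tendsto_nhds_unique (tendsto_integral_abs_rpow hp (fun k => (hWk k).2.2) hG hvG) hlimE
  -- the constraint passes to the limit in its variational form `‖v‖ ≤ ‖v - c‖`
  have hlimc : ∀ c : ℝ, Tendsto (fun k => ∫ x in U, |v (φ k) x - c| ^ p) atTop
      (𝓝 (∫ x in U, |u x - c| ^ p)) := by
    intro c
    rw [integral_congr_ae (g := fun z => |w z - c| ^ p) (huw.mono fun z hz => by simp only [hz])]
    refine tendsto_integral_abs_rpow hp (G := fun x => w x - c)
      (fun k => (hWk k).2.1.sub (memLp_const c)) (hw.sub (memLp_const c)) ?_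
    refine hvw.congr fun k => ?_
    congr 1; ext x; simp
  have hN : ∫ x in U, |u x| ^ p = 1 := by
    have h1 := hlimc 0
    simp only [sub_zero, hv1] at h1
    exact tendsto_nhds_unique h1 tendsto_const_nhds
  refine ⟨u, huW, hN, ?_, hE⟩
  rw [integral_eq_zero_iff_forall_le hp ((mem_spaceW_iff hd hp).1 huW).2.1]
  intro c
  rw [hN]
  refine ge_of_tendsto' (hlimc c) fun k => ?_
  have := (integral_eq_zero_iff_forall_le hp (hWk k).2.1).1 (hv0 (φ k)) c
  rwa [hv1] at this

end Rayleigh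

/-! ### The first nonzero eigenvalue -/

section Eigenvalue

variable {n : ℕ} {U : Set (EuclideanSpace ℝ (Fin n))}
  {d : EuclideanSpace ℝ (Fin n) → EuclideanSpace ℝ (Fin n) → ℝ} {s p : ℝ}
  {u v : EuclideanSpace ℝ (Fin n) → ℝ}

/-- The Euler–Lagrange equation. For the competitor `u + t v`, whose best constant is `c`, convexity
gives `‖u + t v - c‖ₚᵖ ≥ ‖u‖ₚᵖ + p t ∫ |u|^{p-2} u v`, where the term in `c` vanishes because of
the constraint on `u`. So the energy has a supporting line at `t = 0`. -/
lemma form_eq_of_minimizer (hn : 1 ≤ n) (hU : IsSmoothBoundedDomain U) (hd : IsEquivDistance d)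
    (hs : 0 < s) (hs1 : s < 1) (hp : 1 < p) (hu : u ∈ spaceW U d s p)
    (hu0 : ∫ x in U, |u x| ^ (p - 2) * u x = 0)
    (hE : ∫ z, |pairDiff u z| ^ p ∂pairMeasure U d s p =
      2 * (lam U d s p).toReal * ∫ x in U, |u x| ^ p) (hv : v ∈ spaceW U d s p) :
    1 / 2 * form U d s p u v = (lam U d s p).toReal * ∫ x in U, |u x| ^ (p - 2) * u x * v x := by
  have : IsFiniteMeasure (volume.restrict U) := isFiniteMeasure_restrict.2 hU.volume_ne_top
  obtain ⟨-, huL, huD⟩ := (mem_spaceW_iff hd hp).1 hu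
  obtain ⟨-, hvL, hvD⟩ := (mem_spaceW_iff hd hp).1 hv
  set l := (lam U d s p).toReal with hl
  have hl0 : 0 ≤ l := ENNReal.toReal_nonneg
  set I := ∫ x in U, |u x| ^ (p - 2) * u x * v x with hI
  have hint1 : Integrable (fun x => |u x| ^ (p - 2) * u x * v x) (volume.restrict U) :=
    (hasDerivAt_integral_abs_rpow hp huL hvL).1
  have hint2 : Integrable (fun x => |u x| ^ (p - 2) * u x) (volume.restrict U) := by
    simpa using (hasDerivAt_integral_abs_rpow hp huL (memLp_const (1 : ℝ))).1
  have hder := (hasDerivAt_integral_abs_rpow hp huD hvD).2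
  rw [← form_eq_integral hd] at hder
  have hkey : ∀ t : ℝ, 2 * l * (∫ x in U, |u x| ^ p) + 2 * l * (p * (t * I)) ≤
      ∫ z, |pairDiff u z + t * pairDiff v z| ^ p ∂pairMeasure U d s p := by
    intro t
    obtain ⟨c, hc⟩ := exists_const_two_mul_lam_mul_le hn hU hd hs hs1 hp
      (add_smul_mem_spaceW hd hp hu hv t)
    have h1 := integral_abs_rpow_add_ge (g := fun x => t * v x - c) hp huL
      ((hvL.const_mul t).sub (memLp_const c))
    have h2 : ∫ x in U, |u x| ^ (p - 2) * u x * (t * v x - c) = t * I := by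
      have h3 : ∀ x, |u x| ^ (p - 2) * u x * (t * v x - c) =
          t * (|u x| ^ (p - 2) * u x * v x) - c * (|u x| ^ (p - 2) * u x) := fun x => by ring
      simp_rw [h3]
      rw [integral_sub (hint1.const_mul t) (hint2.const_mul c), integral_const_mul,
        integral_const_mul, hu0, mul_zero, sub_zero]
    rw [h2] at h1
    have h4 : ∀ x, |u x + (t * v x - c)| ^ p = |u x + t * v x - c| ^ p :=
      fun x => by congr 2; ring
    simp_rw [h4] at h1
    have h5 : ∀ z, |pairDiff (fun x => u x + t * v x) z| ^ p =
        |pairDiff u z + t * pairDiff v z| ^ p := fun z => by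
      simp only [pairDiff]; congr 2; ring
    simp_rw [h5] at hc
    calc _ = 2 * l * ((∫ x in U, |u x| ^ p) + p * (t * I)) := by ring
      _ ≤ 2 * l * ∫ x in U, |u x + t * v x - c| ^ p := by gcongr
      _ ≤ _ := hc
  -- `Ψ` is minimal at `0`, where it is differentiable
  set Ψ : ℝ → ℝ := fun t => ∫ z, |pairDiff u z + t * pairDiff v z| ^ p ∂pairMeasure U d s p -
    t * (2 * l * (p * I)) with hΨ
  have hΨd : HasDerivAt Ψ (p * form U d s p u v - 1 * (2 * l * (p * I))) 0 :=
    hder.sub ((hasDerivAt_id (0 : ℝ)).mul_const _)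
  have hmin : IsLocalMin Ψ 0 := Eventually.of_forall fun t => by
    simp only [hΨ, zero_mul, add_zero, sub_zero]
    rw [hE]
    have := hkey t
    linarith
  have h0 := hmin.hasDerivAt_eq_zero hΨd
  have hp0 : p ≠ 0 := by linarith
  have h6 : p * (form U d s p u v - 2 * l * I) = 0 := by linarith
  rcases mul_eq_zero.1 h6 with h | h
  · exact absurd h hp0
  · linarith

lemma form_self (hd : IsEquivDistance d) (hp : 1 < p) :
    form U d s p u u = ∫ z, |pairDiff u z| ^ p ∂pairMeasure U d s p := by
  rw [form_eq_integral hd]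
  exact integral_congr_ae (Eventually.of_forall fun z => abs_rpow_mul_self_mul_self hp _)

/-- A nonzero eigenvalue is the quotient of its eigenfunction, which is admissible: test with `1`
and with the eigenfunction. -/
lemma lam_le_of_isEigenvalue (hn : 1 ≤ n) (hU : IsSmoothBoundedDomain U) (hd : IsEquivDistance d)
    (hs : 0 < s) (hs1 : s < 1) (hp : 1 < p) {μ : ℝ} (hμ : μ ≠ 0) (h : IsEigenvalue U d s p μ) :
    (lam U d s p).toReal ≤ μ := by
  obtain ⟨u, ⟨hu, hweak⟩, hu0⟩ := h
  have h1 := hweak _ (const_mem_spaceW hd hp hU.volume_ne_top 1)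
  have hc : ∫ x in U, |u x| ^ (p - 2) * u x = 0 := by
    simpa [form, hμ] using h1
  have h2 := hweak u hu
  rw [form_self hd hp] at h2
  simp_rw [abs_rpow_mul_self_mul_self hp] at h2
  have hN : 0 < ∫ x in U, |u x| ^ p := by
    refine lt_of_le_of_ne (integral_abs_rpow_nonneg u) fun h0 => ?_
    rw [← h0, mul_zero] at h2
    have hE : energy U d s p u = 0 := by
      rw [energy_eq_ofReal hd hp hu, ENNReal.ofReal_eq_zero]; linarith
    exact (integral_pos_of_admissible hn hU hd hp ⟨hu, hu0, hc⟩ (by simp [quotient, hE])).ne h0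
  have h3 := two_mul_lam_mul_le hn hU hd hs hs1 hp hu hc
  have h4 : (lam U d s p).toReal * ∫ x in U, |u x| ^ p ≤ μ * ∫ x in U, |u x| ^ p := by linarith
  exact le_of_mul_le_mul_right h4 hN

lemma isLeast_lam (hn : 1 ≤ n) (hU : IsSmoothBoundedDomain U) (hd : IsEquivDistance d)
    (hs : 0 < s) (hs1 : s < 1) (hp : 1 < p) :
    IsLeast {μ : ℝ | μ ≠ 0 ∧ IsEigenvalue U d s p μ} (lam U d s p).toReal := by
  refine ⟨?_, fun μ hμ => lam_le_of_isEigenvalue hn hU hd hs hs1 hp hμ.1 hμ.2⟩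
  obtain ⟨u, hu, hN, hc, hE⟩ := exists_minimizer hn hU hd hs hs1 hp
  have hu0 : ¬ u =ᵐ[volume] 0 := fun h => by
    rw [integral_eq_zero_of_ae_eq_zero hp h] at hN
    exact zero_ne_one hN
  have hE' : ∫ z, |pairDiff u z| ^ p ∂pairMeasure U d s p =
      2 * (lam U d s p).toReal * ∫ x in U, |u x| ^ p := by rw [hE, hN, mul_one]
  refine ⟨fun h0 => ?_, u, ⟨hu, fun v hv => form_eq_of_minimizer hn hU hd hs hs1 hp hu hc hE' hv⟩,
    hu0⟩
  -- a minimizer of zero energy is constant, and the constraint forces that constant to vanish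
  have hE0 : energy U d s p u = 0 := by rw [energy_eq_ofReal hd hp hu, hE, h0]; simp
  obtain ⟨a, ha⟩ := ae_eq_const_of_energy_eq_zero hn hd hU.isOpen.measurableSet hU.volume_ne_zero
    hp hu hE0
  have h1 : ∫ x in U, |u x| ^ (p - 2) * u x = ∫ _ in U, |a| ^ (p - 2) * a :=
    integral_congr_ae (ae_restrict_of_ae (ha.mono fun x hx => by simp only [hx]))
  have hV : volume.real U ≠ 0 := (ENNReal.toReal_pos hU.volume_ne_zero hU.volume_ne_top).ne'
  rw [hc, setIntegral_const, smul_eq_mul] at h1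
  have h2 : |a| ^ (p - 2) * a = 0 := by
    rcases mul_eq_zero.1 h1.symm with h | h
    · exact absurd h hV
    · exact h
  have h3 : |a| ^ p = 0 := by rw [← abs_rpow_mul_self_mul_self hp, h2, zero_mul]
  rw [Real.rpow_eq_zero (abs_nonneg a) (by linarith), abs_eq_zero] at h3
  exact hu0 (ha.mono fun x hx => by simp [hx, h3])

end Eigenvalue

/-! ### The limit `p → ∞` -/

section Limit

variable {n : ℕ} {U : Set (EuclideanSpace ℝ (Fin n))}
  {d : EuclideanSpace ℝ (Fin n) → EuclideanSpace ℝ (Fin n) → ℝ} {s : ℝ}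

lemma tendsto_const_rpow_one_div {C : ℝ} (hC : 0 < C) :
    Tendsto (fun p : ℝ => C ^ (1 / p)) atTop (𝓝 1) := by
  have h1 : Tendsto (fun p : ℝ => 1 / p) atTop (𝓝 0) := by
    simpa using tendsto_inv_atTop_zero (𝕜 := ℝ)
  have h2 := (Real.continuousAt_const_rpow hC.ne' (b := 0)).tendsto.comp h1
  rw [Real.rpow_zero] at h2
  exact h2

/-- The upper limit of `λ^{1/p}`, by comparison with the cone. -/
lemma eventually_lam_rpow_le (hn : 1 ≤ n) (hU : IsSmoothBoundedDomain U) (hd : IsEquivDistance d)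
    (hs : 0 < s) (hs1 : s < 1) {b : ℝ} (hb : 2 / diamD U d ^ s < b) :
    ∀ᶠ p : ℝ in atTop, (lam U d s p).toReal ^ (1 / p) ≤ b := by
  have hD := diamD_pos hn hU hd
  set B := 2 / diamD U d ^ s with hB
  have hB0 : 0 < B := by positivity
  obtain ⟨ε, hε0, hε1, hε⟩ : ∃ ε : ℝ, 0 < ε ∧ ε < 1 ∧ B / (1 - ε) < b := by
    have h1 : ContinuousAt (fun ε : ℝ => B / (1 - ε)) 0 :=
      continuousAt_const.div (by fun_prop) (by norm_num)
    have h2 : Tendsto (fun ε : ℝ => B / (1 - ε)) (𝓝[>] 0) (𝓝 B) := by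
      have := h1.tendsto
      simp only [sub_zero, div_one] at this
      exact this.mono_left nhdsWithin_le_nhds
    obtain ⟨ε, h3, h4⟩ := ((h2.eventually (gt_mem_nhds hb)).and
      (Ioo_mem_nhdsGT one_pos)).exists
    exact ⟨ε, h4.1, h4.2, h3⟩
  obtain ⟨C₁, hC₁, hle⟩ := exists_lam_le hn hU hd hs hs1 hε0 hε1
  have hB' : 0 < B / (1 - ε) := div_pos hB0 (by linarith)
  have hlim : Tendsto (fun p : ℝ => C₁ ^ (1 / p) * (B / (1 - ε))) atTop (𝓝 (B / (1 - ε))) := by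
    simpa using (tendsto_const_rpow_one_div hC₁).mul_const (B / (1 - ε))
  filter_upwards [hlim.eventually (gt_mem_nhds hε), eventually_gt_atTop 1] with p hp hp1
  refine le_trans ?_ hp.le
  have hp0 : 0 < p := by linarith
  have h1 := ENNReal.toReal_le_of_le_ofReal (by positivity) (hle p hp1)
  calc (lam U d s p).toReal ^ (1 / p) ≤ (C₁ * (B / (1 - ε)) ^ p) ^ (1 / p) :=
        Real.rpow_le_rpow ENNReal.toReal_nonneg h1 (by positivity)
    _ = C₁ ^ (1 / p) * (B / (1 - ε)) := by
        rw [Real.mul_rpow hC₁.le (by positivity), ← Real.rpow_mul hB'.le,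
          mul_one_div_cancel hp0.ne', Real.rpow_one]

/-- Arzelà–Ascoli for uniformly bounded, uniformly Hölder continuous functions. -/
lemma exists_subseq_tendstoUniformlyOn {X : Type*} [PseudoMetricSpace X] {S : Set X}
    (hS : IsCompact S) {g : ℕ → X → ℝ} {B Q α : ℝ} (hα : 0 < α) (hB : ∀ k, ∀ x ∈ S, |g k x| ≤ B)
    (hg : ∀ k x y, |g k x - g k y| ≤ Q * dist x y ^ α) :
    ∃ φ : ℕ → ℕ, StrictMono φ ∧ ∃ f : X → ℝ, TendstoUniformlyOn (fun k => g (φ k)) f atTop S := by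
  have : CompactSpace S := isCompact_iff_compactSpace.1 hS
  set G : ℕ → BoundedContinuousFunction S ℝ := fun k =>
    BoundedContinuousFunction.mkOfCompact
      ⟨fun x => g k x, (continuous_of_holder hα (hg k)).comp continuous_subtype_val⟩ with hG
  have hGx : ∀ k (x : S), G k x = g k x := fun k x => rfl
  have hequi : Equicontinuous ((↑) : Set.range G → S → ℝ) := by
    intro x₀
    rw [Metric.equicontinuousAt_iff_right]
    intro ε hε
    have hc : Continuous fun x : S => Q * dist x₀ x ^ α :=
      continuous_const.mul ((continuous_const.dist continuous_id).rpow_const fun _ => Or.inr hα.le)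
    have h0 := hc.tendsto x₀
    simp only [dist_self, Real.zero_rpow hα.ne', mul_zero] at h0
    filter_upwards [h0.eventually (gt_mem_nhds hε)] with x hx
    rintro ⟨_, k, rfl⟩
    exact (hg k x₀ x).trans_lt hx
  have hcomp : IsCompact (closure (Set.range G)) :=
    BoundedContinuousFunction.arzela_ascoli (Set.Icc (-B) B) isCompact_Icc (Set.range G) (by
      rintro _ x ⟨k, rfl⟩
      exact abs_le.1 (hB k x x.2)) hequi
  obtain ⟨F, -, φ, hφ, hlim⟩ := hcomp.tendsto_subseq (x := G) fun k => subset_closure ⟨k, rfl⟩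
  classical
  refine ⟨φ, hφ, fun x => if h : x ∈ S then F ⟨x, h⟩ else 0, ?_⟩
  rw [BoundedContinuousFunction.tendsto_iff_tendstoUniformly, Metric.tendstoUniformly_iff] at hlim
  rw [Metric.tendstoUniformlyOn_iff]
  intro ε hε
  filter_upwards [hlim ε hε] with k hk x hx
  rw [dif_pos hx]
  exact hk ⟨x, hx⟩

/-- In the limit `p → ∞` the constraint balances the positive and negative parts: a lower bound `-a`
for the limit function, `a ≥ 0`, forces the upper bound `a`. -/
lemma le_of_constraint (hUo : IsOpen U) (hUt : volume U ≠ ⊤)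
    {p : ℕ → ℝ} (hp1 : ∀ k, 1 < p k) (hp : Tendsto p atTop atTop)
    {g : ℕ → EuclideanSpace ℝ (Fin n) → ℝ} {f : EuclideanSpace ℝ (Fin n) → ℝ}
    (hgf : TendstoUniformlyOn g f atTop U) (hf : ContinuousOn f U)
    (hint : ∀ k, Integrable (fun x => |g k x| ^ (p k - 2) * g k x) (volume.restrict U))
    (hc : ∀ k, ∫ x in U, |g k x| ^ (p k - 2) * g k x = 0) {a : ℝ} (ha : 0 ≤ a)
    (hlow : ∀ x ∈ U, -a ≤ f x) : ∀ x ∈ U, f x ≤ a := by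
  intro x hx
  by_contra! hax
  -- for large `k` the functions `g k` lie above `-(a + h)` on `U` and above `a + 2 h` near `x`
  set h := (f x - a) / 4 with hh
  have hh0 : 0 < h := by rw [hh]; linarith
  set V := U ∩ f ⁻¹' Set.Ioi (a + 3 * h) with hV
  have hVo : IsOpen V := hf.isOpen_inter_preimage hUo isOpen_Ioi
  have hVt : volume V ≠ ⊤ := measure_ne_top_of_subset Set.inter_subset_left hUt
  have hVx : x ∈ V := ⟨hx, by simp only [Set.mem_preimage, Set.mem_Ioi]; linarith⟩
  have hm0 : 0 < volume.real V := ENNReal.toReal_pos (hVo.measure_pos _ ⟨x, hVx⟩).ne' hVt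
  have : IsFiniteMeasure (volume.restrict U) := isFiniteMeasure_restrict.2 hUt
  -- the constraint bounds the positive contribution on `V` by the negative one, and the ratio of
  -- the two bounds grows exponentially in `p k`
  have hab : 1 < (a + 2 * h) / (a + h) := (one_lt_div (by linarith)).2 (by linarith)
  have hev : ∀ᶠ k in atTop, ((a + 2 * h) / (a + h)) ^ (p k - 1) ≤
      volume.real U / volume.real V := by
    filter_upwards [Metric.tendstoUniformlyOn_iff.1 hgf h hh0] with k hk
    have hpk := hp1 k
    have hq0 : 0 < p k - 1 := by linarith
    have hb1 : ∀ y ∈ U, 0 ≤ |g k y| ^ (p k - 2) * g k y + (a + h) ^ (p k - 1) := by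
      intro y hy
      have h1 := hk y hy
      rw [Real.dist_eq, abs_lt] at h1
      have h2 := hlow y hy
      have h3 : 0 ≤ (a + h) ^ (p k - 1) := by positivity
      rcases le_total 0 (g k y) with h4 | h4
      · have : 0 ≤ |g k y| ^ (p k - 2) * g k y := by positivity
        linarith
      · have h5 : |g k y| ≤ a + h := by rw [abs_of_nonpos h4]; linarith
        have h6 := Real.rpow_le_rpow (abs_nonneg _) h5 hq0.le
        rw [← abs_abs_rpow_mul_self hpk] at h6
        have h7 := (abs_le.1 h6).1
        linarith
    have hb2 : ∀ y ∈ V, (a + 2 * h) ^ (p k - 1) ≤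
        |g k y| ^ (p k - 2) * g k y + (a + h) ^ (p k - 1) := by
      intro y hy
      have h1 := hk y hy.1
      rw [Real.dist_eq, abs_lt] at h1
      have h2 : a + 3 * h < f y := hy.2
      have h3 : 0 ≤ (a + h) ^ (p k - 1) := by positivity
      have h4 : a + 2 * h ≤ g k y := by linarith
      have h5 : 0 < g k y := by linarith
      have h6 : |g k y| ^ (p k - 2) * g k y = g k y ^ (p k - 1) := by
        have := abs_abs_rpow_mul_self hpk (g k y)
        rw [abs_of_nonneg (by positivity), abs_of_pos h5] at this
        rw [abs_of_pos h5]
        exact this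
      rw [h6]
      have := Real.rpow_le_rpow (by positivity) h4 hq0.le
      linarith
    have hi : IntegrableOn (fun y => |g k y| ^ (p k - 2) * g k y + (a + h) ^ (p k - 1)) U :=
      (hint k).add (integrable_const _)
    have h1 : ∫ y in U, (|g k y| ^ (p k - 2) * g k y + (a + h) ^ (p k - 1)) =
        volume.real U * (a + h) ^ (p k - 1) := by
      rw [integral_add (hint k) (integrable_const _), hc k, zero_add, setIntegral_const,
        smul_eq_mul]
    have h2 : volume.real V * (a + 2 * h) ^ (p k - 1) ≤
        ∫ y in U, (|g k y| ^ (p k - 2) * g k y + (a + h) ^ (p k - 1)) := by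
      calc volume.real V * (a + 2 * h) ^ (p k - 1) = ∫ _ in V, (a + 2 * h) ^ (p k - 1) := by
            rw [setIntegral_const, smul_eq_mul]
        _ ≤ ∫ y in V, (|g k y| ^ (p k - 2) * g k y + (a + h) ^ (p k - 1)) :=
            setIntegral_mono_on (integrableOn_const hVt) (hi.mono_set Set.inter_subset_left)
              hVo.measurableSet hb2
        _ ≤ _ := by
            refine setIntegral_mono_set hi ?_ Set.inter_subset_left.eventuallyLE
            filter_upwards [ae_restrict_mem hUo.measurableSet] with y hy
            exact hb1 y hy
    rw [h1] at h2
    rw [Real.div_rpow (by positivity) (by positivity), div_le_div_iff₀ (by positivity) hm0]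
    linarith
  have htop : Tendsto (fun k => ((a + 2 * h) / (a + h)) ^ (p k - 1)) atTop atTop :=
    (tendsto_rpow_atTop_of_base_gt_one _ hab).comp (tendsto_atTop_add_const_right _ (-1) hp)
  obtain ⟨k, h1, h2⟩ := (hev.and (htop.eventually_gt_atTop
    (volume.real U / volume.real V))).exists
  linarith

/-- The normalization in `L ^ p` survives in the limit as a lower bound for the maximum. -/
lemma exists_lt_abs_of_normalized (hUm : MeasurableSet U) (hUt : volume U ≠ ⊤)
    {p : ℕ → ℝ} (hp : Tendsto p atTop atTop)
    {g : ℕ → EuclideanSpace ℝ (Fin n) → ℝ} {f : EuclideanSpace ℝ (Fin n) → ℝ}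
    (hgf : TendstoUniformlyOn g f atTop U)
    (hint : ∀ k, Integrable (fun x => |g k x| ^ p k) (volume.restrict U))
    (hN : ∀ k, ∫ x in U, |g k x| ^ p k = 1) {a : ℝ} (ha0 : 0 ≤ a) (ha : a < 1) :
    ∃ x ∈ U, a < |f x| := by
  by_contra! hle
  have : IsFiniteMeasure (volume.restrict U) := isFiniteMeasure_restrict.2 hUt
  have hev : ∀ᶠ k in atTop, 1 ≤ volume.real U * ((a + 1) / 2) ^ p k := by
    filter_upwards [Metric.tendstoUniformlyOn_iff.1 hgf ((1 - a) / 2) (by linarith),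
      hp.eventually_gt_atTop 0] with k hk hpk
    calc (1 : ℝ) = ∫ x in U, |g k x| ^ p k := (hN k).symm
      _ ≤ ∫ _ in U, ((a + 1) / 2) ^ p k := by
          refine setIntegral_mono_on (hint k) (integrable_const _) hUm fun x hx => ?_
          refine Real.rpow_le_rpow (abs_nonneg _) ?_ hpk.le
          have h1 := hk x hx
          rw [dist_comm, Real.dist_eq] at h1
          have h2 := abs_sub_abs_le_abs_sub (g k x) (f x)
          linarith [hle x hx]
      _ = _ := by rw [setIntegral_const, smul_eq_mul]
  have h0 : Tendsto (fun k => volume.real U * ((a + 1) / 2) ^ p k) atTop (𝓝 0) := by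
    have h1 := (tendsto_rpow_atTop_of_base_lt_one ((a + 1) / 2) (by linarith) (by linarith)).comp hp
    simpa using h1.const_mul (volume.real U)
  exact absurd (ge_of_tendsto h0 hev) (by norm_num)

/-- The mean value of a Hölder continuous function over a small ball is close to the value at the
centre. -/
lemma abs_setAverage_ball_sub_le {g : EuclideanSpace ℝ (Fin n) → ℝ} {Q α r : ℝ} (hQ : 0 ≤ Q)
    (hα : 0 < α) (hg : ∀ x y, |g x - g y| ≤ Q * dist x y ^ α) (x : EuclideanSpace ℝ (Fin n))
    (hr : 0 < r) : |(⨍ y in Metric.ball x r, g y) - g x| ≤ Q * r ^ α := by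
  have hcont := continuous_of_holder hα hg
  have hbd : ∀ y ∈ Metric.ball x r, g y ∈ Metric.closedBall (g x) (Q * r ^ α) := by
    intro y hy
    rw [Metric.mem_closedBall, Real.dist_eq]
    refine (hg y x).trans ?_
    have := (Metric.mem_ball.1 hy).le
    gcongr
  have hfin : volume (Metric.ball x r) ≠ ⊤ := measure_ball_lt_top.ne
  have := Convex.set_average_mem (convex_closedBall (g x) (Q * r ^ α)) Metric.isClosed_closedBall
    (Metric.measure_ball_pos volume x hr).ne' hfin
    ((ae_restrict_mem measurableSet_ball).mono hbd)
    ((hcont.continuousOn.integrableOn_compact (isCompact_closedBall x r)).mono_set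
      Metric.ball_subset_closedBall)
  rwa [Metric.mem_closedBall, Real.dist_eq] at this

/-- The Hölder estimate for the limit, with exponent `s` and the limit of `λ^{1/p}` as constant: the
energy controls the difference of the mean values over two small balls. -/
lemma abs_sub_le_of_tendsto (hU : IsSmoothBoundedDomain U) (hd : IsEquivDistance d)
    (hs : 0 < s) {p : ℕ → ℝ} (hp1 : ∀ k, 1 < p k) (hp : Tendsto p atTop atTop)
    {u g : ℕ → EuclideanSpace ℝ (Fin n) → ℝ} {f : EuclideanSpace ℝ (Fin n) → ℝ}
    (hu : ∀ k, u k ∈ spaceW U d s (p k)) (hgu : ∀ k, g k =ᵐ[volume.restrict U] u k)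
    {Q α : ℝ} (hQ : 0 ≤ Q) (hα : 0 < α) (hg : ∀ k x y, |g k x - g k y| ≤ Q * dist x y ^ α)
    {L : ℝ} (hL : Tendsto (fun k => ((energy U d s (p k) (u k)).toReal) ^ (1 / p k)) atTop (𝓝 L))
    (hgf : ∀ x ∈ U, Tendsto (fun k => g k x) atTop (𝓝 (f x))) {x y : EuclideanSpace ℝ (Fin n)}
    (hx : x ∈ U) (hy : y ∈ U) : |f x - f y| ≤ L * d x y ^ s := by
  obtain ⟨_, C, _, hC, hequiv⟩ := hd.equiv
  have hdxy := hd.nonneg x y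
  -- first `k → ∞` with fixed balls of radius `r`, which removes the volume factors, then `r → 0`
  have hkey : ∀ r > 0, Metric.ball x r ⊆ U → Metric.ball y r ⊆ U →
      |f x - f y| ≤ 2 * (Q * r ^ α) + L * (d x y + 2 * C * r) ^ s := by
    intro r hr hxr hyr
    set m := min (volume.real (Metric.ball x r)) (volume.real (Metric.ball y r)) with hm
    have hfx : volume (Metric.ball x r) ≠ ⊤ := measure_ball_lt_top.ne
    have hfy : volume (Metric.ball y r) ≠ ⊤ := measure_ball_lt_top.ne
    have hm0 : 0 < m := lt_min
      (ENNReal.toReal_pos (Metric.measure_ball_pos _ _ hr).ne' hfx)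
      (ENNReal.toReal_pos (Metric.measure_ball_pos _ _ hr).ne' hfy)
    set R := d x y + 2 * C * r with hR
    have hR0 : 0 < R := by positivity
    have hdR : ∀ x' ∈ Metric.ball x r, ∀ y' ∈ Metric.ball y r, d x' y' ≤ R := by
      intro x' hx' y' hy'
      have h1 := hd.triangle x' x y'
      have h2 := hd.triangle x y y'
      have h3 : d x' x ≤ C * r := (hequiv x' x).2.trans (by
        have := (Metric.mem_ball.1 hx').le; gcongr)
      have h4 : d y y' ≤ C * r := (hequiv y y').2.trans (by
        have := (Metric.mem_ball'.1 hy').le; gcongr)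
      rw [hR]; linarith
    have hstep : ∀ k, |g k x - g k y| ≤ 2 * (Q * r ^ α) +
        (m⁻¹ * m⁻¹ * R ^ n) ^ (1 / p k) * R ^ s *
          (energy U d s (p k) (u k)).toReal ^ (1 / p k) := by
      intro k
      have hpk := hp1 k
      have hp0 : 0 < p k := by linarith
      have h1 := abs_setAverage_ball_sub_le hQ hα (hg k) x hr
      have h2 := abs_setAverage_ball_sub_le hQ hα (hg k) y hr
      have h3 := abs_setAverage_sub_setAverage_le hd hpk hs (hu k) hxr hyr measurableSet_ball
        measurableSet_ball hfx hfy hm0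
        (ENNReal.ofReal_le_of_le_toReal (min_le_left _ _))
        (ENNReal.ofReal_le_of_le_toReal (min_le_right _ _)) hR0.le hdR
      have e1 : (⨍ z in Metric.ball x r, u k z) = ⨍ z in Metric.ball x r, g k z :=
        average_congr (ae_restrict_of_ae_restrict_of_subset hxr (hgu k).symm)
      have e2 : (⨍ z in Metric.ball y r, u k z) = ⨍ z in Metric.ball y r, g k z :=
        average_congr (ae_restrict_of_ae_restrict_of_subset hyr (hgu k).symm)
      rw [e1, e2] at h3
      set H := (energy U d s (p k) (u k)).toReal with hH
      have hH0 : 0 ≤ H := ENNReal.toReal_nonneg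
      have h4 : |(⨍ z in Metric.ball x r, g k z) - ⨍ z in Metric.ball y r, g k z| ≤
          (m⁻¹ * m⁻¹ * R ^ n) ^ (1 / p k) * R ^ s * H ^ (1 / p k) := by
        rw [← Real.rpow_le_rpow_iff (abs_nonneg _) (by positivity) hp0]
        refine h3.trans (le_of_eq ?_)
        rw [Real.mul_rpow (y := H ^ (1 / p k)) (by positivity) (by positivity),
          Real.mul_rpow (y := R ^ s) (by positivity) (by positivity), ← Real.rpow_mul hH0,
          ← Real.rpow_mul (by positivity), ← Real.rpow_mul hR0.le, one_div_mul_cancel hp0.ne',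
          Real.rpow_one, Real.rpow_one, Real.rpow_add hR0, Real.rpow_natCast, mul_comm s]
        ring
      rw [abs_le] at h1 h2 h4 ⊢
      constructor <;> linarith
    have hlim : Tendsto (fun k => 2 * (Q * r ^ α) + (m⁻¹ * m⁻¹ * R ^ n) ^ (1 / p k) * R ^ s *
        (energy U d s (p k) (u k)).toReal ^ (1 / p k)) atTop
        (𝓝 (2 * (Q * r ^ α) + 1 * R ^ s * L)) :=
      ((((tendsto_const_rpow_one_div (C := m⁻¹ * m⁻¹ * R ^ n) (by positivity)).comp hp).mul_const
        (R ^ s)).mul hL).const_add _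
    have := le_of_tendsto_of_tendsto' ((hgf x hx).sub (hgf y hy)).abs hlim hstep
    linarith
  have hlim : Tendsto (fun r : ℝ => 2 * (Q * r ^ α) + L * (d x y + 2 * C * r) ^ s) (𝓝[>] 0)
      (𝓝 (L * d x y ^ s)) := by
    have hc : Continuous fun r : ℝ => 2 * (Q * r ^ α) + L * (d x y + 2 * C * r) ^ s := by
      have h1 : Continuous fun r : ℝ => r ^ α := continuous_id.rpow_const fun _ => Or.inr hα.le
      have h2 : Continuous fun r : ℝ => (d x y + 2 * C * r) ^ s :=
        (by fun_prop : Continuous fun r : ℝ => d x y + 2 * C * r).rpow_const fun _ => Or.inr hs.le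
      fun_prop
    have := hc.tendsto 0
    simp only [Real.zero_rpow hα.ne', mul_zero, add_zero, zero_add] at this
    exact this.mono_left nhdsWithin_le_nhds
  obtain ⟨r₁, hr₁, hx₁⟩ := Metric.isOpen_iff.1 hU.isOpen x hx
  obtain ⟨r₂, hr₂, hy₂⟩ := Metric.isOpen_iff.1 hU.isOpen y hy
  refine ge_of_tendsto hlim ?_
  filter_upwards [Ioo_mem_nhdsGT (lt_min hr₁ hr₂)] with r hr
  exact hkey r hr.1 ((Metric.ball_subset_ball (hr.2.le.trans (min_le_left _ _))).trans hx₁)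
    ((Metric.ball_subset_ball (hr.2.le.trans (min_le_right _ _))).trans hy₂)

/-- Uniformly Hölder continuous functions normalized in `L ^ p(U)` are uniformly bounded. -/
lemma exists_bound_of_normalized (hU : IsSmoothBoundedDomain U) {Q α : ℝ} (hQ : 0 ≤ Q)
    (hα : 0 < α) : ∃ B : ℝ, ∀ p : ℝ, 1 < p → ∀ g : EuclideanSpace ℝ (Fin n) → ℝ,
      (∀ x y, |g x - g y| ≤ Q * dist x y ^ α) →
      Integrable (fun x => |g x| ^ p) (volume.restrict U) → ∫ x in U, |g x| ^ p = 1 →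
      ∀ x ∈ closure U, |g x| ≤ B := by
  obtain ⟨D, hD⟩ := Metric.isBounded_iff.1 hU.isCompact_closure.isBounded
  have hV : 0 < volume.real U := ENNReal.toReal_pos hU.volume_ne_zero hU.volume_ne_top
  have : IsFiniteMeasure (volume.restrict U) := isFiniteMeasure_restrict.2 hU.volume_ne_top
  -- if `|g| > b` on `U`, then `∫ |g| ^ p ≥ |U| b ^ p ≥ |U| b = |U| + 1 > 1`
  set b := 1 + (volume.real U)⁻¹ with hb
  have hb1 : 1 ≤ b := by rw [hb]; linarith [inv_pos.2 hV]
  refine ⟨b + Q * D ^ α, fun p hp g hg hint hN => ?_⟩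
  have hp0 : 0 < p := by linarith
  obtain ⟨y, hy, hyb⟩ : ∃ y ∈ U, |g y| ≤ b := by
    by_contra! h
    have h1 : volume.real U * b ^ p ≤ 1 := by
      calc volume.real U * b ^ p = ∫ _ in U, b ^ p := by rw [setIntegral_const, smul_eq_mul]
        _ ≤ ∫ x in U, |g x| ^ p := by
            refine setIntegral_mono_on (integrable_const _) hint hU.isOpen.measurableSet
              fun x hx => ?_
            exact Real.rpow_le_rpow (by linarith) (h x hx).le hp0.le
        _ = 1 := hN
    have h2 : b ≤ b ^ p := by
      conv_lhs => rw [← Real.rpow_one b]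
      exact Real.rpow_le_rpow_of_exponent_le hb1 hp.le
    have h3 : volume.real U * b = volume.real U + 1 := by
      rw [hb, mul_add, mul_one, mul_inv_cancel₀ hV.ne']
    nlinarith
  intro x hx
  have h1 := hg x y
  have h2 : Q * dist x y ^ α ≤ Q * D ^ α := by
    have := hD hx (subset_closure hy)
    gcongr
  have h3 := abs_sub_abs_le_abs_sub (g x) (g y)
  linarith

/-- Subsequential convergence of normalized minimizers to a balanced function with the optimal
Hölder constant, together with the convergence of `λ^{1/p}` along the subsequence. -/
lemma exists_subseq_limit (hn : 1 ≤ n) (hU : IsSmoothBoundedDomain U) (hd : IsEquivDistance d)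
    (hs : 0 < s) (hs1 : s < 1) {p : ℕ → ℝ} (hp1 : ∀ k, 1 < p k) (hp : Tendsto p atTop atTop)
    {u : ℕ → EuclideanSpace ℝ (Fin n) → ℝ} (hu : ∀ k, u k ∈ spaceW U d s (p k))
    (hN : ∀ k, ∫ x in U, |u k x| ^ p k = 1)
    (hc : ∀ k, ∫ x in U, |u k x| ^ (p k - 2) * u k x = 0)
    (hE : ∀ k, (energy U d s (p k) (u k)).toReal = 2 * (lam U d s (p k)).toReal) :
    ∃ (φ : ℕ → ℕ) (g : ℕ → EuclideanSpace ℝ (Fin n) → ℝ) (f : EuclideanSpace ℝ (Fin n) → ℝ),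
      StrictMono φ ∧ (∀ k, Continuous (g k) ∧ g k =ᵐ[volume.restrict U] u (φ k)) ∧
      TendstoUniformlyOn g f atTop (closure U) ∧
      (∀ x y, |f x - f y| ≤ 2 / diamD U d ^ s * d x y ^ s) ∧
      IsLUB (f '' U) 1 ∧ IsGLB (f '' U) (-1) ∧
      Tendsto (fun k => (lam U d s (p (φ k))).toReal ^ (1 / p (φ k))) atTop
        (𝓝 (2 / diamD U d ^ s)) := by
  have hD := diamD_pos hn hU hd
  have hUm := hU.isOpen.measurableSet
  have hUt := hU.volume_ne_top
  set b := 2 / diamD U d ^ s with hb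
  have hb0 : 0 < b := by positivity
  -- a subsequence along which `λ^{1/p}` converges and the Morrey estimate applies
  have hgood : ∀ᶠ k in atTop, (lam U d s (p k)).toReal ^ (1 / p k) ≤ b + 1 ∧
      2 * (n : ℝ) ≤ p k * s := by
    refine (hp.eventually (eventually_lam_rpow_le hn hU hd hs hs1 (by linarith))).and ?_
    filter_upwards [hp.eventually_ge_atTop (2 * n / s)] with k hk
    rwa [div_le_iff₀ hs] at hk
  obtain ⟨N, hN0⟩ := eventually_atTop.1 hgood
  obtain ⟨L, -, φ₁, hφ₁, hL⟩ := (isCompact_Icc (a := (0 : ℝ)) (b := b + 1)).tendsto_subseq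
    (x := fun k => (lam U d s (p (k + N))).toReal ^ (1 / p (k + N)))
    fun k => ⟨Real.rpow_nonneg ENNReal.toReal_nonneg _, (hN0 _ (Nat.le_add_left _ _)).1⟩
  have hφN : StrictMono fun k => φ₁ k + N := hφ₁.add_const N
  have hLb : L ≤ b := by
    refine le_of_forall_gt_imp_ge_of_dense fun b' hb' => ?_
    exact le_of_tendsto hL ((hp.comp hφN.tendsto_atTop).eventually
      (eventually_lam_rpow_le hn hU hd hs hs1 hb'))
  -- Hölder representatives
  obtain ⟨K, hK, hrep⟩ := exists_holder_representative hU hd hs hs1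
  have hrep' : ∀ k, ∃ g : EuclideanSpace ℝ (Fin n) → ℝ,
      g =ᵐ[volume.restrict U] u (φ₁ k + N) ∧
      ∀ x y, |g x - g y| ≤ K * (2 * (b + 1)) * dist x y ^ (s / 2) := by
    intro k
    have hpk := hp1 (φ₁ k + N)
    obtain ⟨h1, h2⟩ := hN0 (φ₁ k + N) (Nat.le_add_left _ _)
    obtain ⟨g, hg1, hg2⟩ := hrep _ hpk h2 _ (hu (φ₁ k + N))
    refine ⟨g, hg1, fun x y => (hg2 x y).trans ?_⟩
    have h3 : (energy U d s (p (φ₁ k + N)) (u (φ₁ k + N))).toReal ^ (1 / p (φ₁ k + N)) ≤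
        2 * (b + 1) := by
      rw [hE, Real.mul_rpow (by norm_num) ENNReal.toReal_nonneg]
      refine mul_le_mul ?_ h1 (Real.rpow_nonneg ENNReal.toReal_nonneg _) (by norm_num)
      conv_rhs => rw [← Real.rpow_one 2]
      refine Real.rpow_le_rpow_of_exponent_le (by norm_num) ?_
      rw [div_le_one (by linarith)]; exact hpk.le
    gcongr
  choose g₁ hg₁u hg₁ using hrep'
  set Q := K * (2 * (b + 1)) with hQ
  have hQ0 : 0 ≤ Q := by positivity
  have hα : 0 < s / 2 := by positivity
  have hpow : ∀ k, ∀ᵐ x ∂volume.restrict U, |g₁ k x| ^ p (φ₁ k + N) =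
      |u (φ₁ k + N) x| ^ p (φ₁ k + N) := fun k => (hg₁u k).mono fun x hx => by simp only [hx]
  have hg₁int : ∀ k, Integrable (fun x => |g₁ k x| ^ p (φ₁ k + N)) (volume.restrict U) := fun k =>
    (integrable_congr (hpow k)).2
      (integrable_abs_rpow (hp1 _) ((mem_spaceW_iff hd (hp1 _)).1 (hu _)).2.1)
  have hg₁N : ∀ k, ∫ x in U, |g₁ k x| ^ p (φ₁ k + N) = 1 := fun k => by
    rw [integral_congr_ae (hpow k)]; exact hN _
  obtain ⟨B, hB⟩ := exists_bound_of_normalized hU hQ0 hα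
  have hg₁B : ∀ k, ∀ x ∈ closure U, |g₁ k x| ≤ B := fun k =>
    hB _ (hp1 _) (g₁ k) (hg₁ k) (hg₁int k) (hg₁N k)
  obtain ⟨φ₂, hφ₂, f, hf⟩ := exists_subseq_tendstoUniformlyOn hU.isCompact_closure hα hg₁B hg₁
  set φ : ℕ → ℕ := fun k => φ₁ (φ₂ k) + N with hφ
  have hφm : StrictMono φ := hφN.comp hφ₂
  set g : ℕ → EuclideanSpace ℝ (Fin n) → ℝ := fun k => g₁ (φ₂ k) with hg
  have hgc : ∀ k, Continuous (g k) := fun k => continuous_of_holder hα (hg₁ (φ₂ k))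
  have hpφ : Tendsto (fun k => p (φ k)) atTop atTop := hp.comp hφm.tendsto_atTop
  have hLφ : Tendsto (fun k => (lam U d s (p (φ k))).toReal ^ (1 / p (φ k))) atTop (𝓝 L) :=
    hL.comp hφ₂.tendsto_atTop
  have hL0 : 0 ≤ L := ge_of_tendsto' hLφ fun k => Real.rpow_nonneg ENNReal.toReal_nonneg _
  have hLE : Tendsto (fun k => (energy U d s (p (φ k)) (u (φ k))).toReal ^ (1 / p (φ k))) atTop
      (𝓝 L) := by
    have h1 := ((tendsto_const_rpow_one_div (C := 2) (by norm_num)).comp hpφ).mul hLφ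
    rw [one_mul] at h1
    refine h1.congr fun k => ?_
    rw [hE, Real.mul_rpow (by norm_num) ENNReal.toReal_nonneg, Function.comp]
  have hfU : ∀ x ∈ U, ∀ y ∈ U, |f x - f y| ≤ L * d x y ^ s := fun x hx y hy =>
    abs_sub_le_of_tendsto hU hd hs (fun k => hp1 (φ k)) hpφ (fun k => hu (φ k))
      (fun k => hg₁u (φ₂ k)) hQ0 hα (fun k => hg₁ (φ₂ k)) hLE
      (fun z hz => hf.tendsto_at (subset_closure hz)) hx hy
  have hfcl : ContinuousOn f (closure U) :=
    hf.continuousOn (Eventually.of_forall fun k => (hgc k).continuousOn).frequently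
  have hfc : ContinuousOn f U := hfcl.mono subset_closure
  have hfUu : TendstoUniformlyOn g f atTop U := hf.mono subset_closure
  -- the constraint and the normalization in the limit
  have hψ : ∀ k, ∀ᵐ x ∂volume.restrict U, |g k x| ^ (p (φ k) - 2) * g k x =
      |u (φ k) x| ^ (p (φ k) - 2) * u (φ k) x := fun k =>
    (hg₁u (φ₂ k)).mono fun x hx => by simp only [hg, hφ, hx]
  have : IsFiniteMeasure (volume.restrict U) := isFiniteMeasure_restrict.2 hUt
  have hψint : ∀ k, Integrable (fun x => |g k x| ^ (p (φ k) - 2) * g k x) (volume.restrict U) := by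
    intro k
    refine (integrable_congr (hψ k)).2 ?_
    simpa using (hasDerivAt_integral_abs_rpow (hp1 _)
      ((mem_spaceW_iff hd (hp1 _)).1 (hu (φ k))).2.1 (memLp_const (1 : ℝ))).1
  have hψ0 : ∀ k, ∫ x in U, |g k x| ^ (p (φ k) - 2) * g k x = 0 := fun k => by
    rw [integral_congr_ae (hψ k)]; exact hc _
  have hup : ∀ a : ℝ, 0 ≤ a → (∀ x ∈ U, -a ≤ f x) → ∀ x ∈ U, f x ≤ a := fun a ha hlow =>
    le_of_constraint hU.isOpen hUt (fun k => hp1 (φ k)) hpφ hfUu hfc hψint hψ0 ha hlow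
  have hdown : ∀ a : ℝ, 0 ≤ a → (∀ x ∈ U, f x ≤ a) → ∀ x ∈ U, -a ≤ f x := by
    intro a ha hle x hx
    have h1 := le_of_constraint (g := fun k x => -g k x) (f := fun x => -f x) hU.isOpen hUt
      (fun k => hp1 (φ k)) hpφ hfUu.fun_neg hfc.neg (fun k => by simpa using (hψint k).neg)
      (fun k => by
        simp only [abs_neg, mul_neg]
        rw [integral_neg, hψ0 k, neg_zero]) ha (fun y hy => neg_le_neg (hle y hy)) x hx
    linarith
  have hfB : ∀ x ∈ U, |f x| ≤ B := fun x hx =>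
    le_of_tendsto (hf.tendsto_at (subset_closure hx)).abs
      (Eventually.of_forall fun k => hg₁B (φ₂ k) x (subset_closure hx))
  have hne : (f '' U).Nonempty := hU.isConnected.nonempty.image f
  have hM : IsLUB (f '' U) (sSup (f '' U)) := isLUB_csSup hne ⟨B, by
    rintro _ ⟨x, hx, rfl⟩; exact (abs_le.1 (hfB x hx)).2⟩
  have hm : IsGLB (f '' U) (sInf (f '' U)) := isGLB_csInf hne ⟨-B, by
    rintro _ ⟨x, hx, rfl⟩; exact (abs_le.1 (hfB x hx)).1⟩
  set M := sSup (f '' U) with hMdef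
  set m := sInf (f '' U) with hmdef
  -- the signs of `M` and `m` are not known yet, whence the maxima with `0`
  have hM1 : M ≤ max (-m) 0 := hM.2 (by
    rintro _ ⟨x, hx, rfl⟩
    refine hup _ (le_max_right _ _) (fun y hy => ?_) x hx
    linarith [hm.1 ⟨y, hy, rfl⟩, le_max_left (-m) 0])
  have hm1 : -max M 0 ≤ m := hm.2 (by
    rintro _ ⟨x, hx, rfl⟩
    refine hdown _ (le_max_right _ _) (fun y hy => ?_) x hx
    exact (hM.1 ⟨y, hy, rfl⟩).trans (le_max_left _ _))
  have hone : 1 ≤ max M (-m) := by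
    by_contra! h
    obtain ⟨x, hx, hxa⟩ := exists_lt_abs_of_normalized hUm hUt hpφ hfUu
      (fun k => hg₁int (φ₂ k)) (fun k => hg₁N (φ₂ k))
      (a := max (max M (-m)) 0) (le_max_right _ _) (max_lt h one_pos)
    have h1 := hM.1 ⟨x, hx, rfl⟩
    have h2 := hm.1 ⟨x, hx, rfl⟩
    refine hxa.not_ge (abs_le.2 ⟨?_, ?_⟩)
    · linarith [le_max_left (max M (-m)) 0, le_max_right M (-m)]
    · linarith [le_max_left (max M (-m)) 0, le_max_left M (-m)]
  obtain ⟨hMge, hMm⟩ : 1 ≤ M ∧ M + m = 0 := by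
    rcases le_max_iff.1 hone with h | h
    · have h1 : M ≤ -m := by
        rcases le_max_iff.1 hM1 with h' | h' <;> linarith
      have h2 : -m ≤ M := by
        rw [max_eq_left (by linarith)] at hm1; linarith
      exact ⟨h, by linarith⟩
    · have h1 : -m ≤ M := by
        rcases le_max_iff.1 (neg_le.1 hm1) with h' | h' <;> linarith
      have h2 : M ≤ -m := by
        rw [max_eq_left (by linarith)] at hM1; exact hM1
      exact ⟨by linarith, by linarith⟩
  -- the diameter bound forces equality everywhere
  have h2M := two_mul_sup_le hU hd hs hL0 hfU hM hm hMm
  have hbD : b * diamD U d ^ s = 2 := by rw [hb]; field_simp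
  have hDs : 0 < diamD U d ^ s := by positivity
  have hLD : L * diamD U d ^ s ≤ b * diamD U d ^ s := by gcongr
  have hMeq : M = 1 := by linarith
  have hLeq : L = b := by
    refine le_antisymm hLb (le_of_mul_le_mul_right ?_ hDs)
    rw [hbD]; linarith
  rw [hLeq] at hfU hLφ
  -- outside the closure of `U` the values of `f` are immaterial: replace them by those of
  -- McShane's extension
  obtain ⟨F, hFU, hF⟩ := exists_holder_extension hd.self_eq_zero hd.nonneg hd.symm hd.triangle hs
    hs1.le hb0.le hU.isConnected.nonempty hfU
  have hFc : Continuous F := by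
    rw [← continuousOn_univ]
    exact continuousOn_of_holder hd hs hb0.le fun x _ y _ => hF x y
  have hFcl : Set.EqOn f F (closure U) := by
    have h1 : Set.EqOn f F U := fun x hx => (hFU x hx).symm
    exact h1.of_subset_closure hfcl hFc.continuousOn subset_closure subset_rfl
  have himg : F '' U = f '' U := Set.image_congr hFU
  refine ⟨φ, g, F, hφm, fun k => ⟨hgc k, hg₁u (φ₂ k)⟩, hf.congr_right hFcl, hF, ?_, ?_, hLφ⟩
  · rw [himg, ← hMeq]; exact hM
  · rw [himg, show (-1 : ℝ) = m by linarith]; exact hm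

/-- A normalized minimizer has energy `2 λ`. -/
lemma IsMinimizer.normalized_data {p : ℝ} {u : EuclideanSpace ℝ (Fin n) → ℝ}
    (hd : IsEquivDistance d) (hp : 1 < p) (h : IsMinimizer U d s p u) (hu : normLp U p u = 1) :
    ∫ x in U, |u x| ^ p = 1 ∧
      (energy U d s p u).toReal = 2 * (lam U d s p).toReal := by
  have h1 := normLp_rpow_eq_ofReal hd hp h.1.1
  rw [hu, ENNReal.one_rpow, eq_comm, ENNReal.ofReal_eq_one] at h1
  refine ⟨h1, ?_⟩
  have h2 := h.2
  rw [quotient_eq hd hp h.1.1 (by rw [h1]; exact one_pos), h1] at h2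
  have hE0 : 0 ≤ ∫ z, |pairDiff u z| ^ p ∂pairMeasure U d s p := integral_abs_rpow_nonneg _
  rw [← h2, energy_eq_ofReal hd hp h.1.1, ENNReal.toReal_ofReal hE0,
    ENNReal.toReal_ofReal (by positivity)]
  ring

/-- The limit of `λ^{1/p}`: every sequence of exponents has a subsequence with the right limit. -/
lemma tendsto_lam_rpow (hn : 1 ≤ n) (hU : IsSmoothBoundedDomain U) (hd : IsEquivDistance d)
    (hs : 0 < s) (hs1 : s < 1) :
    Tendsto (fun p : ℝ => (lam U d s p).toReal ^ (1 / p)) atTop (𝓝 (2 / diamD U d ^ s)) := by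
  refine tendsto_of_subseq_tendsto fun p hp => ?_
  obtain ⟨N, hN⟩ := eventually_atTop.1 (hp.eventually_gt_atTop 1)
  have hp1 : ∀ k, 1 < p (k + N) := fun k => hN _ (Nat.le_add_left _ _)
  choose u hu hu1 hu0 huE using fun k => exists_minimizer hn hU hd hs hs1 (hp1 k)
  obtain ⟨φ, -, -, -, -, -, -, -, -, hlim⟩ := exists_subseq_limit hn hU hd hs hs1 hp1
    (hp.comp (tendsto_add_atTop_nat N)) hu hu1 hu0 (fun k => by
      rw [energy_eq_ofReal hd (hp1 k) (hu k), huE, ENNReal.toReal_ofReal (by positivity)])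
  exact ⟨fun k => φ k + N, hlim⟩

end Limit

end FracNeumann

theorem mainTheorem3 (n : ℕ) (hn : 1 ≤ n)
    (U : Set (EuclideanSpace ℝ (Fin n))) (hU : FracNeumann.IsSmoothBoundedDomain U)
    (d : EuclideanSpace ℝ (Fin n) → EuclideanSpace ℝ (Fin n) → ℝ)
    (hd : FracNeumann.IsEquivDistance d)
    (s : ℝ) (hs0 : 0 < s) (hs1 : s < 1) :
    -- the infimum is finite and is the first nonzero eigenvalue
    (∀ p : ℝ, 1 < p → FracNeumann.lam U d s p ≠ ⊤ ∧
      IsLeast {μ : ℝ | μ ≠ 0 ∧ FracNeumann.IsEigenvalue U d s p μ}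
        (FracNeumann.lam U d s p).toReal) ∧
    -- the limit of the eigenvalues
    Tendsto (fun p : ℝ => (FracNeumann.lam U d s p).toReal ^ (1 / p)) atTop
      (𝓝 (2 / FracNeumann.diamD U d ^ s)) ∧
    FracNeumann.LambdaInf U d s = ENNReal.ofReal (2 / FracNeumann.diamD U d ^ s) ∧
    FracNeumann.LambdaNInf U d s = ENNReal.ofReal (2 / FracNeumann.diamD U d ^ s) ∧
    -- subsequential uniform convergence of normalized minimizers, for any `p k → ∞`
    (∀ (p : ℕ → ℝ) (u : ℕ → EuclideanSpace ℝ (Fin n) → ℝ),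
      Tendsto p atTop atTop →
      (∀ k, 1 < p k ∧ FracNeumann.IsMinimizer U d s (p k) (u k) ∧
        FracNeumann.normLp U (p k) (u k) = 1) →
      ∃ (φ : ℕ → ℕ) (g : ℕ → EuclideanSpace ℝ (Fin n) → ℝ)
        (uInf : EuclideanSpace ℝ (Fin n) → ℝ),
        StrictMono φ ∧
        -- `g k` is the continuous representative of `u (φ k)` on the closure of `U`
        (∀ k, ContinuousOn (g k) (closure U) ∧ g k =ᵐ[volume.restrict U] u (φ k)) ∧
        ContinuousOn uInf (closure U) ∧
        TendstoUniformlyOn g uInf atTop (closure U) ∧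
        uInf ∈ FracNeumann.classAN U d s ∧
        FracNeumann.seminormInf U d s uInf / FracNeumann.normLinf U uInf
          = FracNeumann.LambdaNInf U d s ∧
        uInf ∈ FracNeumann.classA U d s ∧
        FracNeumann.energyInf U d s uInf / FracNeumann.normLinf U uInf
          = FracNeumann.LambdaInf U d s) := by
  obtain ⟨hΛ, hΛN⟩ := FracNeumann.Lambda_eq hn hU hd hs0 hs1
  refine ⟨fun p hp => ⟨FracNeumann.lam_ne_top hn hU hd hs0 hs1 hp,
    FracNeumann.isLeast_lam hn hU hd hs0 hs1 hp⟩, FracNeumann.tendsto_lam_rpow hn hU hd hs0 hs1,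
    hΛ, hΛN, fun p u hp h => ?_⟩
  have hdata := fun k => (h k).2.1.normalized_data hd (h k).1 (h k).2.2
  obtain ⟨φ, g, f, hφ, hg, hlim, hf, hM, hm, -⟩ := FracNeumann.exists_subseq_limit hn hU hd hs0 hs1
    (fun k => (h k).1) hp (fun k => (h k).2.1.1.1) (fun k => (hdata k).1)
    (fun k => (h k).2.1.1.2.2) (fun k => (hdata k).2)
  obtain ⟨h1, h2, h3, h4⟩ := FracNeumann.isMinimizer_of_holder hn hU hd hs0 hf hM hm
  exact ⟨φ, g, f, hφ, fun k => ⟨(hg k).1.continuousOn, (hg k).2⟩,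
    hlim.continuousOn (Eventually.of_forall fun k => (hg k).1.continuousOn).frequently, hlim,
    h1, h2.trans hΛN.symm, h3, h4.trans hΛ.symm⟩
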